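/- Let $S$ be the one-holed torus, that is, the torus with one puncture or with one boundary component, and let $(a,b)$ be a pair of generators of its fundamental group, with inverses $A=a^{-1}$, $B=b^{-1}$. Consider unoriented free homotopy classes of closed curves on $S$. The word length of such a class is the number of letters of a shortest word in $a,b,A,B$ representing it, and its mapping class group orbit is the set of its images under all homeomorphisms of $S$. Let $\Phi$ be Euler's totient function (with $\Phi(1)=1$), and let $\ell\ge 0$ be an integer. 1. The number of classes of word length $\ell$ in the mapping class group orbit of $aabAB$ is $4\Phi(\ell-4)$ if $\ell\ge 5$, and $0$ if $\ell\le 4$. 2. The number of classes of word length $\ell$ in the mapping class group orbit of $abaB$ is $2\Phi(\ell/2)$ if $\ell$ is even and $\ell\ge 6$, it is $4$ if $\ell=4$, and it is $0$ if $\ell$ is odd or $\ell\le 2$. -/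

import Mathlib

open scoped unitInterval

/-! ### The one-holed torus -/

/-- The standard torus `ℝ/ℤ × ℝ/ℤ` with a hole of size `r` around the origin. The norm on
`ℝ/ℤ × ℝ/ℤ` is the sup norm of the distances to `0` in `ℝ/ℤ`, so for `0 < r < 1/2` an open square
disc (whose closure is an embedded closed disc) is removed, which leaves the compact torus with one
boundary component, while for `r = 0` only the origin is removed, which leaves the torus with one
puncture. -/
def HoledTorus (r : ℝ) : Type :=
  {p : UnitAddCircle × UnitAddCircle // p ≠ 0 ∧ r ≤ ‖p‖}

instance (r : ℝ) : TopologicalSpace (HoledTorus r) :=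
  inferInstanceAs (TopologicalSpace {p : UnitAddCircle × UnitAddCircle // p ≠ 0 ∧ r ≤ ‖p‖})

/-- A space is a one-holed torus if it is homeomorphic to the torus with one puncture or to the
torus with one boundary component. -/
def IsOneHoledTorus (S : Type*) [TopologicalSpace S] : Prop :=
  ∃ r : ℝ, 0 ≤ r ∧ r < 1 / 2 ∧ Nonempty (S ≃ₜ HoledTorus r)

/-! ### Unoriented free homotopy classes of closed curves -/

/-- A (parametrized, oriented) closed curve: a continuous map on `[0,1]` with equal end values. -/
def ClosedCurve (S : Type*) [TopologicalSpace S] : Type _ :=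
  {γ : C(I, S) // γ 0 = γ 1}

namespace ClosedCurve

variable {S : Type*} [TopologicalSpace S]

/-- Two closed curves are freely homotopic if they are homotopic through closed curves. -/
def FreelyHomotopic (γ δ : ClosedCurve S) : Prop :=
  ContinuousMap.HomotopicWith γ.1 δ.1 (fun f => f 0 = f 1)

/-- The closed curve run through backwards. -/
def reverse (γ : ClosedCurve S) : ClosedCurve S :=
  ⟨γ.1.comp ⟨unitInterval.symm, unitInterval.continuous_symm⟩, by simpa using γ.2.symm⟩

/-- The image of a closed curve under a homeomorphism. -/
def map (h : S ≃ₜ S) (γ : ClosedCurve S) : ClosedCurve S :=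
  ⟨(h : C(S, S)).comp γ.1, by simp [γ.2]⟩

theorem reverse_reverse (γ : ClosedCurve S) : γ.reverse.reverse = γ := by
  apply Subtype.ext
  ext t
  simp [reverse]

theorem FreelyHomotopic.refl (γ : ClosedCurve S) : FreelyHomotopic γ γ :=
  ContinuousMap.HomotopicWith.refl _ γ.2

theorem FreelyHomotopic.symm {γ δ : ClosedCurve S} (h : FreelyHomotopic γ δ) :
    FreelyHomotopic δ γ :=
  ContinuousMap.HomotopicWith.symm h

theorem FreelyHomotopic.trans {γ δ ε : ClosedCurve S} (h : FreelyHomotopic γ δ)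
    (h' : FreelyHomotopic δ ε) : FreelyHomotopic γ ε :=
  ContinuousMap.HomotopicWith.trans h h'

theorem FreelyHomotopic.reverse {γ δ : ClosedCurve S} (h : FreelyHomotopic γ δ) :
    FreelyHomotopic γ.reverse δ.reverse := by
  obtain ⟨F⟩ := h
  refine ⟨⟨⟨⟨fun p => F (p.1, unitInterval.symm p.2), by fun_prop⟩, ?_, ?_⟩, ?_⟩⟩
  · intro t
    simp [ClosedCurve.reverse]
  · intro t
    simp [ClosedCurve.reverse]
  · intro t
    have := F.prop' t
    simpa using this.symm

theorem FreelyHomotopic.map (h : S ≃ₜ S) {γ δ : ClosedCurve S} (H : FreelyHomotopic γ δ) :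
    FreelyHomotopic (γ.map h) (δ.map h) := by
  obtain ⟨F⟩ := H
  refine ⟨⟨⟨⟨fun p => h (F p), by fun_prop⟩, ?_, ?_⟩, ?_⟩⟩
  · intro t
    simp [ClosedCurve.map]
  · intro t
    simp [ClosedCurve.map]
  · intro t
    have := F.prop' t
    simpa using this

/-- Closed curves up to free homotopy and change of orientation. -/
instance unorientedSetoid (S : Type*) [TopologicalSpace S] : Setoid (ClosedCurve S) where
  r γ δ := FreelyHomotopic γ δ ∨ FreelyHomotopic γ δ.reverse
  iseqv :=
    { refl := fun γ => Or.inl (.refl γ)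
      symm := by
        rintro γ δ (h | h)
        · exact Or.inl h.symm
        · have := h.reverse
          rw [reverse_reverse] at this
          exact Or.inr this.symm
      trans := by
        rintro γ δ ε (h | h) (k | k)
        · exact Or.inl (h.trans k)
        · exact Or.inr (h.trans k)
        · exact Or.inr (h.trans k.reverse)
        · have := k.reverse
          rw [reverse_reverse] at this
          exact Or.inl (h.trans this) }

end ClosedCurve

/-- The unoriented free homotopy classes of closed curves on `S`. -/
def CurveClass (S : Type*) [TopologicalSpace S] : Type _ :=
  Quotient (ClosedCurve.unorientedSetoid S)

namespace CurveClass

variable {S : Type*} [TopologicalSpace S]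

/-- The action of a homeomorphism on unoriented free homotopy classes. -/
def map (h : S ≃ₜ S) : CurveClass S → CurveClass S :=
  Quotient.map (ClosedCurve.map h) (by
    rintro γ δ (H | H)
    · exact Or.inl (H.map h)
    · exact Or.inr (H.map h))

/-- The orbit of a class under the mapping class group, the group of components of the group of
all homeomorphisms of `S`. Isotopic homeomorphisms act in the same way on free homotopy classes, so
this is the orbit under homeomorphisms. -/
def orb (α : CurveClass S) : Set (CurveClass S) :=
  {β | ∃ h : S ≃ₜ S, β = α.map h}

/-- The unoriented free homotopy class of an element of the fundamental group. -/
def ofLoop {x : S} (g : FundamentalGroup S x) : CurveClass S :=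
  Quotient.lift (s := Path.Homotopic.setoid x x)
    (fun p : Path x x =>
      Quotient.mk (ClosedCurve.unorientedSetoid S) ⟨p.toContinuousMap, by simp⟩)
    (by
      rintro p q ⟨F⟩
      apply Quotient.sound
      refine Or.inl ⟨⟨F.toHomotopy, ?_⟩⟩
      intro t
      exact (F.source t).trans (F.target t).symm)
    g.toPath

end CurveClass

/-! ### Words -/

/-- The alphabet: two generators `a`, `b` and their inverses `A`, `B`. -/
inductive Letter : Type
  | a | b | A | B

/-- The element of the fundamental group that a letter stands for. -/
noncomputable def Letter.toLoop {S : Type*} [TopologicalSpace S] {x : S} (a b : FundamentalGroup S x) :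
    Letter → FundamentalGroup S x
  | .a => a
  | .b => b
  | .A => a⁻¹
  | .B => b⁻¹

/-- The element of the fundamental group that a word stands for: the letters are run through from
left to right (in Mathlib's convention the product `p * q` runs through `q` first). -/
noncomputable def wordLoop {S : Type*} [TopologicalSpace S] {x : S} (a b : FundamentalGroup S x) :
    List Letter → FundamentalGroup S x
  | [] => 1
  | l :: w => wordLoop a b w * l.toLoop a b

/-- The unoriented free homotopy class labelled by a word. -/
noncomputable def wordClass {S : Type*} [TopologicalSpace S] {x : S} (a b : FundamentalGroup S x)
    (w : List Letter) : CurveClass S :=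
  CurveClass.ofLoop (wordLoop a b w)

/-- The word length of a class: the number of letters of a shortest word that represents it. -/
noncomputable def wordLength {S : Type*} [TopologicalSpace S] {x : S}
    (a b : FundamentalGroup S x) (α : CurveClass S) : ℕ :=
  sInf {n | ∃ w : List Letter, w.length = n ∧ wordClass a b w = α}

/-- The elements of word length `ℓ` in the mapping class group orbit of `α`. -/
def orbOfLength {S : Type*} [TopologicalSpace S] {x : S} (a b : FundamentalGroup S x)
    (α : CurveClass S) (ℓ : ℕ) : Set (CurveClass S) :=
  {β | β ∈ α.orb ∧ wordLength a b β = ℓ}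

/-! The fundamental group of the one-holed torus is free on the horizontal and the vertical loop,
and free homotopy classes up to orientation are conjugacy classes up to inversion (`UConj`,
`CurveClass.ofLoop_eq_iff`). Coordinate exchange, reflection and a Dehn twist realize three
elementary automorphisms. Together with inner automorphisms these generate the automorphism group,
so a mapping class group orbit is an orbit under all automorphisms of the free group
(`orbOfLength_markedClass`), and the theorem becomes a count in that group.

The algebraic core is Nielsen's theory in rank two. Elementary moves and conjugation reach every
generating pair (`generating_pair_induction`), and an automorphism acting trivially on exponent sums
is inner (`exists_eq_conj_of_wt`). Both words are fixed by the twist `a ↦ a`, `b ↦ ba`. Hence, for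
an automorphism `φ` of determinant one, the conjugacy class of the image of either word depends only
on the primitive vector `v` of exponent sums of `φ(a)` (`isConj_of_wt_eq`). Determinant `-1` gives
nothing new, since both words are, up to conjugacy and inversion, invariant under inverting `a`.

For `aabAB` different vectors give different classes: only `v` and `-v` could collide, and a finite
quotient excludes this. For `abaB` the vectors `v` and `-v` give the same class, and the exponent
sums `±2v` separate all others.

A rotation brings `v` to `(p,q)` with `p > 0` and `q ≥ 0`, where a positive automorphism realizes
it. Positive automorphisms fix the commutator `abAB`, so `aabAB` becomes a positive word of length
`p + q` followed by `abAB`, which is cyclically reduced of length `p + q + 4`. If `p` and `q` are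
positive, `abaB` can be carried to a positive word of length `2(p + q)`, the least that its exponent
sums allow; for a unit vector the length is `4`. Since `Φ(n)` primitive vectors of `ℓ¹`-norm `n` lie
in a quarter plane, the counts follow. For `abaB`, length `4` occurs for norm `1` and norm `2`. -/

namespace FreeGroup

/-! ### Common prefixes -/

section CommonPrefix

variable {β : Type*} [DecidableEq β]

/-- The length of the longest common prefix of two lists. -/
def commonPrefix : List β → List β → ℕ
  | x :: l, y :: m => if x = y then commonPrefix l m + 1 else 0
  | _, _ => 0

theorem le_commonPrefix_iff {n : ℕ} {l m : List β} :
    n ≤ commonPrefix l m ↔ n ≤ l.length ∧ n ≤ m.length ∧ l.take n = m.take n := by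
  induction l generalizing m n with
  | nil => cases n <;> simp [commonPrefix]
  | cons x l ih =>
    cases m with
    | nil => cases n <;> simp [commonPrefix]
    | cons y m =>
      cases n with
      | zero => simp
      | succ n =>
        by_cases h : x = y
        · simp [commonPrefix, h, ih]
        · simp [commonPrefix, h]

theorem commonPrefix_comm (l m : List β) : commonPrefix l m = commonPrefix m l := by
  have key (l m : List β) : commonPrefix l m ≤ commonPrefix m l := by
    obtain ⟨h, h', h''⟩ := le_commonPrefix_iff.1 (le_refl (commonPrefix l m))
    exact le_commonPrefix_iff.2 ⟨h', h, h''.symm⟩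
  exact le_antisymm (key l m) (key m l)

theorem commonPrefix_self (l : List β) : commonPrefix l l = l.length :=
  le_antisymm (le_commonPrefix_iff.1 le_rfl).1 (le_commonPrefix_iff.2 ⟨le_rfl, le_rfl, rfl⟩)

/-- The ultrametric inequality: two lists that agree with `m` up to some depth agree with each other
up to that depth. All comparisons of cancellations rest on it. -/
theorem min_commonPrefix_le (l m k : List β) :
    min (commonPrefix l m) (commonPrefix m k) ≤ commonPrefix l k := by
  obtain ⟨h₁, -, h₂⟩ := le_commonPrefix_iff.1 (min_le_left (commonPrefix l m) (commonPrefix m k))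
  obtain ⟨-, h₃, h₄⟩ := le_commonPrefix_iff.1 (min_le_right (commonPrefix l m) (commonPrefix m k))
  exact le_commonPrefix_iff.2 ⟨h₁, h₃, h₂.trans h₄⟩

end CommonPrefix

/-! ### Cancellation in products -/

variable {α : Type*} [DecidableEq α]

theorem norm_mk_of_isReduced {L : List (α × Bool)} (h : IsReduced L) : (mk L).norm = L.length := by
  rw [norm, toWord_mk, h.reduce_eq]

/-- Cancellation stops exactly at the first place where the two words differ, since the letters that
then meet are not inverse to each other. -/
theorem norm_inv_mk_mul_mk {L M : List (α × Bool)} (hL : IsReduced L) (hM : IsReduced M) :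
    ((mk L)⁻¹ * mk M).norm + 2 * commonPrefix L M = L.length + M.length := by
  induction L generalizing M with
  | nil =>
    have : ((mk ([] : List (α × Bool)))⁻¹ * mk M) = mk M := by
      rw [← one_eq_mk]; simp
    rw [this, norm_mk_of_isReduced hM]; simp [commonPrefix]
  | cons x L ih =>
    cases M with
    | nil =>
      have : ((mk (x :: L))⁻¹ * mk []) = (mk (x :: L))⁻¹ := by
        rw [← one_eq_mk]; simp
      rw [this, norm_inv_eq, norm_mk_of_isReduced hL]; simp [commonPrefix]
    | cons y M =>
      by_cases h : x = y
      · subst h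
        have h₁ : (mk (x :: L))⁻¹ * mk (x :: M) = (mk L)⁻¹ * mk M := by
          have e : ∀ N : List (α × Bool), mk (x :: N) = mk [x] * mk N := fun N => by simp
          rw [e L, e M]; group
        have := ih (M := M) (List.IsChain.tail hL) (List.IsChain.tail hM)
        rw [h₁]
        simp only [commonPrefix, if_true, List.length_cons]
        omega
      · have hr : IsReduced (invRev (x :: L) ++ (y :: M)) := by
          have h₁ : IsReduced (invRev (x :: L)) := by
            rw [isReduced_iff_reduce_eq, reduce_invRev, hL.reduce_eq]
          refine List.isChain_append.2 ⟨h₁, hM, ?_⟩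
          rintro ⟨p, q⟩ hp ⟨r, s⟩ hr
          simp [invRev] at hp hr
          obtain ⟨x₁, x₂⟩ := x
          obtain ⟨y₁, y₂⟩ := y
          simp at hp hr h
          obtain ⟨rfl, rfl⟩ := hp
          obtain ⟨rfl, rfl⟩ := hr
          intro e
          have := h e
          revert this; cases q <;> cases y₂ <;> simp
        rw [inv_mk, mul_mk, norm_mk_of_isReduced hr]
        simp [commonPrefix, h, invRev_length]

/-- The number of letters of `g` that cancel in the product `g * h` of reduced words. -/
def cancel (g h : FreeGroup α) : ℕ := commonPrefix g⁻¹.toWord h.toWord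

theorem norm_mul_add (g h : FreeGroup α) : (g * h).norm + 2 * cancel g h = g.norm + h.norm := by
  have := norm_inv_mk_mul_mk (isReduced_toWord (x := g⁻¹)) (isReduced_toWord (x := h))
  rw [mk_toWord, mk_toWord, inv_inv] at this
  rw [cancel, this, ← norm, ← norm, norm_inv_eq]

theorem cancel_inv_inv (g h : FreeGroup α) : cancel h⁻¹ g⁻¹ = cancel g h := by
  rw [cancel, cancel, commonPrefix_comm, inv_inv]

/-- The last `m` letters of `v` are the inverse of the first `m` letters of `v⁻¹`. This turns
statements on cancellation into factorizations. -/
theorem toWord_inv_take_eq {v : FreeGroup α} {n m : ℕ} (h : v.norm = n + m) :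
    v = mk (v.toWord.take n) * (mk (v⁻¹.toWord.take m))⁻¹ := by
  have : invRev (v⁻¹.toWord.take m) = v.toWord.drop n := by
    rw [toWord_inv, invRev, invRev, List.map_take, List.map_reverse, List.map_map]
    rw [← List.reverse_reverse (List.drop n v.toWord)]
    congr 1
    rw [List.reverse_drop]
    have e : v.toWord.length - n = m := by
      have : v.toWord.length = n + m := h
      omega
    rw [e]
    congr 1
    conv_rhs => rw [← List.map_id v.toWord]
    congr 2
    funext x
    simp
  rw [inv_mk, this, mul_mk, List.take_append_drop, mk_toWord]

/-- If half of `v` cancelled against `v`, then `v = p * p⁻¹` for even length, and for odd length the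
middle letter would be its own inverse. -/
theorem two_mul_cancel_self_lt {v : FreeGroup α} (hv : v ≠ 1) : 2 * cancel v v < v.norm := by
  by_contra! h
  obtain ⟨h₁, h₂, h₃⟩ := le_commonPrefix_iff.1 (le_refl (cancel v v))
  obtain ⟨m, hm | hm⟩ : ∃ m, v.norm = m + m ∨ v.norm = 2 * m + 1 := by
    obtain ⟨m, hm⟩ := Nat.even_or_odd' v.norm
    exact ⟨m, by omega⟩
  · have hm' : m ≤ cancel v v := by omega
    have := toWord_inv_take_eq hm
    have h₄ : v⁻¹.toWord.take m = v.toWord.take m := by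
      have := congrArg (List.take m) h₃
      rwa [List.take_take, List.take_take, min_eq_left hm'] at this
    rw [h₄, mul_inv_cancel] at this
    exact hv this
  · have hm' : m + 1 ≤ cancel v v := by omega
    have hl : v.toWord.length = 2 * m + 1 := hm
    have h₄ := congrArg (fun l => l[m]?) h₃
    simp only [List.getElem?_take] at h₄
    rw [if_pos (by omega), if_pos (by omega), toWord_inv, invRev, List.getElem?_reverse (by
      simp [hl]; omega)] at h₄
    simp only [List.length_map, hl, List.getElem?_map] at h₄
    have e : 2 * m + 1 - 1 - m = m := by omega
    rw [e] at h₄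
    rw [List.getElem?_eq_getElem (by omega)] at h₄
    have := congrArg Prod.snd (Option.some.inj h₄)
    simp at this

end FreeGroup

namespace FreeGroup

variable {α : Type*} [DecidableEq α]

/-! ### Products without long cancellation -/

/-- Here `d` is the number of letters that the first factor loses to the rest of the product. Since
cancellation from the left and from the right never meet inside a factor, the product still begins
with the surviving part of `U i`, so `d` depends on the next factor alone and every factor keeps a
letter. -/
theorem norm_prod_of_cancel_add_lt_aux {ι : Type*} {R : ι → ι → Prop} (hR : ∀ i, R i i)
    (U : ι → FreeGroup α)
    (h : ∀ i j k, R i j → R j k → cancel (U i) (U j) + cancel (U j) (U k) < (U j).norm)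
    (i : ι) (l : List ι) (hl : (i :: l).IsChain R) :
    ∃ d, (d = 0 ∨ ∃ j, R i j ∧ d = cancel (U i) (U j)) ∧
      commonPrefix ((i :: l).map U).prod.toWord (U i).toWord + d = (U i).norm ∧
      l.length + (U i).norm ≤ ((i :: l).map U).prod.norm + d := by
  induction l generalizing i with
  | nil => exact ⟨0, Or.inl rfl, by simp [commonPrefix_self, norm], by simp⟩
  | cons j l ih =>
    obtain ⟨hij, hl'⟩ := List.isChain_cons_cons.1 hl
    obtain ⟨d, hd, h₁, h₂⟩ := ih j hl'
    set Q := ((j :: l).map U).prod with hQ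
    have hP : ((i :: j :: l).map U).prod = U i * Q := by simp [hQ]
    rw [hP]
    have hlt : cancel (U i) (U j) + d < (U j).norm := by
      rcases hd with rfl | ⟨k, hk, rfl⟩
      · have := h i j j hij (hR j); omega
      · exact h i j k hij hk
    have hc : cancel (U i) Q = cancel (U i) (U j) := by
      have h₃ := min_commonPrefix_le (U i)⁻¹.toWord (U j).toWord Q.toWord
      have h₄ := min_commonPrefix_le (U i)⁻¹.toWord Q.toWord (U j).toWord
      rw [commonPrefix_comm (U j).toWord] at h₃
      unfold cancel at hlt ⊢
      omega
    refine ⟨cancel (U i) (U j), Or.inr ⟨j, hij, rfl⟩, ?_, ?_⟩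
    · have h₃ := norm_mul_add (U i * Q)⁻¹ (U i)
      have h₄ := norm_mul_add (U i) Q
      rw [cancel, inv_inv] at h₃
      have e : (U i * Q)⁻¹ * U i = Q⁻¹ := by group
      rw [e, norm_inv_eq, norm_inv_eq] at h₃
      omega
    · have h₄ := norm_mul_add (U i) Q
      simp only [List.length_cons]
      omega

theorem length_le_norm_prod_of_cancel_add_lt {ι : Type*} {R : ι → ι → Prop} (hR : ∀ i, R i i)
    (U : ι → FreeGroup α)
    (h : ∀ i j k, R i j → R j k → cancel (U i) (U j) + cancel (U j) (U k) < (U j).norm)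
    (l : List ι) (hl : l.IsChain R) : l.length ≤ (l.map U).prod.norm := by
  cases l with
  | nil => simp
  | cons i l =>
    obtain ⟨d, hd, -, h₂⟩ := norm_prod_of_cancel_add_lt_aux hR U h i l hl
    have : d < (U i).norm := by
      rcases hd with rfl | ⟨k, hk, rfl⟩
      · have := h i i i (hR i) (hR i); omega
      · have := h i i k (hR i) hk; omega
    simp only [List.length_cons]
    omega

/-- The hypotheses force `v = p * q⁻¹` and `u = q * s * p⁻¹` with `p`, `q` of length `m`.
Conjugation by `q` turns `v` into `q⁻¹ * p` and `u * v` into `s`. This handles the case in which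
half of `v` cancels on both sides. -/
theorem exists_conj_norm_add_lt {u v : FreeGroup α} {m : ℕ} (hv : v ≠ 1) (hm : v.norm = m + m)
    (hu : m + m ≤ u.norm) (huv : m ≤ cancel u v) (hvu : m ≤ cancel v u) :
    ∃ g, (g⁻¹ * v * g).norm + (g⁻¹ * (u * v) * g).norm < u.norm + v.norm := by
  have hm0 : 0 < m := by
    have : v.norm ≠ 0 := by rwa [Ne, norm_eq_zero]
    omega
  set p := v.toWord.take m with hp
  set q := v⁻¹.toWord.take m with hq
  have hvpq : v = mk p * (mk q)⁻¹ := toWord_inv_take_eq hm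
  have hup : u⁻¹.toWord.take m = p := (le_commonPrefix_iff.1 huv).2.2
  have huq : u.toWord.take m = q := (le_commonPrefix_iff.1 hvu).2.2.symm
  have hu' := toWord_inv_take_eq (v := u) (n := u.norm - m) (m := m) (by omega)
  rw [hup] at hu'
  set s := (u.toWord.take (u.norm - m)).drop m with hs
  have hqs : u.toWord.take (u.norm - m) = q ++ s := by
    rw [← List.take_append_drop m (u.toWord.take (u.norm - m)), List.take_take,
      min_eq_left (by omega), huq]
  have hus : u = mk q * mk s * (mk p)⁻¹ := by rw [mul_mk, ← hqs]; exact hu'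
  refine ⟨mk q, ?_⟩
  have e₁ : (mk q)⁻¹ * v * mk q = (mk q)⁻¹ * mk p := by
    rw [hvpq]; group
  have e₂ : (mk q)⁻¹ * (u * v) * mk q = mk s := by
    rw [hvpq, hus]; group
  have l₁ : ((mk q)⁻¹ * mk p).norm ≤ m + m := by
    refine (norm_mul_le _ _).trans (add_le_add ?_ ?_)
    · rw [norm_inv_eq]; exact norm_mk_le.trans (by simp [hq])
    · exact norm_mk_le.trans (by simp [hp])
  have l₂ : (mk s).norm ≤ u.norm - m - m := norm_mk_le.trans (by simp [hs]; omega)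
  rw [e₁, e₂]
  omega

/-! ### Nielsen's theorem in rank two -/

/-- The value of a letter at a pair of elements. -/
def letterVal {G : Type*} [Group G] (x y : G) (i : Bool × Bool) : G :=
  cond i.2 (cond i.1 x y) (cond i.1 x y)⁻¹

theorem lift_cond_mk {G : Type*} [Group G] (x y : G) (L : List (Bool × Bool)) :
    lift (fun t => cond t x y) (mk L) = (L.map (letterVal x y)).prod := by
  rw [lift_mk]; rfl

theorem ne_one_of_closure_pair_eq_top {x y : FreeGroup Bool}
    (h : Subgroup.closure {x, y} = ⊤) : x ≠ 1 := by
  rintro rfl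
  have hle : Subgroup.closure {1, y} ≤ Subgroup.zpowers y := by
    rw [Subgroup.closure_le]
    rintro z (rfl | rfl)
    exacts [one_mem _, Subgroup.mem_zpowers z]
  rw [h] at hle
  obtain ⟨m, hm⟩ := Subgroup.mem_zpowers_iff.1 (hle (Subgroup.mem_top (of true)))
  obtain ⟨n, hn⟩ := Subgroup.mem_zpowers_iff.1 (hle (Subgroup.mem_top (of false)))
  have hc : of true * of false = of false * of true := by
    rw [← hm, ← hn]; exact ((Commute.refl y).zpow_zpow m n).eq
  revert hc
  decide

/-- A property of pairs of elements of the free group of rank two that holds for the standard basis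
and is preserved by the elementary moves and by simultaneous conjugation holds for all generating
pairs. -/
theorem generating_pair_induction {P : FreeGroup Bool → FreeGroup Bool → Prop}
    (base : P (of true) (of false)) (swap : ∀ x y, P x y → P y x)
    (inv : ∀ x y, P x y → P x⁻¹ y) (mul : ∀ x y, P x y → P (x * y) y)
    (conj : ∀ g x y, P x y → P (g * x * g⁻¹) (g * y * g⁻¹)) (x y : FreeGroup Bool)
    (hxy : Subgroup.closure {x, y} = ⊤) : P x y := by
  have toLetters : ∀ x y, P x y → ∀ i j : Bool × Bool, i.1 ≠ j.1 →
      P (letterVal x y i) (letterVal x y j) := by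
    intro x y h
    have h₁ := inv x y h
    have h₂ := swap _ _ h
    have h₃ := swap _ _ h₁
    have h₄ := inv _ _ h₂
    have h₅ := inv _ _ h₃
    have h₆ := swap _ _ h₄
    have h₇ := swap _ _ h₅
    rintro ⟨_ | _, _ | _⟩ ⟨_ | _, _ | _⟩ hij <;> simp [letterVal] at hij ⊢ <;> assumption
  have ofLetters : ∀ x y, ∀ i j : Bool × Bool, i.1 ≠ j.1 →
      P (letterVal x y i) (letterVal x y j) → P x y := by
    intro x y i j hij h
    have k₁ := toLetters _ _ h (true, i.2) (false, j.2) (by simp)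
    have k₂ := swap _ _ k₁
    obtain ⟨_ | _, _ | _⟩ := i <;> obtain ⟨_ | _, _ | _⟩ := j <;>
      simp [letterVal] at hij k₁ k₂ <;> assumption
  induction hn : x.norm + y.norm using Nat.strong_induction_on generalizing x y with
  | _ n ih =>
  subst hn
  -- A pair with smaller total norm that generates is good.
  have small : ∀ x' y', x'.norm + y'.norm < x.norm + y.norm →
      Subgroup.closure {x', y'} = ⊤ → P x' y' := fun x' y' hlt h => ih _ hlt _ _ h rfl
  have eq_top : ∀ H : Subgroup (FreeGroup Bool), x ∈ H ∧ y ∈ H → H = ⊤ := by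
    rintro H ⟨hx, hy⟩
    rw [eq_top_iff, ← hxy, Subgroup.closure_le]
    rintro z (rfl | rfl)
    exacts [hx, hy]
  by_contra hP
  set U := letterVal x y with hU
  have hx : x ≠ 1 := ne_one_of_closure_pair_eq_top hxy
  have hy : y ≠ 1 := ne_one_of_closure_pair_eq_top (x := y) (y := x) (by rwa [Set.pair_comm])
  have hne : ∀ i, U i ≠ 1 := by
    rintro ⟨_ | _, _ | _⟩ <;> simp [hU, letterVal, hx, hy]
  have hinv : ∀ i : Bool × Bool, (U i)⁻¹ = U (i.1, !i.2) := by
    rintro ⟨_ | _, _ | _⟩ <;> simp [hU, letterVal]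
  have hnorm : ∀ i j : Bool × Bool, i.1 ≠ j.1 →
      (U i).norm + (U j).norm = x.norm + y.norm := by
    rintro ⟨_ | _, _ | _⟩ ⟨_ | _, _ | _⟩ hij <;>
      simp [hU, letterVal, norm_inv_eq, add_comm] at hij ⊢
  have hmem : ∀ (H : Subgroup (FreeGroup Bool)) (i j : Bool × Bool), i.1 ≠ j.1 →
      U i ∈ H → U j ∈ H → x ∈ H ∧ y ∈ H := by
    rintro H ⟨_ | _, _ | _⟩ ⟨_ | _, _ | _⟩ hij <;>
      simp +contextual [hU, letterVal] at hij ⊢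
  have mulInv : ∀ x y, P x y → P (x * y⁻¹) y := by
    intro x y h
    have h₁ := swap _ _ (inv _ _ (swap _ _ (mul _ _ (swap _ _ (inv _ _ (swap _ _ h))))))
    rwa [inv_inv] at h₁
  -- Otherwise `(U i * U j, U j)` is a generating pair of smaller total norm, so it is good, and an
  -- elementary move leads back to `(U i, U j)`.
  have hmul : ∀ i j : Bool × Bool, i.1 ≠ j.1 → (U i).norm ≤ (U i * U j).norm := by
    intro i j hij
    by_contra! hlt
    refine hP (ofLetters x y i j hij ?_)
    have hj : U j ∈ Subgroup.closure {U i * U j, U j} := Subgroup.subset_closure (by simp)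
    have hi : U i ∈ Subgroup.closure {U i * U j, U j} := by
      have := mul_mem (s := Subgroup.closure {U i * U j, U j})
        (Subgroup.subset_closure (Set.mem_insert _ _)) (inv_mem hj)
      rwa [mul_inv_cancel_right] at this
    have := mulInv _ _ (small _ _ (by rw [← hnorm i j hij]; omega)
      (eq_top _ (hmem _ i j hij hi hj)))
    rwa [mul_inv_cancel_right] at this
  have hcancel : ∀ i j : Bool × Bool, i.1 ≠ j.1 → 2 * cancel (U i) (U j) ≤ (U j).norm := by
    intro i j hij
    have := norm_mul_add (U i) (U j)
    have := hmul i j hij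
    omega
  have hcancel' : ∀ i j : Bool × Bool, i.1 ≠ j.1 → 2 * cancel (U i) (U j) ≤ (U i).norm := by
    intro i j hij
    have := hcancel (j.1, !j.2) (i.1, !i.2) hij.symm
    rwa [← hinv, ← hinv, cancel_inv_inv, norm_inv_eq] at this
  -- Adjacency of letters in a reduced word: equal generators must have equal signs.
  let R : Bool × Bool → Bool × Bool → Prop := fun i j => i.1 = j.1 → i.2 = j.2
  have hstrict : ∀ i j k, R i j → R j k →
      cancel (U i) (U j) + cancel (U j) (U k) < (U j).norm := by
    intro i j k hij hjk
    have hself := two_mul_cancel_self_lt (hne j)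
    by_cases h₁ : i.1 = j.1
    · obtain rfl : i = j := Prod.ext h₁ (hij h₁)
      by_cases h₂ : i.1 = k.1
      · obtain rfl : i = k := Prod.ext h₂ (hjk h₂)
        omega
      · have := hcancel' i k h₂
        omega
    have h₁' := hcancel i j h₁
    by_cases h₂ : j.1 = k.1
    · obtain rfl : j = k := Prod.ext h₂ (hjk h₂)
      omega
    have h₂' := hcancel' j k h₂
    -- Now both neighbours cancel exactly half of `U j`. No single multiplication shortens the pair,
    -- so this case needs its own argument.
    by_contra! hle
    have hik : i.1 = k.1 := by
      revert h₁ h₂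
      cases i.1 <;> cases j.1 <;> cases k.1 <;> simp
    by_cases hik' : i.2 = k.2
    · obtain rfl : i = k := Prod.ext hik hik'
      obtain ⟨g, hg⟩ := exists_conj_norm_add_lt (u := U i) (v := U j)
        (m := cancel (U i) (U j)) (hne j) (by omega) (by have := hcancel' i j h₁; omega)
        le_rfl (by omega)
      have hj : U j ∈ Subgroup.closure {U j, U i * U j} := Subgroup.subset_closure (by simp)
      have hi : U i ∈ Subgroup.closure {U j, U i * U j} := by
        have := mul_mem (s := Subgroup.closure {U j, U i * U j})
          (Subgroup.subset_closure (Set.mem_insert_of_mem _ rfl)) (inv_mem hj)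
        rwa [mul_inv_cancel_right] at this
      have htop : Subgroup.closure {g⁻¹ * U j * g, g⁻¹ * (U i * U j) * g} = ⊤ := by
        have := congrArg (Subgroup.map (MulAut.conj g⁻¹).toMonoidHom)
          (eq_top _ (hmem _ i j h₁ hi hj))
        rw [MonoidHom.map_closure, Set.image_pair, ← MonoidHom.range_eq_map,
          MonoidHom.range_eq_top.2 (MulAut.conj g⁻¹).surjective] at this
        simpa using this
      have h₃ := conj g _ _ (small _ _ (by rw [← hnorm i j h₁]; omega) htop)
      have e₁ : g * (g⁻¹ * U j * g) * g⁻¹ = U j := by group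
      have e₂ : g * (g⁻¹ * (U i * U j) * g) * g⁻¹ = U i * U j := by group
      rw [e₁, e₂] at h₃
      have h₄ := mulInv _ _ (swap _ _ h₃)
      rw [mul_inv_cancel_right] at h₄
      exact hP (ofLetters x y i j h₁ h₄)
    -- Half of `U j` and half of `(U j)⁻¹` are both prefixes of `(U i)⁻¹`, so half of `U j` would
    -- cancel in its own square.
    · have hk : U k = (U i)⁻¹ := by
        rw [hinv]
        congr 1
        refine Prod.ext hik.symm ?_
        revert hik'
        cases i.2 <;> cases k.2 <;> simp
      rw [hk] at hle h₂'
      have := min_commonPrefix_le (U j)⁻¹.toWord (U i)⁻¹.toWord (U j).toWord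
      unfold cancel at *
      omega
  -- A word in `x` and `y` has norm at least its own length. Hence a generator of the free group,
  -- having norm one, is a single letter in `x` and `y`, and the pair is the standard basis up to
  -- signs and order.
  have hlen : ∀ g : FreeGroup Bool,
      g.toWord.length ≤ (lift (fun t => cond t x y) g).norm := by
    intro g
    have := length_le_norm_prod_of_cancel_add_lt (R := R) (fun i _ => rfl) U hstrict g.toWord
      isReduced_toWord
    rwa [hU, ← lift_cond_mk, mk_toWord] at this
  have hsurj : Function.Surjective (lift (fun t => cond t x y)) := by
    rw [← MonoidHom.range_eq_top, eq_top_iff, ← hxy, Subgroup.closure_le]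
    rintro z (rfl | rfl)
    exacts [⟨of true, by simp⟩, ⟨of false, by simp⟩]
  have hletter : ∀ t, ∃ i, U i = of t := by
    intro t
    obtain ⟨g, hg⟩ := hsurj (of t)
    have hl := hlen g
    rw [hg, norm_of] at hl
    have hg' : g = mk g.toWord := mk_toWord.symm
    rw [hg', lift_cond_mk] at hg
    match hw : g.toWord, hl with
    | [], _ => rw [hw] at hg; exact absurd hg.symm (of_ne_one t)
    | [i], _ => rw [hw] at hg; exact ⟨i, by simpa using hg⟩
    | _ :: _ :: _, hl => simp at hl
  obtain ⟨i, hi⟩ := hletter true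
  obtain ⟨j, hj⟩ := hletter false
  have hij : i.1 ≠ j.1 := by
    intro h
    obtain ⟨i₁, i₂⟩ := i
    obtain ⟨j₁, j₂⟩ := j
    obtain rfl : i₁ = j₁ := h
    by_cases h₂ : i₂ = j₂
    · rw [h₂, hj] at hi
      exact absurd (of_injective hi) (by simp)
    · have : U (i₁, j₂) = (U (i₁, i₂))⁻¹ := by
        rw [hinv]
        congr 2
        revert h₂
        cases i₂ <;> cases j₂ <;> simp
      rw [hj, hi] at this
      revert this
      decide
  refine hP (ofLetters x y i j hij ?_)
  rw [← hU, hi, hj]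
  exact base

end FreeGroup

namespace FreeGroup

/-! ### Elementary automorphisms of the free group of rank two -/

/-- The substitution endomorphism. -/
def subst (x y : FreeGroup Bool) : FreeGroup Bool →* FreeGroup Bool := lift (fun t => cond t x y)

@[simp] theorem subst_of_true (x y : FreeGroup Bool) : subst x y (of true) = x := by simp [subst]

@[simp] theorem subst_of_false (x y : FreeGroup Bool) : subst x y (of false) = y := by simp [subst]

theorem hom_ext_bool {G : Type*} [Group G] {f g : FreeGroup Bool →* G}
    (h₁ : f (of true) = g (of true)) (h₂ : f (of false) = g (of false)) : f = g := by
  ext t; cases t <;> assumption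

theorem mulAut_ext_bool {f g : MulAut (FreeGroup Bool)}
    (h₁ : f (of true) = g (of true)) (h₂ : f (of false) = g (of false)) : f = g := by
  have : f.toMonoidHom = g.toMonoidHom := hom_ext_bool h₁ h₂
  ext x
  exact DFunLike.congr_fun this x

/-- The automorphism exchanging the two generators. -/
def swapAut : MulAut (FreeGroup Bool) :=
  (subst (of false) (of true)).toMulEquiv (subst (of false) (of true))
    (hom_ext_bool (by simp) (by simp)) (hom_ext_bool (by simp) (by simp))

/-- The automorphism inverting the first generator. -/
def invAut : MulAut (FreeGroup Bool) :=
  (subst (of true)⁻¹ (of false)).toMulEquiv (subst (of true)⁻¹ (of false))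
    (hom_ext_bool (by simp) (by simp)) (hom_ext_bool (by simp) (by simp))

/-- The automorphism `a ↦ ab`, `b ↦ b`. -/
def mulAut₁ : MulAut (FreeGroup Bool) :=
  (subst (of true * of false) (of false)).toMulEquiv (subst (of true * (of false)⁻¹) (of false))
    (hom_ext_bool (by simp) (by simp)) (hom_ext_bool (by simp) (by simp))

/-- The automorphism `a ↦ a`, `b ↦ ba`. -/
def mulAut₂ : MulAut (FreeGroup Bool) :=
  (subst (of true) (of false * of true)).toMulEquiv (subst (of true) (of false * (of true)⁻¹))
    (hom_ext_bool (by simp) (by simp)) (hom_ext_bool (by simp) (by simp))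

@[simp] theorem swapAut_true : swapAut (of true) = of false := by simp [swapAut]
@[simp] theorem swapAut_false : swapAut (of false) = of true := by simp [swapAut]
@[simp] theorem invAut_true : invAut (of true) = (of true)⁻¹ := by simp [invAut]
@[simp] theorem invAut_false : invAut (of false) = of false := by simp [invAut]
@[simp] theorem mulAut₁_true : mulAut₁ (of true) = of true * of false := by simp [mulAut₁]
@[simp] theorem mulAut₁_false : mulAut₁ (of false) = of false := by simp [mulAut₁]
@[simp] theorem mulAut₂_true : mulAut₂ (of true) = of true := by simp [mulAut₂]
@[simp] theorem mulAut₂_false : mulAut₂ (of false) = of false * of true := by simp [mulAut₂]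

theorem swapAut_mul_self : swapAut * swapAut = 1 := mulAut_ext_bool (by simp) (by simp)
theorem invAut_mul_self : invAut * invAut = 1 := mulAut_ext_bool (by simp) (by simp)
theorem swapAut_inv : swapAut⁻¹ = swapAut := inv_eq_of_mul_eq_one_left swapAut_mul_self
theorem invAut_inv : invAut⁻¹ = invAut := inv_eq_of_mul_eq_one_left invAut_mul_self

/-- Elementary moves of a pair are right multiplications of the automorphism by `swapAut`, `invAut`,
`mulAut₁`; simultaneous conjugation is left multiplication by an inner automorphism. -/
theorem exists_mulAut_of_closure_eq_top {x y : FreeGroup Bool}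
    (h : Subgroup.closure {x, y} = ⊤) :
    ∃ φ : MulAut (FreeGroup Bool), φ (of true) = x ∧ φ (of false) = y := by
  refine generating_pair_induction
    (P := fun x y => ∃ φ : MulAut (FreeGroup Bool), φ (of true) = x ∧ φ (of false) = y)
    ⟨1, rfl, rfl⟩ ?_ ?_ ?_ ?_ x y h
  · rintro x y ⟨φ, rfl, rfl⟩; exact ⟨φ * swapAut, by simp, by simp⟩
  · rintro x y ⟨φ, rfl, rfl⟩; exact ⟨φ * invAut, by simp, by simp⟩
  · rintro x y ⟨φ, rfl, rfl⟩; exact ⟨φ * mulAut₁, by simp, by simp⟩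
  · rintro g x y ⟨φ, rfl, rfl⟩; exact ⟨MulAut.conj g * φ, by simp, by simp⟩

theorem closure_of_eq_top : Subgroup.closure {of true, of false} = (⊤ : Subgroup (FreeGroup Bool)) := by
  rw [← FreeGroup.closure_range_of]
  congr 1
  ext x
  simp [or_comm]

theorem mulAut_induction {Q : MulAut (FreeGroup Bool) → Prop} (one : Q 1)
    (swap : ∀ φ, Q φ → Q (φ * swapAut)) (inv : ∀ φ, Q φ → Q (φ * invAut))
    (mul : ∀ φ, Q φ → Q (φ * mulAut₁)) (conj : ∀ g φ, Q φ → Q (MulAut.conj g * φ))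
    (φ : MulAut (FreeGroup Bool)) : Q φ := by
  have key := generating_pair_induction
    (P := fun x y => ∃ φ : MulAut (FreeGroup Bool), Q φ ∧ φ (of true) = x ∧ φ (of false) = y)
    ⟨1, one, rfl, rfl⟩ ?_ ?_ ?_ ?_ (φ (of true)) (φ (of false)) ?_
  · obtain ⟨ψ, h, h₁, h₂⟩ := key
    rwa [← mulAut_ext_bool h₁ h₂]
  · rintro x y ⟨φ, h, rfl, rfl⟩; exact ⟨φ * swapAut, swap _ h, by simp, by simp⟩
  · rintro x y ⟨φ, h, rfl, rfl⟩; exact ⟨φ * invAut, inv _ h, by simp, by simp⟩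
  · rintro x y ⟨φ, h, rfl, rfl⟩; exact ⟨φ * mulAut₁, mul _ h, by simp, by simp⟩
  · rintro g x y ⟨φ, h, rfl, rfl⟩; exact ⟨MulAut.conj g * φ, conj _ _ h, by simp, by simp⟩
  · have := congrArg (Subgroup.map φ.toMonoidHom) closure_of_eq_top
    rwa [MonoidHom.map_closure, Set.image_pair, ← MonoidHom.range_eq_map,
      MonoidHom.range_eq_top.2 φ.surjective] at this

/-! ### Abelianization -/

/-- The exponent sums of an element of the free group of rank two. -/
def wt (g : FreeGroup Bool) : ℤ × ℤ :=
  (lift (fun t => Multiplicative.ofAdd (cond t ((1 : ℤ), (0 : ℤ)) (0, 1))) g).toAdd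

@[simp] theorem wt_one : wt 1 = 0 := by simp [wt]
@[simp] theorem wt_mul (g h : FreeGroup Bool) : wt (g * h) = wt g + wt h := by simp [wt]
@[simp] theorem wt_inv (g : FreeGroup Bool) : wt g⁻¹ = -wt g := by simp [wt]
@[simp] theorem wt_true : wt (of true) = (1, 0) := by simp [wt]
@[simp] theorem wt_false : wt (of false) = (0, 1) := by simp [wt]
@[simp] theorem wt_zpow (g : FreeGroup Bool) (n : ℤ) : wt (g ^ n) = n • wt g := by simp [wt]

theorem wt_eq_of_isConj {g h : FreeGroup Bool} (H : IsConj g h) : wt g = wt h := by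
  obtain ⟨c, rfl⟩ := isConj_iff.1 H
  simp

theorem wt_hom_apply (f : FreeGroup Bool →* FreeGroup Bool) (g : FreeGroup Bool) :
    wt (f g) = (wt g).1 • wt (f (of true)) + (wt g).2 • wt (f (of false)) := by
  induction g using FreeGroup.induction_on with
  | C1 => simp
  | of t => cases t <;> simp
  | inv_of t h => rw [_root_.map_inv, wt_inv, h, wt_inv]; simp; abel
  | mul x y hx hy => rw [_root_.map_mul, wt_mul, hx, hy, wt_mul]; simp [add_smul]; abel

theorem wt_apply (φ : MulAut (FreeGroup Bool)) (g : FreeGroup Bool) :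
    wt (φ g) = (wt g).1 • wt (φ (of true)) + (wt g).2 • wt (φ (of false)) :=
  wt_hom_apply φ.toMonoidHom g

/-- The determinant of the action on the abelianization. -/
def det (φ : MulAut (FreeGroup Bool)) : ℤ :=
  (wt (φ (of true))).1 * (wt (φ (of false))).2 - (wt (φ (of true))).2 * (wt (φ (of false))).1

theorem det_mul (φ ψ : MulAut (FreeGroup Bool)) : det (φ * ψ) = det φ * det ψ := by
  simp only [det, MulAut.mul_apply]
  rw [wt_apply φ (ψ (of true)), wt_apply φ (ψ (of false))]
  simp
  ring

@[simp] theorem det_one : det 1 = 1 := by simp [det]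
@[simp] theorem det_swapAut : det swapAut = -1 := by simp [det]
@[simp] theorem det_invAut : det invAut = -1 := by simp [det]
@[simp] theorem det_mulAut₁ : det mulAut₁ = 1 := by simp [det]
@[simp] theorem det_mulAut₂ : det mulAut₂ = 1 := by simp [det]
@[simp] theorem det_conj (g : FreeGroup Bool) : det (MulAut.conj g) = 1 := by simp [det]

theorem det_eq_or (φ : MulAut (FreeGroup Bool)) : det φ = 1 ∨ det φ = -1 := by
  refine mulAut_induction (Q := fun φ => det φ = 1 ∨ det φ = -1) (by simp) ?_ ?_ ?_ ?_ φ
  all_goals (intros; simp only [det_mul, det_swapAut, det_invAut, det_mulAut₁, det_conj]; omega)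

theorem natAbs_wt_le_norm (g : FreeGroup Bool) :
    (wt g).1.natAbs + (wt g).2.natAbs ≤ g.norm := by
  have key : ∀ L : List (Bool × Bool), (wt (mk L)).1.natAbs + (wt (mk L)).2.natAbs ≤ L.length := by
    intro L
    induction L with
    | nil => rw [← one_eq_mk]; simp
    | cons x L ih =>
      have e : mk (x :: L) = mk [x] * mk L := by simp
      have h₁ : mk [(true, true)] = of true := rfl
      have h₂ : mk [(false, true)] = of false := rfl
      have h₃ : mk [(true, false)] = (of true)⁻¹ := rfl
      have h₄ : mk [(false, false)] = (of false)⁻¹ := rfl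
      rw [e, wt_mul]
      obtain ⟨_ | _, _ | _⟩ := x <;> simp only [h₁, h₂, h₃, h₄, wt_inv, wt_true, wt_false,
        Prod.fst_add, Prod.snd_add, Prod.fst_neg, Prod.snd_neg, List.length_cons] <;> omega
  have := key g.toWord
  rwa [mk_toWord] at this

end FreeGroup

namespace FreeGroup

/-! ### Automorphisms acting trivially on the abelianization are inner -/

instance normal_range_conj {G : Type*} [Group G] : (MulAut.conj (G := G)).range.Normal := by
  refine ⟨?_⟩
  rintro _ ⟨g, rfl⟩ φ
  refine ⟨φ g, ?_⟩
  ext x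
  simp [MulAut.conj_apply]

/-- The outer automorphism class. -/
def toOut (G : Type*) [Group G] : MulAut G →* MulAut G ⧸ (MulAut.conj (G := G)).range :=
  QuotientGroup.mk' _

theorem toOut_conj {G : Type*} [Group G] (g : G) : toOut G (MulAut.conj g) = 1 :=
  (QuotientGroup.eq_one_iff _).2 ⟨g, rfl⟩

theorem exists_conj_of_toOut_eq {G : Type*} [Group G] {φ ψ : MulAut G}
    (h : toOut G φ = toOut G ψ) : ∃ g, φ = MulAut.conj g * ψ := by
  obtain ⟨g, hg⟩ : φ * ψ⁻¹ ∈ (MulAut.conj (G := G)).range := by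
    rw [← QuotientGroup.eq_one_iff]
    change toOut G (φ * ψ⁻¹) = 1
    rw [_root_.map_mul, _root_.map_inv, h, mul_inv_cancel]
  exact ⟨g, by rw [hg, inv_mul_cancel_right]⟩

/-- The signed permutations of the generators. -/
def signedPerm : Submonoid (MulAut (FreeGroup Bool)) := Submonoid.closure {swapAut, invAut}

/-- The monoid generated by the two positive automorphisms that fix the commutator `abAB`. -/
def positiveAut : Submonoid (MulAut (FreeGroup Bool)) := Submonoid.closure {mulAut₁, mulAut₂}

theorem swapAut_mem : swapAut ∈ signedPerm := Submonoid.subset_closure (by simp)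
theorem invAut_mem : invAut ∈ signedPerm := Submonoid.subset_closure (by simp)
theorem mulAut₁_mem : mulAut₁ ∈ positiveAut := Submonoid.subset_closure (by simp)
theorem mulAut₂_mem : mulAut₂ ∈ positiveAut := Submonoid.subset_closure (by simp)

local notation "π" => toOut (FreeGroup Bool)

theorem swap_mul₁ : swapAut * mulAut₁ = mulAut₂ * swapAut := mulAut_ext_bool (by simp) (by simp)
theorem swap_mul₂ : swapAut * mulAut₂ = mulAut₁ * swapAut := mulAut_ext_bool (by simp) (by simp)

theorem inv_mul₁_mul : invAut * mulAut₁ * invAut * mulAut₁ = MulAut.conj (of false)⁻¹ :=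
  mulAut_ext_bool (by simp) (by simp)

theorem inv_mul₂_mul : invAut * mulAut₂ * invAut * mulAut₂ = 1 :=
  mulAut_ext_bool (by simp) (by simp)

/-- Modulo inner automorphisms this rewrites `mulAut₂ * mulAut₁⁻¹` as `mulAut₁` times a signed
permutation, which removes an inverse from a product. `mul₁_eq` is its mirror image. -/
theorem mul₂_eq : mulAut₂ =
    MulAut.conj (of false) * mulAut₁ * (swapAut * invAut) * mulAut₁ :=
  mulAut_ext_bool (by simp) (by simp [mul_assoc])

theorem mul₁_eq : mulAut₁ =
    MulAut.conj (of true) * mulAut₂ * (invAut * swapAut) * mulAut₂ :=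
  mulAut_ext_bool (by simp [mul_assoc]) (by simp)

/-- The positive elementary automorphisms and their inverses. -/
def elementarySet : Set (MulAut (FreeGroup Bool)) := {mulAut₁, mulAut₂, mulAut₁⁻¹, mulAut₂⁻¹}

/-- Modulo inner automorphisms, `swapAut` exchanges the two positive automorphisms and `invAut`
inverts each of them, so signed permutations can be moved past elementary factors. -/
theorem exists_toOut_mul_eq {δ η : MulAut (FreeGroup Bool)} (hδ : δ ∈ signedPerm)
    (hη : η ∈ elementarySet) : ∃ η' ∈ elementarySet, π δ * π η = π η' * π δ := by
  have hs : π swapAut * π mulAut₁ = π mulAut₂ * π swapAut := by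
    rw [← _root_.map_mul, swap_mul₁, _root_.map_mul]
  have hs' : π swapAut * π mulAut₂ = π mulAut₁ * π swapAut := by
    rw [← _root_.map_mul, swap_mul₂, _root_.map_mul]
  have hi : π invAut * π invAut = 1 := by rw [← _root_.map_mul, invAut_mul_self, _root_.map_one]
  have hi' : (π invAut)⁻¹ = π invAut := inv_eq_of_mul_eq_one_left hi
  have h₁ : π invAut * π mulAut₁ * π invAut * π mulAut₁ = 1 := by
    rw [← _root_.map_mul, ← _root_.map_mul, ← _root_.map_mul, inv_mul₁_mul, toOut_conj]
  have h₂ : π invAut * π mulAut₂ * π invAut * π mulAut₂ = 1 := by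
    rw [← _root_.map_mul, ← _root_.map_mul, ← _root_.map_mul, inv_mul₂_mul, _root_.map_one]
  have inv_rel : ∀ t : MulAut (FreeGroup Bool) ⧸ (MulAut.conj (G := FreeGroup Bool)).range,
      π invAut * t * π invAut * t = 1 →
      π invAut * t = t⁻¹ * π invAut ∧ π invAut * t⁻¹ = t * π invAut := by
    intro t ht
    have e : π invAut * t * π invAut = t⁻¹ := eq_inv_of_mul_eq_one_left ht
    have e₁ : π invAut * t = t⁻¹ * π invAut := by
      rw [← e, mul_assoc _ _ (π invAut), hi, mul_one]
    refine ⟨e₁, ?_⟩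
    rw [← e, ← mul_assoc, ← mul_assoc, hi, one_mul]
  induction hδ using Submonoid.closure_induction generalizing η with
  | mem x hx =>
    rcases hx with rfl | rfl
    · rcases hη with rfl | rfl | rfl | rfl
      · exact ⟨mulAut₂, by simp [elementarySet], hs⟩
      · exact ⟨mulAut₁, by simp [elementarySet], hs'⟩
      · refine ⟨mulAut₂⁻¹, by simp [elementarySet], ?_⟩
        rw [_root_.map_inv, _root_.map_inv, eq_inv_mul_iff_mul_eq, ← mul_assoc, ← hs,
          mul_inv_cancel_right]
      · refine ⟨mulAut₁⁻¹, by simp [elementarySet], ?_⟩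
        rw [_root_.map_inv, _root_.map_inv, eq_inv_mul_iff_mul_eq, ← mul_assoc, ← hs',
          mul_inv_cancel_right]
    · rcases hη with rfl | rfl | rfl | rfl
      · refine ⟨mulAut₁⁻¹, by simp [elementarySet], ?_⟩
        rw [_root_.map_inv]; exact (inv_rel _ h₁).1
      · refine ⟨mulAut₂⁻¹, by simp [elementarySet], ?_⟩
        rw [_root_.map_inv]; exact (inv_rel _ h₂).1
      · refine ⟨mulAut₁, by simp [elementarySet], ?_⟩
        rw [_root_.map_inv]; exact (inv_rel _ h₁).2
      · refine ⟨mulAut₂, by simp [elementarySet], ?_⟩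
        rw [_root_.map_inv]; exact (inv_rel _ h₂).2
  | one => exact ⟨η, hη, by simp⟩
  | mul x y _ _ hx hy =>
    obtain ⟨η₁, h₁, e₁⟩ := hy hη
    obtain ⟨η₂, h₂, e₂⟩ := hx h₁
    refine ⟨η₂, h₂, ?_⟩
    rw [_root_.map_mul, mul_assoc, e₁, ← mul_assoc, e₂, mul_assoc]

/-- An inverse elementary factor meets the last factor of `ψ`: it cancels if they match, and is
absorbed by `mul₂_eq` or `mul₁_eq` if not. For `ψ = 1` it is the conjugate of a positive factor by
`invAut`, whence the signed permutations on both sides. -/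
theorem exists_positive_mul {ψ η : MulAut (FreeGroup Bool)} (hψ : ψ ∈ positiveAut)
    (hη : η ∈ elementarySet) : ∃ δ ∈ signedPerm, ∃ ψ' ∈ positiveAut, ∃ δ' ∈ signedPerm,
      π ψ * π η = π δ * π ψ' * π δ' := by
  have e₂ : π mulAut₂ * (π mulAut₁)⁻¹ = π mulAut₁ * π (swapAut * invAut) := by
    rw [mul_inv_eq_iff_eq_mul]
    conv_lhs => rw [mul₂_eq]
    simp only [_root_.map_mul, toOut_conj, one_mul]
  have e₁ : π mulAut₁ * (π mulAut₂)⁻¹ = π mulAut₂ * π (invAut * swapAut) := by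
    rw [mul_inv_eq_iff_eq_mul]
    conv_lhs => rw [mul₁_eq]
    simp only [_root_.map_mul, toOut_conj, one_mul]
  have hi : (π invAut)⁻¹ = π invAut := by rw [← _root_.map_inv, invAut_inv]
  rcases hη with rfl | rfl | rfl | rfl
  · exact ⟨1, one_mem _, _, mul_mem hψ mulAut₁_mem, 1, one_mem _, by simp⟩
  · exact ⟨1, one_mem _, _, mul_mem hψ mulAut₂_mem, 1, one_mem _, by simp⟩
  · induction hψ using Submonoid.closure_induction_right with
    | one =>
      refine ⟨invAut, invAut_mem, mulAut₁, mulAut₁_mem, invAut, invAut_mem, ?_⟩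
      have := congrArg π inv_mul₁_mul
      simp only [_root_.map_mul, toOut_conj] at this
      rw [eq_inv_of_mul_eq_one_left this, _root_.map_inv, _root_.map_one, one_mul]
    | mul_right x hx y hy _ =>
      rcases hy with rfl | rfl
      · exact ⟨1, one_mem _, x, hx, 1, one_mem _, by simp⟩
      · refine ⟨1, one_mem _, _, mul_mem hx mulAut₁_mem, _, mul_mem swapAut_mem invAut_mem, ?_⟩
        rw [_root_.map_mul, _root_.map_inv, mul_assoc, e₂]
        simp [mul_assoc]
  · induction hψ using Submonoid.closure_induction_right with
    | one =>
      refine ⟨invAut, invAut_mem, mulAut₂, mulAut₂_mem, invAut, invAut_mem, ?_⟩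
      have := congrArg π inv_mul₂_mul
      simp only [_root_.map_mul, _root_.map_one] at this
      rw [eq_inv_of_mul_eq_one_left this, _root_.map_inv, _root_.map_one, one_mul]
    | mul_right x hx y hy _ =>
      rcases hy with rfl | rfl
      · refine ⟨1, one_mem _, _, mul_mem hx mulAut₂_mem, _, mul_mem invAut_mem swapAut_mem, ?_⟩
        rw [_root_.map_mul, _root_.map_inv, mul_assoc, e₁]
        simp [mul_assoc]
      · exact ⟨1, one_mem _, x, hx, 1, one_mem _, by simp⟩

theorem exists_normal_form (φ : MulAut (FreeGroup Bool)) :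
    ∃ δ ∈ signedPerm, ∃ ψ ∈ positiveAut, ∃ δ' ∈ signedPerm, π φ = π δ * π ψ * π δ' := by
  refine mulAut_induction (Q := fun φ => ∃ δ ∈ signedPerm, ∃ ψ ∈ positiveAut,
    ∃ δ' ∈ signedPerm, π φ = π δ * π ψ * π δ')
    ⟨1, one_mem _, 1, one_mem _, 1, one_mem _, by simp⟩ ?_ ?_ ?_ ?_ φ
  · rintro φ ⟨δ, h, ψ, h', δ', h'', e⟩
    exact ⟨δ, h, ψ, h', _, mul_mem h'' swapAut_mem, by simp [e, mul_assoc]⟩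
  · rintro φ ⟨δ, h, ψ, h', δ', h'', e⟩
    exact ⟨δ, h, ψ, h', _, mul_mem h'' invAut_mem, by simp [e, mul_assoc]⟩
  · rintro φ ⟨δ, h, ψ, h', δ', h'', e⟩
    obtain ⟨η, hη, e₁⟩ := exists_toOut_mul_eq h'' (η := mulAut₁) (by simp [elementarySet])
    obtain ⟨δ₁, k, ψ₁, k', δ₂, k'', e₂⟩ := exists_positive_mul h' hη
    refine ⟨δ * δ₁, mul_mem h k, ψ₁, k', δ₂ * δ', mul_mem k'' h'', ?_⟩
    calc π (φ * mulAut₁) = π δ * π ψ * (π δ' * π mulAut₁) := by simp [e, mul_assoc]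
      _ = π δ * (π ψ * π η) * π δ' := by rw [e₁]; simp only [mul_assoc]
      _ = _ := by rw [e₂]; simp only [_root_.map_mul, mul_assoc]
  · rintro g φ ⟨δ, h, ψ, h', δ', h'', e⟩
    exact ⟨δ, h, ψ, h', δ', h'', by rw [_root_.map_mul, toOut_conj, one_mul, e]⟩

/-- The sum of the absolute values of the exponent sums. -/
def wtNorm (v : ℤ × ℤ) : ℕ := v.1.natAbs + v.2.natAbs

theorem wtNorm_signedPerm {δ : MulAut (FreeGroup Bool)} (hδ : δ ∈ signedPerm)
    (g : FreeGroup Bool) : wtNorm (wt (δ g)) = wtNorm (wt g) := by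
  induction hδ using Submonoid.closure_induction generalizing g with
  | mem x hx =>
    rcases hx with rfl | rfl <;> rw [wt_apply] <;> simp [wtNorm, add_comm]
  | one => rfl
  | mul x y _ _ hx hy => rw [MulAut.mul_apply, hx, hy]

theorem signedPerm_apply_of {δ : MulAut (FreeGroup Bool)} (hδ : δ ∈ signedPerm) (t : Bool) :
    ∃ s, δ (of t) = of s ∨ δ (of t) = (of s)⁻¹ := by
  induction hδ using Submonoid.closure_induction generalizing t with
  | mem x hx =>
    rcases hx with rfl | rfl <;> cases t <;> simp
  | one => exact ⟨t, Or.inl rfl⟩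
  | mul x y _ _ hx hy =>
    obtain ⟨s, hs⟩ := hy t
    obtain ⟨r, hr⟩ := hx s
    refine ⟨r, ?_⟩
    rcases hs with hs | hs <;> rcases hr with hr | hr <;> simp [hs, hr]

theorem wt_positiveAut_nonneg {ψ : MulAut (FreeGroup Bool)} (hψ : ψ ∈ positiveAut) (t : Bool) :
    0 ≤ (wt (ψ (of t))).1 ∧ 0 ≤ (wt (ψ (of t))).2 ∧
      1 ≤ (wt (ψ (of t))).1 + (wt (ψ (of t))).2 := by
  induction hψ using Submonoid.closure_induction_right generalizing t with
  | one => cases t <;> simp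
  | mul_right x _ y hy hx =>
    have h₁ := hx true
    have h₂ := hx false
    rcases hy with rfl | rfl <;> cases t <;> simp <;> omega

/-- A further positive factor replaces one column of a nonnegative matrix by the sum of both
columns. Each column has sum at least one, so the new one has sum at least two. -/
theorem positiveAut_eq_one {ψ : MulAut (FreeGroup Bool)} (hψ : ψ ∈ positiveAut)
    (h : ∀ t, wtNorm (wt (ψ (of t))) ≤ 1) : ψ = 1 := by
  induction hψ using Submonoid.closure_induction_right with
  | one => rfl
  | mul_right x hx y hy _ =>
    have h₁ := wt_positiveAut_nonneg hx true
    have h₂ := wt_positiveAut_nonneg hx false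
    rcases hy with rfl | rfl
    · have := h true
      simp [wtNorm] at this
      omega
    · have := h false
      simp [wtNorm] at this
      omega

/-- An automorphism of the free group of rank two that acts trivially on the abelianization is
inner. -/
theorem exists_eq_conj_of_wt {φ : MulAut (FreeGroup Bool)} (h₁ : wt (φ (of true)) = (1, 0))
    (h₂ : wt (φ (of false)) = (0, 1)) : ∃ g, φ = MulAut.conj g := by
  obtain ⟨δ, hδ, ψ, hψ, δ', hδ', e⟩ := exists_normal_form φ
  rw [← _root_.map_mul, ← _root_.map_mul] at e
  obtain ⟨g, hg⟩ := exists_conj_of_toOut_eq e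
  have hwt : ∀ x, wt (δ (ψ (δ' x))) = wt x := by
    intro x
    have : wt (φ x) = wt (δ (ψ (δ' x))) := by rw [hg]; simp
    rw [← this, wt_apply, h₁, h₂]
    simp
  -- Signed permutations preserve the `ℓ¹`-norm of exponent sums and the whole product acts
  -- trivially on them, so both columns of `ψ` have norm one.
  have hψ1 : ψ = 1 := by
    refine positiveAut_eq_one hψ ?_
    have key : ∀ t, ∃ s, wtNorm (wt (ψ (of s))) ≤ 1 ∧
        (δ' (of t) = of s ∨ δ' (of t) = (of s)⁻¹) := by
      intro t
      obtain ⟨s, hs⟩ := signedPerm_apply_of hδ' t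
      refine ⟨s, ?_, hs⟩
      have h₃ := congrArg wtNorm (hwt (of t))
      rw [wtNorm_signedPerm hδ] at h₃
      have h₄ : wtNorm (wt (of t)) = 1 := by cases t <;> simp [wtNorm]
      rw [h₄] at h₃
      rcases hs with hs | hs <;> rw [hs] at h₃ <;> simp [wtNorm] at h₃ ⊢ <;> omega
    obtain ⟨s, hs, hs'⟩ := key true
    obtain ⟨r, hr, hr'⟩ := key false
    -- If both generators went to the same letter up to sign, the determinant of `δ'` would vanish.
    have hsr : s ≠ r := by
      rintro rfl
      have : wt (δ' (of true)) = wt (δ' (of false)) ∨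
          wt (δ' (of true)) = -wt (δ' (of false)) := by
        rcases hs' with hs' | hs' <;> rcases hr' with hr' | hr' <;> simp [hs', hr']
      have hd := det_eq_or δ'
      rw [det] at hd
      rcases this with h | h <;> rw [h] at hd <;>
        (try simp only [Prod.fst_neg, Prod.snd_neg] at hd) <;> rcases hd with hd | hd <;>
        ring_nf at hd <;> omega
    intro t
    cases s <;> cases r <;> cases t <;> first | exact hs | exact hr | exact absurd rfl hsr
  subst hψ1
  have hmem : δ * 1 * δ' ∈ signedPerm := by simpa using mul_mem hδ hδ'
  have hone : δ * 1 * δ' = 1 := by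
    have key : ∀ t, (δ * 1 * δ') (of t) = of t := by
      intro t
      have h₃ := hwt (of t)
      change wt ((δ * 1 * δ') (of t)) = wt (of t) at h₃
      obtain ⟨s, hs | hs⟩ := signedPerm_apply_of hmem t <;> rw [hs] at h₃ <;> rw [hs] <;>
        revert h₃ <;> cases s <;> cases t <;> simp
    exact mulAut_ext_bool (key true) (key false)
  exact ⟨g, by rw [hg, hone, mul_one]⟩

end FreeGroup

namespace FreeGroup

/-! ### Conjugacy up to inversion and cyclic length -/

/-- Conjugate up to inversion. -/
def UConj {G : Type*} [Group G] (g h : G) : Prop := IsConj g h ∨ IsConj g h⁻¹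

theorem isConj_inv {G : Type*} [Group G] {g h : G} (H : IsConj g h) : IsConj g⁻¹ h⁻¹ := by
  obtain ⟨c, rfl⟩ := isConj_iff.1 H
  exact isConj_iff.2 ⟨c, by group⟩

namespace UConj

variable {G : Type*} [Group G] {g h k : G}

theorem refl (g : G) : UConj g g := Or.inl (IsConj.refl g)

theorem symm (H : UConj g h) : UConj h g := by
  rcases H with H | H
  · exact Or.inl H.symm
  · have := isConj_inv H
    rw [inv_inv] at this
    exact Or.inr this.symm

theorem trans (H : UConj g h) (K : UConj h k) : UConj g k := by
  rcases H with H | H <;> rcases K with K | K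
  · exact Or.inl (H.trans K)
  · exact Or.inr (H.trans K)
  · exact Or.inr (H.trans (isConj_inv K))
  · have := isConj_inv K
    rw [inv_inv] at this
    exact Or.inl (H.trans this)

theorem map (φ : MulAut G) (H : UConj g h) : UConj (φ g) (φ h) := by
  rcases H with H | H
  · exact Or.inl (φ.toMonoidHom.map_isConj H)
  · exact Or.inr (by simpa using φ.toMonoidHom.map_isConj H)

theorem of_map (φ : MulAut G) (H : UConj (φ g) (φ h)) : UConj g h := by
  simpa using H.map φ⁻¹

end UConj

theorem wt_eq_or_of_uconj {g h : FreeGroup Bool} (H : UConj g h) : wt g = wt h ∨ wt g = -wt h := by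
  rcases H with H | H
  · exact Or.inl (wt_eq_of_isConj H)
  · exact Or.inr (by rw [wt_eq_of_isConj H, wt_inv])

/-- Powers of a cyclically reduced word do not cancel, so their norm grows with slope `L.length`.
The powers of a conjugate `g` grow with slope at most `g.norm`, and conjugation costs only a
constant. -/
theorem length_le_norm_of_isConj {α : Type*} [DecidableEq α] {L : List (α × Bool)}
    (hL : IsCyclicallyReduced L) {g : FreeGroup α} (h : IsConj (mk L) g) : L.length ≤ g.norm := by
  by_contra! hlt
  obtain ⟨c, hc⟩ := isConj_iff.1 h
  have hpow : ∀ n : ℕ, (mk L ^ n).norm = n * L.length := by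
    intro n
    rw [pow_mk, norm_mk_of_isReduced (hL.flatten_replicate n).isReduced]
    simp
  have hle : ∀ n : ℕ, (g ^ n).norm ≤ n * g.norm := by
    intro n
    induction n with
    | zero => simp
    | succ n ih =>
      rw [pow_succ]
      refine (norm_mul_le _ _).trans ?_
      rw [add_mul, one_mul]
      omega
  have hconj : ∀ n : ℕ, n * L.length ≤ c.norm + n * g.norm + c.norm := by
    intro n
    have e : mk L ^ n = c⁻¹ * g ^ n * c := by
      rw [← hc, conj_pow]
      group
    rw [← hpow, e]
    refine (norm_mul_le _ _).trans (add_le_add_left ((norm_mul_le _ _).trans ?_) _)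
    rw [norm_inv_eq]
    exact add_le_add_right (hle n) _
  -- This exponent exceeds the total cost `2 * c.norm` of the conjugation.
  have := hconj (2 * c.norm + 1)
  nlinarith

/-- The least number of letters of a word that represents an element up to conjugacy and
inversion. -/
noncomputable def cyclicLength (g : FreeGroup Bool) : ℕ :=
  sInf {n | ∃ L : List (Bool × Bool), L.length = n ∧ UConj (mk L) g}

theorem cyclicLength_eq {g h : FreeGroup Bool} (H : UConj h g)
    (hmin : ∀ k, UConj k g → h.norm ≤ k.norm) : cyclicLength g = h.norm := by
  refine le_antisymm (Nat.sInf_le ⟨h.toWord, rfl, by rwa [mk_toWord]⟩)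
    (le_csInf ⟨_, h.toWord, rfl, by rwa [mk_toWord]⟩ ?_)
  rintro _ ⟨L, rfl, hL⟩
  exact (hmin _ hL).trans norm_mk_le

theorem cyclicLength_congr {g h : FreeGroup Bool} (H : UConj g h) :
    cyclicLength g = cyclicLength h := by
  unfold cyclicLength
  congr 1
  ext n
  exact ⟨fun ⟨L, h₁, h₂⟩ => ⟨L, h₁, h₂.trans H⟩, fun ⟨L, h₁, h₂⟩ => ⟨L, h₁, h₂.trans H.symm⟩⟩

theorem cyclicLength_mk {L : List (Bool × Bool)} (hL : IsCyclicallyReduced L) :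
    cyclicLength (mk L) = L.length := by
  rw [← norm_mk_of_isReduced hL.isReduced]
  refine cyclicLength_eq (UConj.refl _) ?_
  rw [norm_mk_of_isReduced hL.isReduced]
  rintro k hk
  rcases hk.symm with hk | hk
  · exact length_le_norm_of_isConj hL hk
  · rw [← norm_inv_eq]; exact length_le_norm_of_isConj hL hk

theorem norm_map_le {φ : MulAut (FreeGroup Bool)} (h : ∀ t, (φ (of t)).norm ≤ 1)
    (g : FreeGroup Bool) : (φ g).norm ≤ g.norm := by
  have key : ∀ L : List (Bool × Bool), (φ (mk L)).norm ≤ L.length := by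
    intro L
    induction L with
    | nil => rw [← one_eq_mk]; simp
    | cons x L ih =>
      have e : mk (x :: L) = mk [x] * mk L := by simp
      have hx : (φ (mk [x])).norm ≤ 1 := by
        obtain ⟨t, _ | _⟩ := x
        · have : mk [(t, false)] = (of t)⁻¹ := rfl
          rw [this, _root_.map_inv, norm_inv_eq]
          exact h t
        · exact h t
      rw [e, _root_.map_mul]
      refine (norm_mul_le _ _).trans ?_
      rw [List.length_cons]
      omega
  have := key g.toWord
  rwa [mk_toWord] at this

/-- Automorphisms that, like their inverses, send generators to words of length at most one do not
lengthen words in either direction. -/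
theorem cyclicLength_map {φ : MulAut (FreeGroup Bool)} (h : ∀ t, (φ (of t)).norm ≤ 1)
    (h' : ∀ t, (φ⁻¹ (of t)).norm ≤ 1) (g : FreeGroup Bool) :
    cyclicLength (φ g) = cyclicLength g := by
  have key : ∀ (φ : MulAut (FreeGroup Bool)), (∀ t, (φ (of t)).norm ≤ 1) → ∀ g,
      cyclicLength (φ g) ≤ cyclicLength g := by
    intro φ h g
    obtain ⟨L, hL, hL'⟩ := Nat.sInf_mem (s := {n | ∃ L : List (Bool × Bool), L.length = n ∧
      UConj (mk L) g}) ⟨_, g.toWord, rfl, by rw [mk_toWord]; exact UConj.refl g⟩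
    have h₁ : (φ (mk L)).norm ≤ cyclicLength g :=
      ((norm_map_le h _).trans norm_mk_le).trans hL.le
    have h₂ : UConj (mk (φ (mk L)).toWord) (φ g) := by
      rw [mk_toWord]
      exact hL'.map φ
    exact (Nat.sInf_le ⟨_, rfl, h₂⟩ : cyclicLength (φ g) ≤ _).trans h₁
  refine le_antisymm (key φ h g) ?_
  have := key φ⁻¹ h' (φ g)
  simpa using this

/-- The rotation `a ↦ b`, `b ↦ A`. -/
def rotAut : MulAut (FreeGroup Bool) := invAut * swapAut

@[simp] theorem rotAut_true : rotAut (of true) = of false := by simp [rotAut]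
@[simp] theorem rotAut_false : rotAut (of false) = (of true)⁻¹ := by simp [rotAut]
@[simp] theorem det_rotAut : det rotAut = 1 := by simp [rotAut, det_mul]

theorem wt_rotAut (g : FreeGroup Bool) : wt (rotAut g) = (-(wt g).2, (wt g).1) := by
  rw [wt_apply]; simp

theorem cyclicLength_rotAut (g : FreeGroup Bool) : cyclicLength (rotAut g) = cyclicLength g := by
  refine cyclicLength_map ?_ ?_ g
  · intro t; cases t <;> simp [norm_inv_eq]
  · intro t
    have : rotAut⁻¹ = swapAut * invAut := by rw [rotAut, mul_inv_rev, swapAut_inv, invAut_inv]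
    rw [this]
    cases t <;> simp [norm_inv_eq]

/-! ### The two words -/

/-- The word `aabAB`. -/
def wordOne : FreeGroup Bool :=
  of true * (of true * of false * (of true)⁻¹ * (of false)⁻¹)

/-- The word `abaB`. -/
def wordTwo : FreeGroup Bool := of true * of false * of true * (of false)⁻¹

theorem mulAut₂_zpow_true (n : ℤ) : (mulAut₂ ^ n) (of true) = of true := by
  have : mulAut₂ ∈ MulAction.stabilizer (MulAut (FreeGroup Bool)) (of true) := by
    simp [MulAction.mem_stabilizer_iff]
  exact zpow_mem this n

theorem mulAut₂_zpow_false (n : ℤ) : (mulAut₂ ^ n) (of false) = of false * of true ^ n := by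
  have hinv : mulAut₂⁻¹ (of false) = of false * (of true)⁻¹ := by
    rw [MulAut.inv_apply, MulEquiv.symm_apply_eq]
    simp
  induction n using Int.induction_on with
  | zero => simp
  | succ n ih => rw [zpow_add_one, MulAut.mul_apply, mulAut₂_false, _root_.map_mul, ih,
      mulAut₂_zpow_true, mul_assoc, ← zpow_add_one]
  | pred n ih => rw [zpow_sub_one, MulAut.mul_apply, hinv, _root_.map_mul, ih,
      _root_.map_inv, mulAut₂_zpow_true, mul_assoc, ← zpow_sub_one]

/-- The twist fixes `a`, and the powers of `a` inserted after `b` cancel in `b * A * B`. In `abaB`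
they cancel in `b * a * B`. -/
theorem mulAut₂_zpow_wordOne (n : ℤ) : (mulAut₂ ^ n) wordOne = wordOne := by
  simp only [wordOne, _root_.map_mul, _root_.map_inv, mulAut₂_zpow_true, mulAut₂_zpow_false]
  group

theorem mulAut₂_zpow_wordTwo (n : ℤ) : (mulAut₂ ^ n) wordTwo = wordTwo := by
  simp only [wordTwo, _root_.map_mul, _root_.map_inv, mulAut₂_zpow_true, mulAut₂_zpow_false]
  group

/-- Automorphisms of determinant one with the same first column differ by an inner automorphism
and a power of the twist `a ↦ a`, `b ↦ ba`. -/
theorem exists_eq_conj_mul_zpow {φ φ' : MulAut (FreeGroup Bool)} (hφ : det φ = 1)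
    (hφ' : det φ' = 1) (h : wt (φ (of true)) = wt (φ' (of true))) :
    ∃ g n, φ' = MulAut.conj g * φ * mulAut₂ ^ (n : ℤ) := by
  set χ := φ⁻¹ * φ' with hχ
  have hφ'χ : φ' = φ * χ := by rw [hχ, mul_inv_cancel_left]
  have hdet : det χ = 1 := by
    have := det_mul φ χ
    rw [← hφ'χ, hφ, hφ', one_mul] at this
    exact this.symm
  have h₁ : wt (χ (of true)) = (1, 0) := by
    have e : wt (φ' (of true)) = wt (φ (χ (of true))) := by rw [hφ'χ]; rfl
    rw [← h, wt_apply φ (χ (of true))] at e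
    rw [det] at hφ
    have e₁ := congrArg Prod.fst e
    have e₂ := congrArg Prod.snd e
    simp only [Prod.fst_add, Prod.snd_add, Prod.smul_fst, Prod.smul_snd, smul_eq_mul] at e₁ e₂
    refine Prod.ext ?_ ?_ <;> dsimp only
    -- Cramer's rule for the matrix of `φ`, which has determinant one.
    · linear_combination (-(wt (φ (of false))).2) * e₁ + (wt (φ (of false))).1 * e₂ +
        (1 - (wt (χ (of true))).1) * hφ
    · linear_combination (wt (φ (of true))).2 * e₁ - (wt (φ (of true))).1 * e₂ -
        (wt (χ (of true))).2 * hφ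
  set n := (wt (χ (of false))).1 with hn
  have h₂ : wt (χ (of false)) = (n, 1) := by
    rw [det, h₁] at hdet
    simp at hdet
    exact Prod.ext rfl hdet
  -- The matrix of `χ` is unipotent with upper entry `n`; undoing `n` twists makes it trivial.
  obtain ⟨g, hg⟩ := exists_eq_conj_of_wt (φ := χ * mulAut₂ ^ (-n))
    (by rw [MulAut.mul_apply, mulAut₂_zpow_true, h₁])
    (by rw [MulAut.mul_apply, mulAut₂_zpow_false, _root_.map_mul, _root_.map_zpow, wt_mul, wt_zpow,
          h₁, h₂]; simp)
  refine ⟨φ g, n, ?_⟩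
  have hχ' : χ = MulAut.conj g * mulAut₂ ^ n := by
    rw [← hg, mul_assoc, ← zpow_add, neg_add_cancel, zpow_zero, mul_one]
  rw [hφ'χ, hχ', ← mul_assoc]
  congr 1
  ext x
  simp

/-- The twist ambiguity fixes `w` and the inner one stays inside its conjugacy class. So images of
`w` under determinant one are indexed by primitive vectors. -/
theorem isConj_of_wt_eq {φ φ' : MulAut (FreeGroup Bool)} (hφ : det φ = 1) (hφ' : det φ' = 1)
    (h : wt (φ (of true)) = wt (φ' (of true))) {w : FreeGroup Bool}
    (hw : ∀ n : ℤ, (mulAut₂ ^ n) w = w) : IsConj (φ w) (φ' w) := by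
  obtain ⟨g, n, rfl⟩ := exists_eq_conj_mul_zpow hφ hφ' h
  refine isConj_iff.2 ⟨g, ?_⟩
  simp [hw]

theorem uconj_invAut_wordOne : UConj wordOne (invAut wordOne) := by
  refine Or.inr (isConj_iff.2 ⟨(of true * of true)⁻¹, ?_⟩)
  simp [wordOne]
  group

theorem uconj_invAut_wordTwo : UConj wordTwo (invAut wordTwo) := by
  refine Or.inr (isConj_iff.2 ⟨(of true)⁻¹, ?_⟩)
  simp [wordTwo]
  group

/-- The automorphism inverting both generators. -/
def negAut : MulAut (FreeGroup Bool) := rotAut * rotAut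

theorem uconj_negAut_wordTwo : UConj wordTwo (negAut wordTwo) := by
  refine Or.inr (isConj_iff.2 ⟨(of false)⁻¹, ?_⟩)
  simp [wordTwo, negAut]
  group

/-- Precomposition with `invAut` changes the sign of the determinant but not the class of the image
of `w`. -/
theorem exists_det_eq_one {w : FreeGroup Bool} (hw : UConj w (invAut w))
    (φ : MulAut (FreeGroup Bool)) :
    ∃ φ' : MulAut (FreeGroup Bool), det φ' = 1 ∧ UConj (φ w) (φ' w) := by
  rcases det_eq_or φ with h | h
  · exact ⟨φ, h, UConj.refl _⟩
  · exact ⟨φ * invAut, by rw [det_mul, h]; simp, hw.map φ⟩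

/-- Opposite exponent sums exclude conjugacy. Conjugacy to the inverse is excluded by a finite
quotient that kills one word but not the other. -/
theorem not_uconj_negAut_wordOne : ¬ UConj wordOne (negAut wordOne) := by
  rintro (h | h)
  · have := wt_eq_of_isConj h
    simp [wordOne, negAut] at this
  -- The affine group of the field with five elements, with `a` acting as `x + 1` and `b` as `2x`:
  -- conjugating `a` by `b` gives `a²`, so `aabAB` dies, while `AABab` becomes translation by `-2 +
  -- 3 = 1`. The modulus works because `4 ≠ 1` in it.
  · let f : FreeGroup Bool →* Equiv.Perm (ZMod 5) :=
      lift (fun t => cond t (Equiv.addRight 1) ⟨(· * 2), (· * 3), by decide, by decide⟩)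
    have h₁ := f.map_isConj h
    have h₂ : f wordOne = 1 := by
      simp only [f, wordOne, _root_.map_mul, _root_.map_inv, lift_apply_of, cond]
      decide
    rw [h₂, isConj_one_right] at h₁
    revert h₁
    simp only [f, wordOne, negAut, _root_.map_mul, _root_.map_inv, lift_apply_of, cond,
      MulAut.mul_apply, rotAut_true, rotAut_false]
    decide

/-- If the vectors were opposite, `φ'` and `φ * negAut` would have the same first column, which
would identify `wordOne` with its image under `negAut`. -/
theorem wt_eq_of_uconj_wordOne {φ φ' : MulAut (FreeGroup Bool)} (hφ : det φ = 1)
    (hφ' : det φ' = 1) (h : UConj (φ wordOne) (φ' wordOne)) :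
    wt (φ (of true)) = wt (φ' (of true)) := by
  have hw : ∀ ψ : MulAut (FreeGroup Bool), wt (ψ wordOne) = wt (ψ (of true)) := by
    intro ψ
    rw [wt_apply]; simp [wordOne]
  rcases wt_eq_or_of_uconj h with e | e
  · rwa [hw, hw] at e
  · rw [hw, hw] at e
    have h₁ : UConj (φ' wordOne) ((φ * negAut) wordOne) := by
      refine Or.inl (isConj_of_wt_eq hφ' ?_ ?_ mulAut₂_zpow_wordOne)
      · rw [det_mul, hφ, negAut, det_mul]; simp
      · simp [negAut, e]
    exact absurd ((h.trans h₁).of_map φ) not_uconj_negAut_wordOne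

end FreeGroup

namespace FreeGroup

/-! ### Positive words with prescribed exponent sums -/

theorem wt_mulAut₁ (g : FreeGroup Bool) : wt (mulAut₁ g) = ((wt g).1, (wt g).1 + (wt g).2) := by
  rw [wt_apply]; simp

theorem wt_mulAut₂ (g : FreeGroup Bool) : wt (mulAut₂ g) = ((wt g).1 + (wt g).2, (wt g).2) := by
  rw [wt_apply]; simp

/-- The Euclidean algorithm. -/
theorem exists_positiveAut_mul {p q : ℕ} (hp : 0 < p) (hq : 0 < q) (h : p.Coprime q) :
    ∃ ψ ∈ positiveAut, wt (ψ (of true * of false)) = ((p : ℤ), (q : ℤ)) := by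
  induction hn : p + q using Nat.strong_induction_on generalizing p q with
  | _ n ih =>
  subst hn
  rcases lt_trichotomy p q with hlt | rfl | hlt
  · obtain ⟨ψ, hψ, e⟩ := ih (p + (q - p)) (by omega) (p := p) (q := q - p) hp (by omega)
      ((Nat.coprime_sub_self_right hlt.le).2 h) rfl
    refine ⟨mulAut₁ * ψ, mul_mem mulAut₁_mem hψ, ?_⟩
    rw [MulAut.mul_apply, wt_mulAut₁, e]
    ext
    · simp
    · simp; omega
  · obtain rfl : p = 1 := by simpa using h
    exact ⟨1, one_mem _, by simp⟩
  · obtain ⟨ψ, hψ, e⟩ := ih (p - q + q) (by omega) (p := p - q) (q := q) (by omega) hq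
      ((Nat.coprime_sub_self_left hlt.le).2 h) rfl
    refine ⟨mulAut₂ * ψ, mul_mem mulAut₂_mem hψ, ?_⟩
    rw [MulAut.mul_apply, wt_mulAut₂, e]
    ext
    · simp; omega
    · simp

/-- The Euclidean algorithm prescribes the exponent sums of the image of `ab`, and `mulAut₁` carries
`a` to `ab`. -/
theorem exists_positiveAut {p q : ℕ} (hp : 0 < p) (h : p.Coprime q) :
    ∃ ψ ∈ positiveAut, wt (ψ (of true)) = ((p : ℤ), (q : ℤ)) := by
  rcases Nat.eq_zero_or_pos q with rfl | hq
  · obtain rfl : p = 1 := by simpa using h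
    exact ⟨1, one_mem _, by simp⟩
  · obtain ⟨ψ, hψ, e⟩ := exists_positiveAut_mul hp hq h
    exact ⟨ψ * mulAut₁, mul_mem hψ mulAut₁_mem, by simpa using e⟩

theorem det_positiveAut {ψ : MulAut (FreeGroup Bool)} (hψ : ψ ∈ positiveAut) : det ψ = 1 := by
  induction hψ using Submonoid.closure_induction with
  | mem x hx => rcases hx with rfl | rfl <;> simp
  | one => simp
  | mul x y _ _ hx hy => rw [det_mul, hx, hy, one_mul]

theorem positiveAut_commutator {ψ : MulAut (FreeGroup Bool)} (hψ : ψ ∈ positiveAut) :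
    ψ (of true * of false * (of true)⁻¹ * (of false)⁻¹) =
      of true * of false * (of true)⁻¹ * (of false)⁻¹ := by
  induction hψ using Submonoid.closure_induction with
  | mem x hx => rcases hx with rfl | rfl <;> simp [mul_assoc]
  | one => rfl
  | mul x y _ _ hx hy => rw [MulAut.mul_apply, hy, hx]

/-- The word with positive letters. -/
def posWord (l : List Bool) : List (Bool × Bool) := l.map fun t => (t, true)

theorem mk_posWord_append (l m : List Bool) :
    mk (posWord (l ++ m)) = mk (posWord l) * mk (posWord m) := by
  simp [posWord]

theorem wt_posWord (l : List Bool) :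
    (wt (mk (posWord l))).1 + (wt (mk (posWord l))).2 = l.length := by
  induction l with
  | nil => rw [posWord, List.map_nil, ← one_eq_mk]; simp
  | cons t l ih =>
    have e : mk (posWord (t :: l)) = of t * mk (posWord l) := by simp [posWord, of]
    rw [e, wt_mul]
    cases t <;> simp <;> omega

/-- The leading letter is retained because cyclic reducedness of the image of `aabAB` depends on it.
-/
theorem exists_posWord {ψ : MulAut (FreeGroup Bool)} (hψ : ψ ∈ positiveAut) (t : Bool) :
    ∃ l, ψ (of t) = mk (posWord (t :: l)) := by
  induction hψ using Submonoid.closure_induction_right generalizing t with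
  | one => exact ⟨[], rfl⟩
  | mul_right x _ y hy hx =>
    obtain ⟨l, hl⟩ := hx true
    obtain ⟨m, hm⟩ := hx false
    rcases hy with rfl | rfl <;> cases t
    · exact ⟨m, by simpa using hm⟩
    · exact ⟨l ++ false :: m, by rw [← List.cons_append, mk_posWord_append, ← hl, ← hm]; simp⟩
    · exact ⟨m ++ true :: l, by rw [← List.cons_append, mk_posWord_append, ← hl, ← hm]; simp⟩
    · exact ⟨l, by simpa using hl⟩

theorem norm_posWord_le (l : List Bool) :
    ((mk (posWord l)).norm : ℤ) ≤ (wt (mk (posWord l))).1 + (wt (mk (posWord l))).2 := by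
  rw [wt_posWord]
  exact_mod_cast norm_mk_le.trans (by simp [posWord])

theorem isReduced_posWord (l : List Bool) : IsReduced (posWord l) := by
  have : ∀ t, IsReduced (posWord (t :: l)) := by
    induction l with
    | nil => intro t; exact List.isChain_singleton _
    | cons s l ih => intro t; exact List.isChain_cons_cons.2 ⟨fun _ => rfl, ih s⟩
  exact List.IsChain.tail (this true)

/-! ### Lengths of the images of the two words -/

/-- A positive word does not cancel against the `a` that follows it, and cyclically the final `B`
meets the leading `a`. -/
theorem isCyclicallyReduced_posWord_commutator (l : List Bool) :
    IsCyclicallyReduced (posWord (true :: l) ++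
      [(true, true), (false, true), (true, false), (false, false)]) := by
  refine ⟨List.isChain_append.2 ⟨isReduced_posWord _, by decide, ?_⟩, ?_⟩
  · rintro ⟨x, y⟩ hx ⟨z, w⟩ hw
    have hy : y = true := by
      have := List.mem_of_getLast? hx
      simp only [posWord, List.mem_map] at this
      obtain ⟨_, _, h⟩ := this
      exact (congrArg Prod.snd h).symm
    simp at hw
    intro _
    rw [hy]
    exact hw.2.symm
  · rintro x hx y hy
    rw [List.getLast?_append] at hx
    simp [posWord] at hx hy
    subst hx hy
    simp

theorem cyclicLength_positiveAut_wordOne {ψ : MulAut (FreeGroup Bool)} (hψ : ψ ∈ positiveAut) :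
    (cyclicLength (ψ wordOne) : ℤ) = (wt (ψ (of true))).1 + (wt (ψ (of true))).2 + 4 := by
  obtain ⟨l, hl⟩ := exists_posWord hψ true
  have e : ψ wordOne = mk (posWord (true :: l) ++
      [(true, true), (false, true), (true, false), (false, false)]) := by
    rw [wordOne, _root_.map_mul, positiveAut_commutator hψ, hl, ← mul_mk]
    rfl
  rw [e, cyclicLength_mk (isCyclicallyReduced_posWord_commutator l), hl, wt_posWord]
  simp [posWord]
  ring

/-- The four quarter turns of the half-open quadrant `x > 0`, `y ≥ 0` tile the plane without the
origin. -/
theorem exists_rotAut_pow {v : ℤ × ℤ} (hv : v ≠ 0) :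
    ∃ (k : ℕ) (p q : ℕ), 0 < p ∧ ∀ g, wt g = ((p : ℤ), (q : ℤ)) → wt ((rotAut ^ k) g) = v := by
  obtain ⟨x, y⟩ := v
  have hv' : x ≠ 0 ∨ y ≠ 0 := by
    by_contra! h
    exact hv (by simp [h.1, h.2])
  by_cases h₁ : 0 < x ∧ 0 ≤ y
  · refine ⟨0, x.toNat, y.toNat, by omega, fun g hg => ?_⟩
    simp [hg]; omega
  by_cases h₂ : 0 < y ∧ x ≤ 0
  · refine ⟨1, y.toNat, (-x).toNat, by omega, fun g hg => ?_⟩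
    simp [wt_rotAut, hg]; omega
  by_cases h₃ : x < 0 ∧ y ≤ 0
  · refine ⟨2, (-x).toNat, (-y).toNat, by omega, fun g hg => ?_⟩
    simp [pow_succ, wt_rotAut, hg]; omega
  · refine ⟨3, (-y).toNat, x.toNat, by omega, fun g hg => ?_⟩
    simp [pow_succ, wt_rotAut, hg]; omega

theorem wtNorm_rotAut_pow (k : ℕ) (g : FreeGroup Bool) :
    wtNorm (wt ((rotAut ^ k) g)) = wtNorm (wt g) :=
  wtNorm_signedPerm (pow_mem (mul_mem invAut_mem swapAut_mem) k) g

theorem cyclicLength_rotAut_pow (k : ℕ) (g : FreeGroup Bool) :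
    cyclicLength ((rotAut ^ k) g) = cyclicLength g := by
  induction k generalizing g with
  | zero => rfl
  | succ k ih => rw [pow_succ, MulAut.mul_apply, ih, cyclicLength_rotAut]

theorem det_pow_rotAut (k : ℕ) : det (rotAut ^ k) = 1 := by
  induction k with
  | zero => simp
  | succ k ih => rw [pow_succ, det_mul, ih, det_rotAut, one_mul]

theorem isCoprime_of_det {φ : MulAut (FreeGroup Bool)} (hφ : det φ = 1) :
    IsCoprime (wt (φ (of true))).1 (wt (φ (of true))).2 :=
  ⟨(wt (φ (of false))).2, -(wt (φ (of false))).1, by rw [det] at hφ; linarith⟩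

/-- An automorphism of determinant one with a prescribed first column that is a rotation of a
positive automorphism. -/
theorem exists_rotAut_pow_mul_positiveAut {v : ℤ × ℤ} (hv : IsCoprime v.1 v.2) :
    ∃ (k p q : ℕ), 0 < p ∧ p.Coprime q ∧ wtNorm v = p + q ∧
      ∀ ψ : MulAut (FreeGroup Bool), wt (ψ (of true)) = ((p : ℤ), (q : ℤ)) →
        wt ((rotAut ^ k * ψ) (of true)) = v := by
  have hv0 : v ≠ 0 := by
    rintro rfl
    exact not_isCoprime_zero_zero hv
  obtain ⟨k, p, q, hp, hk⟩ := exists_rotAut_pow hv0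
  -- This element only serves as a probe with exponent sums `(p, q)`.
  have hg : wt (of true ^ (p : ℤ) * of false ^ (q : ℤ)) = ((p : ℤ), (q : ℤ)) := by
    rw [wt_mul, wt_zpow, wt_zpow]; simp
  have hn : wtNorm v = p + q := by
    rw [← hk _ hg, wtNorm_rotAut_pow, hg]
    simp [wtNorm]
  refine ⟨k, p, q, hp, ?_, hn, fun ψ hψ => hk _ hψ⟩
  rw [← Nat.isCoprime_iff_coprime]
  obtain ⟨s, t, hst⟩ := hv
  rw [← hk _ hg, wt_apply, hg] at hst
  simp only [Prod.fst_add, Prod.snd_add, Prod.smul_fst, Prod.smul_snd, smul_eq_mul] at hst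
  exact ⟨s * (wt ((rotAut ^ k) (of true))).1 + t * (wt ((rotAut ^ k) (of true))).2,
    s * (wt ((rotAut ^ k) (of false))).1 + t * (wt ((rotAut ^ k) (of false))).2,
    by linear_combination hst⟩

/-- By `isConj_of_wt_eq`, `φ` may be replaced by a rotation of a positive automorphism, and
rotations preserve cyclic length. -/
theorem cyclicLength_wordOne {φ : MulAut (FreeGroup Bool)} (hφ : det φ = 1) :
    cyclicLength (φ wordOne) = wtNorm (wt (φ (of true))) + 4 := by
  obtain ⟨k, p, q, hp, hpq, hn, hk⟩ := exists_rotAut_pow_mul_positiveAut (isCoprime_of_det hφ)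
  obtain ⟨ψ, hψ, e⟩ := exists_positiveAut hp hpq
  have hc : UConj (φ wordOne) ((rotAut ^ k * ψ) wordOne) :=
    Or.inl (isConj_of_wt_eq hφ (by rw [det_mul, det_pow_rotAut, det_positiveAut hψ, one_mul])
      (hk ψ e).symm mulAut₂_zpow_wordOne)
  rw [cyclicLength_congr hc, MulAut.mul_apply, cyclicLength_rotAut_pow, hn]
  have := cyclicLength_positiveAut_wordOne hψ
  rw [e] at this
  dsimp only at this
  exact_mod_cast this

theorem wt_map_wordTwo (φ : MulAut (FreeGroup Bool)) :
    wt (φ wordTwo) = (2 : ℤ) • wt (φ (of true)) := by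
  rw [wt_apply]; simp [wordTwo]

/-- For a unit vector the word `abaB` itself is cyclically reduced. Otherwise both entries of the
rotated vector are positive, a positive representative exists, and its exponent sums show that it is
shortest. -/
theorem cyclicLength_wordTwo {φ : MulAut (FreeGroup Bool)} (hφ : det φ = 1) :
    cyclicLength (φ wordTwo) =
      if wtNorm (wt (φ (of true))) = 1 then 4 else 2 * wtNorm (wt (φ (of true))) := by
  obtain ⟨k, p, q, hp, hpq, hn, hk⟩ := exists_rotAut_pow_mul_positiveAut (isCoprime_of_det hφ)
  rw [hn]
  have hc : ∀ ψ ∈ positiveAut, wt (ψ (of true)) = ((p : ℤ), (q : ℤ)) →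
      cyclicLength (φ wordTwo) = cyclicLength (ψ wordTwo) := by
    intro ψ hψ e
    have hc : UConj (φ wordTwo) ((rotAut ^ k * ψ) wordTwo) :=
      Or.inl (isConj_of_wt_eq hφ (by rw [det_mul, det_pow_rotAut, det_positiveAut hψ, one_mul])
        (hk ψ e).symm mulAut₂_zpow_wordTwo)
    rw [cyclicLength_congr hc, MulAut.mul_apply, cyclicLength_rotAut_pow]
  rcases Nat.eq_zero_or_pos q with rfl | hq
  · obtain rfl : p = 1 := by simpa using hpq
    rw [hc 1 (one_mem _) (by simp), if_pos rfl]
    exact cyclicLength_mk (L := [(true, true), (false, true), (true, true), (false, false)])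
      ⟨by unfold IsReduced; decide, by decide⟩
  · rw [if_neg (by omega)]
    obtain ⟨ψ, hψ, e⟩ := exists_positiveAut_mul hp hq hpq
    obtain ⟨l, hl⟩ := exists_posWord hψ true
    obtain ⟨m, hm⟩ := exists_posWord hψ false
    -- `mulAut₁` carries `abaB` to the positive word `abba`, which `ψ` keeps positive.
    rw [hc (ψ * mulAut₁) (mul_mem hψ mulAut₁_mem) (by simpa using e)]
    have e₁ : (ψ * mulAut₁) wordTwo = mk (posWord (true :: l ++ false :: m ++ false :: m ++
        true :: l)) := by
      rw [mk_posWord_append, mk_posWord_append, mk_posWord_append, ← hl, ← hm]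
      simp [wordTwo, mul_assoc]
    have e₂ : wt ((ψ * mulAut₁) wordTwo) = (2 * (p : ℤ), 2 * (q : ℤ)) := by
      rw [wt_map_wordTwo, MulAut.mul_apply, mulAut₁_true, e]
      simp
    have hle := norm_posWord_le (true :: l ++ false :: m ++ false :: m ++ true :: l)
    rw [← e₁, e₂] at hle
    have hge : ∀ g, UConj g ((ψ * mulAut₁) wordTwo) → 2 * (p + q) ≤ g.norm := by
      intro g hg
      have h₁ := natAbs_wt_le_norm g
      rcases wt_eq_or_of_uconj hg with h | h <;> rw [h, e₂] at h₁ <;> simp at h₁ <;> omega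
    have hself := hge _ (UConj.refl _)
    simp only at hle
    have hnorm : ((ψ * mulAut₁) wordTwo).norm = 2 * (p + q) := by omega
    rw [cyclicLength_eq (UConj.refl _) (by rw [hnorm]; exact hge), hnorm]

end FreeGroup

namespace FreeGroup

/-! ### Counting primitive vectors -/

/-- The primitive integer vectors of `ℓ¹`-norm `n`. -/
def primVec (n : ℕ) : Set (ℤ × ℤ) := {v | IsCoprime v.1 v.2 ∧ wtNorm v = n}

/-- The primitive integer vectors of `ℓ¹`-norm `n` in a quarter of the plane. -/
def quarterVec (n : ℕ) : Set (ℤ × ℤ) := {v ∈ primVec n | 0 < v.1 ∧ 0 ≤ v.2}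

/-- The primitive integer vectors of `ℓ¹`-norm `n` in a half plane. -/
def halfVec (n : ℕ) : Set (ℤ × ℤ) := {v ∈ primVec n | 0 < v.1 ∧ 0 ≤ v.2 ∨ v.1 ≤ 0 ∧ 0 < v.2}

/-- The vectors are `(n - q, q)` with `0 ≤ q < n`, and `n - q` is coprime to `q` exactly when `n`
is. Starting at `q = 0` gives the right value for `n = 1`. -/
theorem encard_quarterVec {n : ℕ} (hn : 0 < n) : (quarterVec n).encard = n.totient := by
  have e : quarterVec n = (fun q : ℕ => ((n : ℤ) - q, (q : ℤ))) ''
      ((Finset.range n).filter n.Coprime : Finset ℕ) := by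
    ext ⟨x, y⟩
    simp only [quarterVec, primVec, wtNorm, Set.mem_ofPred_eq, Finset.coe_filter, Finset.mem_range,
      Set.mem_image, Prod.mk.injEq]
    constructor
    · rintro ⟨⟨hc, hw⟩, hx, hy⟩
      refine ⟨y.toNat, ⟨by omega, ?_⟩, by omega, by omega⟩
      rw [← Nat.isCoprime_iff_coprime]
      have h₁ : (y.toNat : ℤ) = y := by omega
      have h₂ : (n : ℤ) = x + y * 1 := by omega
      rw [h₁, h₂]
      exact hc.add_mul_left_left 1
    · rintro ⟨q, ⟨hq, hc⟩, rfl, rfl⟩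
      refine ⟨⟨?_, by omega⟩, by omega, by omega⟩
      rw [← Nat.isCoprime_iff_coprime] at hc
      have := hc.add_mul_left_left (-1)
      rwa [mul_neg_one, ← sub_eq_add_neg] at this
  rw [e, Set.InjOn.encard_image, Set.encard_coe_eq_coe_finsetCard, Nat.totient]
  intro p _ q _ h
  simpa using h

theorem encard_halfVec {n : ℕ} (hn : 0 < n) : (halfVec n).encard = (2 * n.totient : ℕ) := by
  have e : halfVec n = quarterVec n ∪ (fun v : ℤ × ℤ => (-v.2, v.1)) '' quarterVec n := by
    ext ⟨x, y⟩
    simp only [halfVec, quarterVec, primVec, wtNorm, Set.mem_ofPred_eq, Set.mem_union,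
      Set.mem_image, Prod.mk.injEq, Prod.exists]
    constructor
    · rintro ⟨⟨hc, hw⟩, h | h⟩
      · exact Or.inl ⟨⟨hc, hw⟩, h⟩
      · exact Or.inr ⟨y, -x, ⟨⟨hc.symm.neg_right, by omega⟩, by omega⟩, by omega, rfl⟩
    · rintro (⟨⟨hc, hw⟩, h⟩ | ⟨p, q, ⟨⟨hc, hw⟩, h⟩, rfl, rfl⟩)
      · exact ⟨⟨hc, hw⟩, Or.inl h⟩
      · exact ⟨⟨hc.symm.neg_left, by omega⟩, by omega⟩
  rw [e, Set.encard_union_eq, Set.InjOn.encard_image, encard_quarterVec hn, two_mul, Nat.cast_add]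
  · rintro ⟨x, y⟩ _ ⟨z, w⟩ _ h
    simp at h
    exact Prod.ext h.2 h.1
  · rw [Set.disjoint_left]
    rintro _ h ⟨w, hw, rfl⟩
    have h₁ := h.2
    have h₂ := hw.2
    dsimp only at h₁
    omega

theorem encard_primVec {n : ℕ} (hn : 0 < n) : (primVec n).encard = (4 * n.totient : ℕ) := by
  have e : primVec n = halfVec n ∪ (fun v : ℤ × ℤ => -v) '' halfVec n := by
    ext ⟨x, y⟩
    simp only [halfVec, primVec, wtNorm, Set.mem_ofPred_eq, Set.mem_union,
      Set.mem_image, Prod.exists]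
    constructor
    · rintro ⟨hc, hw⟩
      by_cases h : 0 < x ∧ 0 ≤ y ∨ x ≤ 0 ∧ 0 < y
      · exact Or.inl ⟨⟨hc, hw⟩, h⟩
      · exact Or.inr ⟨-x, -y, ⟨⟨hc.neg_neg, by omega⟩, by omega⟩, by simp⟩
    · rintro (⟨⟨hc, hw⟩, h⟩ | ⟨p, q, ⟨⟨hc, hw⟩, h⟩, e⟩)
      · exact ⟨hc, hw⟩
      · simp only [Prod.neg_mk, Prod.mk.injEq] at e
        obtain ⟨rfl, rfl⟩ := e
        exact ⟨hc.neg_neg, by omega⟩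
  rw [e, Set.encard_union_eq, Set.InjOn.encard_image, encard_halfVec hn, ← Nat.cast_add]
  · congr 1; ring
  · exact neg_injective.injOn
  · rw [Set.disjoint_left]
    rintro _ h ⟨w, hw, rfl⟩
    have h₁ := h.2
    have h₂ := hw.2
    simp only [Prod.fst_neg, Prod.snd_neg] at h₁
    omega

theorem exists_det_wt {v : ℤ × ℤ} (hv : IsCoprime v.1 v.2) :
    ∃ φ : MulAut (FreeGroup Bool), det φ = 1 ∧ wt (φ (of true)) = v := by
  obtain ⟨k, p, q, hp, hpq, hn, hk⟩ := exists_rotAut_pow_mul_positiveAut hv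
  obtain ⟨ψ, hψ, e⟩ := exists_positiveAut hp hpq
  exact ⟨_, by rw [det_mul, det_pow_rotAut, det_positiveAut hψ, one_mul], hk ψ e⟩

/-! ### Counting classes in the orbits of the two words -/

/-- Classes in the orbit correspond to primitive vectors: `isConj_of_wt_eq` gives one class for each
vector, and `wt_eq_of_uconj_wordOne` gives injectivity. -/
theorem encard_orbit_wordOne {X : Type*} (cl : FreeGroup Bool → X)
    (hcl : ∀ g h, cl g = cl h ↔ UConj g h) (n : ℕ) :
    {β | ∃ φ : MulAut (FreeGroup Bool), cl (φ wordOne) = β ∧ cyclicLength (φ wordOne) = n + 4}.encard =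
      (primVec n).encard := by
  choose! Φ hΦ using fun (v : ℤ × ℤ) (hv : IsCoprime v.1 v.2) => exists_det_wt hv
  have e : {β | ∃ φ : MulAut (FreeGroup Bool), cl (φ wordOne) = β ∧
      cyclicLength (φ wordOne) = n + 4} = (fun v => cl (Φ v wordOne)) '' primVec n := by
    ext β
    constructor
    · rintro ⟨φ, rfl, hl⟩
      obtain ⟨φ', hφ', hc⟩ := exists_det_eq_one uconj_invAut_wordOne φ
      rw [cyclicLength_congr hc, cyclicLength_wordOne hφ', add_left_inj] at hl
      have hv := isCoprime_of_det hφ'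
      refine ⟨_, ⟨hv, hl⟩, (hcl _ _).2 (UConj.trans ?_ hc.symm)⟩
      exact Or.inl (isConj_of_wt_eq (hΦ _ hv).1 hφ' (hΦ _ hv).2 mulAut₂_zpow_wordOne)
    · rintro ⟨v, ⟨hv, hn⟩, rfl⟩
      refine ⟨Φ v, rfl, ?_⟩
      rw [cyclicLength_wordOne (hΦ _ hv).1, (hΦ _ hv).2, hn]
  rw [e, Set.InjOn.encard_image]
  rintro v ⟨hv, -⟩ w ⟨hw, -⟩ h
  have := wt_eq_of_uconj_wordOne (hΦ _ hv).1 (hΦ _ hw).1 ((hcl _ _).1 h)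
  rwa [(hΦ _ hv).2, (hΦ _ hw).2] at this

/-- Classes correspond to primitive vectors up to sign, represented in a half plane. A predicate `P`
on lengths is used because two norms share the length `4`. -/
theorem encard_orbit_wordTwo {X : Type*} (cl : FreeGroup Bool → X)
    (hcl : ∀ g h, cl g = cl h ↔ UConj g h) (P : ℕ → Prop) :
    {β | ∃ φ : MulAut (FreeGroup Bool), cl (φ wordTwo) = β ∧ P (cyclicLength (φ wordTwo))}.encard =
      (⋃ n ∈ {n | P (if n = 1 then 4 else 2 * n)}, halfVec n).encard := by
  choose! Φ hΦ using fun (v : ℤ × ℤ) (hv : IsCoprime v.1 v.2) => exists_det_wt hv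
  have e : {β | ∃ φ : MulAut (FreeGroup Bool), cl (φ wordTwo) = β ∧
      P (cyclicLength (φ wordTwo))} = (fun v => cl (Φ v wordTwo)) ''
        (⋃ n ∈ {n | P (if n = 1 then 4 else 2 * n)}, halfVec n) := by
    ext β
    simp only [Set.mem_image, Set.mem_iUnion]
    constructor
    · rintro ⟨φ, rfl, hl⟩
      obtain ⟨φ₁, hφ₁, hc₁⟩ := exists_det_eq_one uconj_invAut_wordTwo φ
      obtain ⟨φ', hφ', hc, hpos⟩ : ∃ φ' : MulAut (FreeGroup Bool), det φ' = 1 ∧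
          UConj (φ wordTwo) (φ' wordTwo) ∧ (0 < (wt (φ' (of true))).1 ∧ 0 ≤ (wt (φ' (of true))).2 ∨
            (wt (φ' (of true))).1 ≤ 0 ∧ 0 < (wt (φ' (of true))).2) := by
        by_cases h : 0 < (wt (φ₁ (of true))).1 ∧ 0 ≤ (wt (φ₁ (of true))).2 ∨
            (wt (φ₁ (of true))).1 ≤ 0 ∧ 0 < (wt (φ₁ (of true))).2
        · exact ⟨φ₁, hφ₁, hc₁, h⟩
        · refine ⟨φ₁ * negAut, by rw [det_mul, hφ₁, negAut, det_mul]; simp,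
            hc₁.trans (uconj_negAut_wordTwo.map φ₁), ?_⟩
          have hne : wt (φ₁ (of true)) ≠ 0 := by
            intro h0
            have := isCoprime_of_det hφ₁
            rw [h0] at this
            exact not_isCoprime_zero_zero this
          have : (wt (φ₁ (of true))).1 ≠ 0 ∨ (wt (φ₁ (of true))).2 ≠ 0 := by
            by_contra! h'
            exact hne (Prod.ext h'.1 h'.2)
          simp [negAut]
          omega
      rw [cyclicLength_congr hc, cyclicLength_wordTwo hφ'] at hl
      have hv := isCoprime_of_det hφ'
      refine ⟨_, ⟨_, hl, ⟨hv, rfl⟩, hpos⟩, (hcl _ _).2 (UConj.trans ?_ hc.symm)⟩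
      exact Or.inl (isConj_of_wt_eq (hΦ _ hv).1 hφ' (hΦ _ hv).2 mulAut₂_zpow_wordTwo)
    · rintro ⟨v, ⟨n, hP, ⟨hv, rfl⟩, -⟩, rfl⟩
      refine ⟨Φ v, rfl, ?_⟩
      rw [cyclicLength_wordTwo (hΦ _ hv).1, (hΦ _ hv).2]
      exact hP
  rw [e, Set.InjOn.encard_image]
  simp only [Set.InjOn, Set.mem_iUnion]
  rintro v ⟨_, _, ⟨hv, -⟩, hv'⟩ w ⟨_, _, ⟨hw, -⟩, hw'⟩ h
  have := wt_eq_or_of_uconj ((hcl _ _).1 h)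
  rw [wt_map_wordTwo, wt_map_wordTwo, (hΦ _ hv).2, (hΦ _ hw).2] at this
  obtain ⟨x, y⟩ := v
  obtain ⟨z, t⟩ := w
  simp at this hv' hw' ⊢
  omega

/-- The count for `aabAB`. -/
theorem encard_orbit_wordOne_eq {X : Type*} (cl : FreeGroup Bool → X)
    (hcl : ∀ g h, cl g = cl h ↔ UConj g h) (ℓ : ℕ) :
    (5 ≤ ℓ → {β | ∃ φ : MulAut (FreeGroup Bool), cl (φ wordOne) = β ∧
      cyclicLength (φ wordOne) = ℓ}.encard = (4 * Nat.totient (ℓ - 4) : ℕ)) ∧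
    (ℓ < 5 → {β | ∃ φ : MulAut (FreeGroup Bool), cl (φ wordOne) = β ∧
      cyclicLength (φ wordOne) = ℓ}.encard = 0) := by
  constructor
  · intro h
    obtain ⟨n, rfl⟩ := Nat.exists_eq_add_of_le' (show 4 ≤ ℓ by omega)
    rw [encard_orbit_wordOne cl hcl, encard_primVec (by omega), Nat.add_sub_cancel]
  · intro h
    rw [Set.encard_eq_zero, Set.eq_empty_iff_forall_notMem]
    rintro _ ⟨φ, rfl, hl⟩
    obtain ⟨φ', hφ', hc⟩ := exists_det_eq_one uconj_invAut_wordOne φ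
    rw [cyclicLength_congr hc, cyclicLength_wordOne hφ'] at hl
    have h0 : wtNorm (wt (φ' (of true))) = 0 := by omega
    simp only [wtNorm, Nat.add_eq_zero_iff, Int.natAbs_eq_zero] at h0
    have := isCoprime_of_det hφ'
    rw [h0.1, h0.2] at this
    exact not_isCoprime_zero_zero this

theorem halfVec_zero : halfVec 0 = ∅ := by
  ext ⟨x, y⟩
  simp only [halfVec, primVec, wtNorm, Set.mem_ofPred_eq, Set.mem_empty_iff_false, iff_false]
  rintro ⟨⟨_, h⟩, h'⟩
  omega

/-- The count for `abaB`. -/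
theorem encard_orbit_wordTwo_eq {X : Type*} (cl : FreeGroup Bool → X)
    (hcl : ∀ g h, cl g = cl h ↔ UConj g h) (ℓ : ℕ) :
    (Even ℓ → 6 ≤ ℓ → {β | ∃ φ : MulAut (FreeGroup Bool), cl (φ wordTwo) = β ∧
      cyclicLength (φ wordTwo) = ℓ}.encard = (2 * Nat.totient (ℓ / 2) : ℕ)) ∧
    (ℓ = 4 → {β | ∃ φ : MulAut (FreeGroup Bool), cl (φ wordTwo) = β ∧
      cyclicLength (φ wordTwo) = ℓ}.encard = 4) ∧
    (Odd ℓ ∨ ℓ < 4 → {β | ∃ φ : MulAut (FreeGroup Bool), cl (φ wordTwo) = β ∧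
      cyclicLength (φ wordTwo) = ℓ}.encard = 0) := by
  refine ⟨?_, ?_, ?_⟩
  · rintro ⟨m, rfl⟩ h
    rw [encard_orbit_wordTwo cl hcl (fun n => n = m + m)]
    have e : {n : ℕ | (if n = 1 then 4 else 2 * n) = m + m} = {m} := by
      ext n
      simp only [Set.mem_ofPred_eq, Set.mem_singleton_iff]
      split_ifs <;> omega
    rw [e, Set.biUnion_singleton, encard_halfVec (by omega)]
    congr 3
    omega
  · rintro rfl
    rw [encard_orbit_wordTwo cl hcl (fun n => n = 4)]
    -- Norm `1` comes from the exceptional length of `abaB`, norm `2` from words such as `abba`;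
    -- together `2Φ(1) + 2Φ(2) = 4`.
    have e : {n : ℕ | (if n = 1 then 4 else 2 * n) = 4} = {1, 2} := by
      ext n
      simp only [Set.mem_ofPred_eq, Set.mem_singleton_iff, Set.mem_insert_iff]
      split_ifs <;> omega
    rw [e, Set.biUnion_pair, Set.encard_union_eq, encard_halfVec one_pos, encard_halfVec two_pos]
    · norm_num
    · rw [Set.disjoint_left]
      rintro v h h'
      have := h.1.2.symm.trans h'.1.2
      omega
  · intro h
    rw [encard_orbit_wordTwo cl hcl (fun n => n = ℓ)]
    rw [Set.encard_eq_zero, Set.eq_empty_iff_forall_notMem]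
    intro v hv
    simp only [Set.mem_iUnion, Set.mem_ofPred_eq, exists_prop] at hv
    obtain ⟨n, hn, hv⟩ := hv
    obtain rfl : n = 0 := by
      rcases h with ⟨m, rfl⟩ | h <;> split_ifs at hn <;> omega
    rw [halfVec_zero] at hv
    exact hv

end FreeGroup

/-! ### Free homotopy and conjugacy -/

namespace CurveClass

variable {S T : Type*} [TopologicalSpace S] [TopologicalSpace T]

/-- The class of a loop. -/
def ofPath {x : S} (p : Path x x) : CurveClass S :=
  Quotient.mk (ClosedCurve.unorientedSetoid S) ⟨p.toContinuousMap, by simp⟩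

theorem ofLoop_mk {x : S} (p : Path x x) :
    ofLoop (FundamentalGroup.fromPath (Path.Homotopic.Quotient.mk p)) = ofPath p := rfl

/-- The class of the image of a closed curve under a homeomorphism between two spaces. -/
def push (h : S ≃ₜ T) : CurveClass S → CurveClass T :=
  Quotient.map
    (fun γ : ClosedCurve S => (⟨(h : C(S, T)).comp γ.1, by simp [γ.2]⟩ : ClosedCurve T)) (by
      have key : ∀ {γ δ : ClosedCurve S}, ClosedCurve.FreelyHomotopic γ δ →
          ClosedCurve.FreelyHomotopic (⟨(h : C(S, T)).comp γ.1, by simp [γ.2]⟩ : ClosedCurve T)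
            ⟨(h : C(S, T)).comp δ.1, by simp [δ.2]⟩ := by
        rintro γ δ ⟨F⟩
        refine ⟨⟨⟨⟨fun p => h (F p), by fun_prop⟩, ?_, ?_⟩, ?_⟩⟩
        · intro t; simp
        · intro t; simp
        · intro t
          have := F.prop' t
          simpa using this
      rintro γ δ (H | H)
      · exact Or.inl (key H)
      · exact Or.inr (key H))

theorem push_self (h : S ≃ₜ S) (α : CurveClass S) : push h α = α.map h := by
  induction α using Quotient.ind
  rfl

theorem push_push {U : Type*} [TopologicalSpace U] (h : S ≃ₜ T) (k : T ≃ₜ U) (α : CurveClass S) :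
    push k (push h α) = push (h.trans k) α := by
  induction α using Quotient.ind
  rfl

theorem push_refl (α : CurveClass S) : push (Homeomorph.refl S) α = α := by
  induction α using Quotient.ind
  rfl

theorem push_injective (h : S ≃ₜ T) : Function.Injective (push h) := by
  intro α β e
  have := congrArg (push h.symm) e
  rwa [push_push, push_push, Homeomorph.self_trans_symm, push_refl, push_refl] at this

theorem ofPath_eq_of_homotopic {x : S} {p q : Path x x} (h : p.Homotopic q) :
    ofPath p = ofPath q := by
  rw [← ofLoop_mk, ← ofLoop_mk, Path.Homotopic.Quotient.eq.2 h]

/-- The final part of a path, reparametrized. -/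
noncomputable def tailPath {x y : S} (β : Path x y) (s : unitInterval) : Path (β s) y where
  toFun t := β.extend ((s : ℝ) + t * (1 - s))
  continuous_toFun := by fun_prop
  source' := by simp
  target' := by simp

theorem continuous_tailPath {x y : S} (β : Path x y) : Continuous ↿(tailPath β) := by
  change Continuous fun p : unitInterval × unitInterval =>
    β.extend ((p.1 : ℝ) + p.2 * (1 - p.1))
  fun_prop

theorem tailPath_zero {x y : S} (β : Path x y) (t : unitInterval) : tailPath β 0 t = β t := by
  simp [tailPath]

theorem tailPath_one {x y : S} (β : Path x y) (t : unitInterval) : tailPath β 1 t = y := by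
  simp [tailPath]

/-- Sliding the base point of a loop along a path does not change its class. -/
theorem ofPath_trans_trans_symm {x y : S} (β : Path x y) (q : Path y y) :
    ofPath ((β.trans q).trans β.symm) = ofPath q := by
  have hq : Continuous ↿(fun _ : unitInterval => q) := by
    change Continuous fun p : unitInterval × unitInterval => q p.2
    fun_prop
  have hg : Continuous ↿(fun s => ((tailPath β s).trans q).trans (tailPath β s).symm) :=
    Path.trans_continuous_family _
      (Path.trans_continuous_family _ (continuous_tailPath β) _ hq) _
      (Path.symm_continuous_family _ (continuous_tailPath β))
  have e : ofPath (((Path.refl y).trans q).trans (Path.refl y).symm) = ofPath q := by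
    refine ofPath_eq_of_homotopic ?_
    rw [Path.refl_symm]
    exact (Path.Homotopic.trans_refl _).trans (Path.Homotopic.refl_trans _)
  rw [← e]
  -- At time `s` the loop starts at `β s`, follows the rest of `β`, runs around `q` and returns.
  refine Quotient.sound (Or.inl ⟨⟨⟨⟨fun p => ((tailPath β p.1).trans q).trans (tailPath β p.1).symm p.2, hg⟩,
    ?_, ?_⟩, ?_⟩⟩)
  · intro t
    change ((tailPath β 0).trans q).trans (tailPath β 0).symm t = ((β.trans q).trans β.symm) t
    simp only [Path.trans_apply, Path.symm_apply, Function.comp_apply, tailPath_zero]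
  · intro t
    change ((tailPath β 1).trans q).trans (tailPath β 1).symm t =
      (((Path.refl y).trans q).trans (Path.refl y).symm) t
    simp only [Path.trans_apply, Path.symm_apply, Function.comp_apply, tailPath_one, Path.refl_apply]
  · intro t
    simp

/-- The square is simply connected, so the two ways along its boundary are homotopic. A homotopy
through closed curves takes the same values on the two sides `t = 0` and `t = 1`, which both give
the track `β` of the base point. -/
theorem exists_path_of_freelyHomotopic {x y : S} (p : Path x x) (q : Path y y)
    (h : ClosedCurve.FreelyHomotopic ⟨p.toContinuousMap, by simp⟩ ⟨q.toContinuousMap, by simp⟩) :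
    ∃ β : Path x y, (p.trans β).Homotopic (β.trans q) := by
  obtain ⟨F⟩ := h
  let b : Path ((0, 0) : unitInterval × unitInterval) (0, 1) := ⟨⟨fun t => (0, t), by fun_prop⟩, rfl, rfl⟩
  let r : Path ((0, 1) : unitInterval × unitInterval) (1, 1) := ⟨⟨fun t => (t, 1), by fun_prop⟩, rfl, rfl⟩
  let l : Path ((0, 0) : unitInterval × unitInterval) (1, 0) := ⟨⟨fun t => (t, 0), by fun_prop⟩, rfl, rfl⟩
  let t : Path ((1, 0) : unitInterval × unitInterval) (1, 1) := ⟨⟨fun t => (1, t), by fun_prop⟩, rfl, rfl⟩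
  have : ContractibleSpace unitInterval :=
    (convex_Icc (0 : ℝ) 1).contractibleSpace ⟨0, by simp⟩
  have hsq : (b.trans r).Homotopic (l.trans t) := SimplyConnectedSpace.paths_homotopic _ _
  have hF := hsq.map F.toHomotopy.toContinuousMap
  have hF₀ : ∀ t, F (0, t) = p t := fun t => F.apply_zero t
  have hF₁ : ∀ t, F (1, t) = q t := fun t => F.apply_one t
  have hβ : ∀ t, F (t, 0) = F (t, 1) := fun t => F.prop' t
  have e₁ : x = F (0, 0) := by rw [hF₀, p.source]
  have e₂ : x = F (0, 1) := by rw [hF₀, p.target]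
  have e₃ : y = F (1, 0) := by rw [hF₁, q.source]
  have e₄ : y = F (1, 1) := by rw [hF₁, q.target]
  let f := F.toHomotopy.toContinuousMap
  refine ⟨(r.map f.continuous).cast e₂ e₄, ?_⟩
  have hp : p = (b.map f.continuous).cast e₁ e₂ := by
    ext t
    exact (hF₀ t).symm
  have hq : q = (t.map f.continuous).cast e₃ e₄ := by
    ext t
    exact (hF₁ t).symm
  have hr : (r.map f.continuous).cast e₂ e₄ = (l.map f.continuous).cast e₁ e₃ := by
    ext t
    exact (hβ t).symm
  rw [hp]
  conv_rhs => rw [hr, hq]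
  rw [← Path.cast_trans, ← Path.cast_trans, ← Path.map_trans, ← Path.map_trans]
  exact hF

open FundamentalGroup in
theorem ofLoop_conj {x : S} (g c : FundamentalGroup S x) : ofLoop (c * g * c⁻¹) = ofLoop g := by
  induction g using Quotient.ind with | _ p
  induction c using Quotient.ind with | _ β
  have e : (fromPath (Quotient.mk _ β) * fromPath (Quotient.mk _ p) * (fromPath (Quotient.mk _ β))⁻¹ :
      FundamentalGroup S x) =
      fromPath (Path.Homotopic.Quotient.mk (β.symm.trans (p.trans β))) := rfl
  refine (congrArg ofLoop e).trans ?_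
  rw [ofLoop_mk]
  refine Eq.trans ?_ (ofLoop_mk p).symm
  have h := ofPath_trans_trans_symm β.symm p
  rw [Path.symm_symm] at h
  refine Eq.trans (ofPath_eq_of_homotopic ?_) h
  exact (Path.Homotopic.trans_assoc _ _ _).symm

end CurveClass

namespace CurveClass

variable {S T : Type*} [TopologicalSpace S] [TopologicalSpace T]

open FundamentalGroup

theorem ofLoop_inv {x : S} (g : FundamentalGroup S x) : ofLoop g⁻¹ = ofLoop g := by
  induction g using Quotient.ind with | _ p
  have e : ((fromPath (Quotient.mk _ p))⁻¹ : FundamentalGroup S x) =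
      fromPath (Path.Homotopic.Quotient.mk p.symm) := rfl
  refine (congrArg ofLoop e).trans ((ofLoop_mk _).trans (Eq.trans ?_ (ofLoop_mk p).symm))
  exact Quotient.sound (Or.inr (ClosedCurve.FreelyHomotopic.refl _))

theorem isConj_of_freelyHomotopic {x : S} (p q : Path x x)
    (h : ClosedCurve.FreelyHomotopic ⟨p.toContinuousMap, by simp⟩ ⟨q.toContinuousMap, by simp⟩) :
    IsConj (fromPath (Path.Homotopic.Quotient.mk p)) (fromPath (Path.Homotopic.Quotient.mk q)) := by
  obtain ⟨β, hβ⟩ := exists_path_of_freelyHomotopic p q h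
  have h₁ : fromPath (Path.Homotopic.Quotient.mk β) * fromPath (Path.Homotopic.Quotient.mk p) =
      fromPath (Path.Homotopic.Quotient.mk q) * fromPath (Path.Homotopic.Quotient.mk β) :=
    Path.Homotopic.Quotient.eq.2 hβ
  exact isConj_iff.2 ⟨fromPath (Path.Homotopic.Quotient.mk β), by
    rw [h₁, mul_inv_cancel_right]⟩

/-- Classes of loops agree if and only if the loops are conjugate up to inversion. -/
theorem ofLoop_eq_iff {x : S} {g h : FundamentalGroup S x} :
    ofLoop g = ofLoop h ↔ FreeGroup.UConj g h := by
  constructor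
  · induction g using Quotient.ind with | _ p
    induction h using Quotient.ind with | _ q
    intro e
    rcases Quotient.exact e with e | e
    · exact Or.inl (isConj_of_freelyHomotopic p q e)
    · exact Or.inr (isConj_of_freelyHomotopic p q.symm e)
  · have key : ∀ {g h : FundamentalGroup S x}, IsConj g h → ofLoop g = ofLoop h := by
      intro g h H
      obtain ⟨c, rfl⟩ := isConj_iff.1 H
      rw [ofLoop_conj]
    rintro (H | H)
    · exact key H
    · rw [key H, ofLoop_inv]

theorem ofLoop_fundamentalGroupMulEquivOfPath {x y : S} (β : Path x y)
    (g : FundamentalGroup S x) : ofLoop (fundamentalGroupMulEquivOfPath β g) = ofLoop g := by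
  induction g using Quotient.ind with | _ p
  have e : fundamentalGroupMulEquivOfPath β (fromPath (Quotient.mk _ p)) =
      fromPath (Path.Homotopic.Quotient.mk (β.symm.trans (p.trans β))) := rfl
  refine (congrArg ofLoop e).trans ?_
  rw [ofLoop_mk]
  refine Eq.trans ?_ (ofLoop_mk p).symm
  have h := ofPath_trans_trans_symm β.symm p
  rw [Path.symm_symm] at h
  refine Eq.trans (ofPath_eq_of_homotopic ?_) h
  exact (Path.Homotopic.trans_assoc _ _ _).symm

theorem push_ofLoop (e : S ≃ₜ T) {x : S} (g : FundamentalGroup S x) :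
    push e (ofLoop g) = ofLoop (FundamentalGroup.map (e : C(S, T)) x g) := by
  induction g using Quotient.ind with | _ p
  rfl

theorem map_bijective (e : S ≃ₜ T) (x : S) :
    Function.Bijective (FundamentalGroup.map (e : C(S, T)) x) := by
  constructor
  · intro g h
    induction g using Quotient.ind with | _ p
    induction h using Quotient.ind with | _ q
    intro H
    have H' : (p.map e.continuous).Homotopic (q.map e.continuous) := Quotient.exact H
    obtain ⟨F⟩ := H'
    refine Quotient.sound ⟨⟨⟨⟨fun z => e.symm (F z), by fun_prop⟩, ?_, ?_⟩, ?_⟩⟩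
    · intro t; simp
    · intro t; simp
    · intro t z hz
      have := F.prop' t z hz
      simpa using congrArg e.symm this
  · intro g
    induction g using Quotient.ind with | _ p
    refine ⟨fromPath (Path.Homotopic.Quotient.mk
      ((p.map e.symm.continuous).cast (by simp) (by simp))), ?_⟩
    refine congrArg Path.Homotopic.Quotient.mk ?_
    ext t
    simp

/-- The base point is brought back along an arbitrary path; the choice does not matter because free
homotopy classes ignore base points. -/
theorem exists_mulEquiv_push [PathConnectedSpace T] (e : S ≃ₜ T) (x : S) (y : T) :
    ∃ Ψ : FundamentalGroup S x ≃* FundamentalGroup T y,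
      ∀ g, push e (ofLoop g) = ofLoop (Ψ g) := by
  let β := PathConnectedSpace.somePath (e x) y
  refine ⟨(MulEquiv.ofBijective _ (map_bijective e x)).trans (fundamentalGroupMulEquivOfPath β),
    fun g => ?_⟩
  rw [push_ofLoop]
  exact (ofLoop_fundamentalGroupMulEquivOfPath β _).symm

end CurveClass

section

open FreeGroup CurveClass

/-! ### Markings of the fundamental group -/

section Marking

variable {S T : Type*} [TopologicalSpace S] [TopologicalSpace T]

/-- The unoriented class of a word under a marking of the fundamental group. Words are read from
left to right, hence the opposite group. -/
noncomputable def markedClass {x : S} (e : FreeGroup Bool ≃* (FundamentalGroup S x)ᵐᵒᵖ) (g : FreeGroup Bool) :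
    CurveClass S :=
  ofLoop (e g).unop

/-- An automorphism of the free group is realized by a homeomorphism. -/
def Realized {x : S} (e : FreeGroup Bool ≃* (FundamentalGroup S x)ᵐᵒᵖ)
    (φ : MulAut (FreeGroup Bool)) : Prop :=
  ∃ h : S ≃ₜ S, ∀ g, (markedClass e g).map h = markedClass e (φ g)

theorem uconj_op {G : Type*} [Group G] (g h : Gᵐᵒᵖ) : UConj g h ↔ UConj g.unop h.unop := by
  have key : ∀ g h : Gᵐᵒᵖ, IsConj g h ↔ IsConj g.unop h.unop := by
    intro g h
    rw [isConj_iff, isConj_iff]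
    constructor
    · rintro ⟨c, rfl⟩
      exact ⟨(c.unop)⁻¹, by simp [mul_assoc]⟩
    · rintro ⟨c, hc⟩
      refine ⟨MulOpposite.op c⁻¹, MulOpposite.unop_injective ?_⟩
      rw [← hc]
      simp [mul_assoc]
  rw [UConj, UConj, key, key, MulOpposite.unop_inv]

theorem uconj_mulEquiv {G H : Type*} [Group G] [Group H] (e : G ≃* H) (g h : G) :
    UConj (e g) (e h) ↔ UConj g h := by
  refine ⟨fun H => ?_, ?_⟩
  · rcases H with H | H
    · left; simpa using e.symm.toMonoidHom.map_isConj H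
    · right; simpa using e.symm.toMonoidHom.map_isConj H
  · rintro (H | H)
    · exact Or.inl (e.toMonoidHom.map_isConj H)
    · exact Or.inr (by simpa using e.toMonoidHom.map_isConj H)

theorem markedClass_eq_iff {x : S} (e : FreeGroup Bool ≃* (FundamentalGroup S x)ᵐᵒᵖ)
    (g h : FreeGroup Bool) : markedClass e g = markedClass e h ↔ UConj g h := by
  rw [markedClass, markedClass, ofLoop_eq_iff, ← uconj_op, uconj_mulEquiv]

theorem map_trans (h k : S ≃ₜ S) (α : CurveClass S) : (α.map h).map k = α.map (h.trans k) := by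
  rw [← push_self, ← push_self, ← push_self, push_push]

/-- Inner automorphisms do not change classes, so the identity homeomorphism handles them and three
homeomorphisms suffice. -/
theorem realized_of_elementary {x : S} {e : FreeGroup Bool ≃* (FundamentalGroup S x)ᵐᵒᵖ}
    (swap : Realized e swapAut) (inv : Realized e invAut) (mul : Realized e mulAut₁)
    (φ : MulAut (FreeGroup Bool)) : Realized e φ := by
  have step : ∀ φ ψ, Realized e φ → Realized e ψ → Realized e (φ * ψ) := by
    rintro φ ψ ⟨h, hh⟩ ⟨k, hk⟩
    refine ⟨k.trans h, fun g => ?_⟩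
    rw [← map_trans, hk, hh]
    rfl
  refine mulAut_induction (Q := Realized e) ?_ (fun φ h => step _ _ h swap)
    (fun φ h => step _ _ h inv) (fun φ h => step _ _ h mul) ?_ φ
  · exact ⟨Homeomorph.refl S, fun g => by rw [← push_self, push_refl]; rfl⟩
  · rintro g φ ⟨h, hh⟩
    refine ⟨h, fun w => ?_⟩
    rw [hh, markedClass_eq_iff]
    exact Or.inl (isConj_iff.2 ⟨g, by simp⟩)

/-- The marking of a homeomorphic space. -/
theorem exists_marking_of_homeomorph [PathConnectedSpace T] (θ : S ≃ₜ T) (x : S) {y : T}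
    (e : FreeGroup Bool ≃* (FundamentalGroup T y)ᵐᵒᵖ) (he : ∀ φ, Realized e φ) :
    ∃ e' : FreeGroup Bool ≃* (FundamentalGroup S x)ᵐᵒᵖ, ∀ φ, Realized e' φ := by
  obtain ⟨Ψ, hΨ⟩ := exists_mulEquiv_push θ x y
  have hcl : ∀ g, push θ (markedClass (e.trans (MulEquiv.op Ψ.symm)) g) = markedClass e g := by
    intro g
    rw [markedClass, hΨ]
    simp [markedClass]
  refine ⟨e.trans (MulEquiv.op Ψ.symm), fun φ => ?_⟩
  obtain ⟨h, hh⟩ := he φ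
  refine ⟨(θ.trans h).trans θ.symm, fun g => push_injective θ ?_⟩
  rw [hcl, ← hh, ← hcl, ← push_self, push_push, ← push_self, push_push]
  congr 1
  ext z
  simp

/-- The marking with a prescribed generating pair. -/
theorem exists_marking_of_closure_eq_top {x : S}
    (e : FreeGroup Bool ≃* (FundamentalGroup S x)ᵐᵒᵖ) (he : ∀ φ, Realized e φ)
    {a b : FundamentalGroup S x} (hab : Subgroup.closure {a, b} = ⊤) :
    ∃ e' : FreeGroup Bool ≃* (FundamentalGroup S x)ᵐᵒᵖ, (∀ φ, Realized e' φ) ∧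
      (e' (of true)).unop = a ∧ (e' (of false)).unop = b := by
  -- Inversion identifies the group with its opposite; the inverses in `htop` undo it and leave the
  -- generated subgroup unchanged.
  let E : FundamentalGroup S x ≃* FreeGroup Bool := (MulEquiv.inv' _).trans e.symm
  have hE : ∀ g, (e (E g)⁻¹).unop = g := by intro g; simp [E]
  have htop : Subgroup.closure {(E a)⁻¹, (E b)⁻¹} = ⊤ := by
    have h₁ := congrArg (Subgroup.map E.toMonoidHom) hab
    rw [MonoidHom.map_closure, Set.image_pair, ← MonoidHom.range_eq_map,
      MonoidHom.range_eq_top.2 E.surjective] at h₁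
    rw [← h₁, ← Subgroup.closure_inv, Set.inv_insert, Set.inv_singleton, inv_inv, inv_inv]
    rfl
  obtain ⟨φ, h₁, h₂⟩ := exists_mulAut_of_closure_eq_top htop
  refine ⟨MulEquiv.trans φ e, fun ψ => ?_, ?_, ?_⟩
  · obtain ⟨h, hh⟩ := he (φ * ψ * φ⁻¹)
    refine ⟨h, fun g => ?_⟩
    have := hh (φ g)
    simpa [markedClass] using this
  · rw [MulEquiv.trans_apply, h₁, hE]
  · rw [MulEquiv.trans_apply, h₂, hE]

/-- The letters as signed generators. -/
def Letter.toSigned : Letter → Bool × Bool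
  | .a => (true, true)
  | .b => (false, true)
  | .A => (true, false)
  | .B => (false, false)

/-- The signed generators as letters. -/
def Letter.ofSigned : Bool × Bool → Letter
  | (true, true) => .a
  | (false, true) => .b
  | (true, false) => .A
  | (false, false) => .B

theorem Letter.toSigned_ofSigned (i : Bool × Bool) : (Letter.ofSigned i).toSigned = i := by
  obtain ⟨_ | _, _ | _⟩ := i <;> rfl

theorem wordLoop_eq {x : S} {e : FreeGroup Bool ≃* (FundamentalGroup S x)ᵐᵒᵖ}
    {a b : FundamentalGroup S x} (ha : (e (of true)).unop = a) (hb : (e (of false)).unop = b)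
    (w : List Letter) : wordLoop a b w = (e (FreeGroup.mk (w.map Letter.toSigned))).unop := by
  induction w with
  | nil => rw [List.map_nil, ← FreeGroup.one_eq_mk]; simp [wordLoop]
  | cons l w ih =>
    have h : FreeGroup.mk ((l :: w).map Letter.toSigned) =
        FreeGroup.mk [l.toSigned] * FreeGroup.mk (w.map Letter.toSigned) := by simp
    have h₃ : FreeGroup.mk [(true, false)] = (of true)⁻¹ := rfl
    have h₄ : FreeGroup.mk [(false, false)] = (of false)⁻¹ := rfl
    rw [h, _root_.map_mul, MulOpposite.unop_mul, ← ih, wordLoop]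
    congr 1
    cases l
    · exact ha.symm
    · exact hb.symm
    · rw [Letter.toSigned, h₃, _root_.map_inv, MulOpposite.unop_inv, ha]; rfl
    · rw [Letter.toSigned, h₄, _root_.map_inv, MulOpposite.unop_inv, hb]; rfl

theorem wordClass_eq {x : S} {e : FreeGroup Bool ≃* (FundamentalGroup S x)ᵐᵒᵖ}
    {a b : FundamentalGroup S x} (ha : (e (of true)).unop = a) (hb : (e (of false)).unop = b)
    (w : List Letter) :
    wordClass a b w = markedClass e (FreeGroup.mk (w.map Letter.toSigned)) := by
  rw [wordClass, wordLoop_eq ha hb, markedClass]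

theorem wordLength_markedClass {x : S} {e : FreeGroup Bool ≃* (FundamentalGroup S x)ᵐᵒᵖ}
    {a b : FundamentalGroup S x} (ha : (e (of true)).unop = a) (hb : (e (of false)).unop = b)
    (g : FreeGroup Bool) : wordLength a b (markedClass e g) = cyclicLength g := by
  unfold wordLength cyclicLength
  congr 1
  ext n
  constructor
  · rintro ⟨w, rfl, h⟩
    rw [wordClass_eq ha hb, markedClass_eq_iff] at h
    exact ⟨_, by simp, h⟩
  · rintro ⟨L, rfl, h⟩
    refine ⟨L.map Letter.ofSigned, by simp, ?_⟩
    rw [wordClass_eq ha hb, markedClass_eq_iff, List.map_map]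
    have : Letter.toSigned ∘ Letter.ofSigned = id := funext Letter.toSigned_ofSigned
    rwa [this, List.map_id]

/-- Every homeomorphism induces an automorphism of the free group, and `he` supplies the converse.
-/
theorem orbOfLength_markedClass [PathConnectedSpace S] {x : S}
    {e : FreeGroup Bool ≃* (FundamentalGroup S x)ᵐᵒᵖ} (he : ∀ φ, Realized e φ)
    {a b : FundamentalGroup S x} (ha : (e (of true)).unop = a) (hb : (e (of false)).unop = b)
    (g : FreeGroup Bool) (ℓ : ℕ) :
    orbOfLength a b (markedClass e g) ℓ =
      {β | ∃ φ : MulAut (FreeGroup Bool), markedClass e (φ g) = β ∧ cyclicLength (φ g) = ℓ} := by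
  ext β
  constructor
  · rintro ⟨⟨h, rfl⟩, hl⟩
    obtain ⟨Ψ, hΨ⟩ := exists_mulEquiv_push h x x
    have h₁ : (markedClass e g).map h =
        markedClass e (((e.trans (MulEquiv.op Ψ)).trans e.symm : MulAut (FreeGroup Bool)) g) := by
      rw [← push_self, markedClass, hΨ]
      simp [markedClass]
    rw [h₁, wordLength_markedClass ha hb] at hl
    exact ⟨_, h₁.symm, hl⟩
  · rintro ⟨φ, rfl, hl⟩
    obtain ⟨h, hh⟩ := he φ
    exact ⟨⟨h, (hh g).symm⟩, by rwa [wordLength_markedClass ha hb]⟩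

end Marking

end

/-! ### Monodromy of coverings given by locally constant transition functions -/

section

open Topology

section Transport

/-- Transport along paths for a family of locally defined frames with locally constant transition
functions: a homotopy class of paths acts on `G`, and a path inside one of the charts acts by the
quotient of the frame at its end points. -/
theorem exists_transport {X G ι : Type*} [TopologicalSpace X] [Group G] (U : ι → Set X)
    (hU : ∀ i, IsOpen (U i)) (hcov : ∀ p, ∃ i, p ∈ U i) (s : ι → X → G)
    (hs : ∀ i j, ∀ p ∈ U i ∩ U j, ∀ᶠ q in 𝓝 p, (s j q)⁻¹ * s i q = (s j p)⁻¹ * s i p) :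
    ∃ M : ∀ {p q : X}, Path.Homotopic.Quotient p q → G → G,
      (∀ p g, M (Path.Homotopic.Quotient.refl p) g = g) ∧
      (∀ {p q r : X} (γ : Path.Homotopic.Quotient p q) (δ : Path.Homotopic.Quotient q r) g,
        M (γ.trans δ) g = M δ (M γ g)) ∧
      ∀ i {p q : X} (γ : Path p q), (∀ t, γ t ∈ U i) →
        ∀ g, M (Path.Homotopic.Quotient.mk γ) g = s i q * (s i p)⁻¹ * g := by
  -- With discrete fibre the bundle glued from the transition functions is a covering.
  let _ : TopologicalSpace G := ⊥
  have : DiscreteTopology G := ⟨rfl⟩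
  choose idx hidx using hcov
  let Z : FiberBundleCore ι X G :=
    { baseSet := U
      isOpen_baseSet := hU
      indexAt := idx
      mem_baseSet_at := hidx
      coordChange := fun i j p v => (s j p)⁻¹ * s i p * v
      coordChange_self := by intro i p _ v; simp
      continuousOn_coordChange := by
        rintro i j ⟨p, v⟩ hp
        apply ContinuousAt.continuousWithinAt
        have h := (hs i j p hp.1).prod_inl_nhds v
        have h₂ : ∀ᶠ z : X × G in 𝓝 (p, v), z.2 = v :=
          
          (continuous_snd.tendsto (p, v)).eventually
            (show ∀ᶠ w in 𝓝 v, w = v by rw [nhds_discrete]; rfl)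
        refine ContinuousAt.congr (f := fun _ => (s j p)⁻¹ * s i p * v) continuousAt_const ?_
        filter_upwards [h, h₂] with z hz hz₂
        rw [hz, hz₂]
      coordChange_comp := by intro i j k p _ v; group }
  have cov : IsCoveringMap Z.proj := FiberBundle.isCoveringMap (F := G) (E := Z.Fiber)
  -- The product of `s i p` with the fibre coordinate in chart `i` does not depend on `i`. This
  -- identifies every fibre with `G`; the identification jumps with the frame.
  let pt : ∀ p : X, G → Z.proj ⁻¹' {p} := fun p g => ⟨⟨p, (s (idx p) p)⁻¹ * g⟩, rfl⟩
  let co : ∀ p : X, Z.proj ⁻¹' {p} → G := fun p e => s (idx p) p * (show G from e.1.2)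
  have total_ext : ∀ {x y : X} (v w : G), x = y → v = w →
      (⟨x, v⟩ : Bundle.TotalSpace G Z.Fiber) = ⟨y, w⟩ := by
    rintro x _ v _ rfl rfl; rfl
  have copt : ∀ p g, co p (pt p g) = g := by intro p g; simp [co, pt]
  have ptco : ∀ p e, pt p (co p e) = e := by
    rintro p ⟨⟨q, v⟩, hq⟩
    obtain rfl : q = p := hq
    exact Subtype.ext (total_ext _ _ rfl (inv_mul_cancel_left (s (idx q) q) (show G from v)))
  refine ⟨fun {p q} γ g => co q (cov.monodromy γ (pt p g)), ?_, ?_, ?_⟩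
  · intro p g
    change co p (cov.monodromy _ (pt p g)) = g
    rw [cov.monodromy_refl]
    exact copt p g
  · intro p q r γ δ g
    change co r (cov.monodromy _ _) = co r (cov.monodromy _ (pt q (co q _)))
    rw [cov.monodromy_trans_apply, ptco]
  · intro i p q γ hγ g
    let v : G := (s i p)⁻¹ * g
    have hcont : Continuous fun t => (Z.localTriv i).toOpenPartialHomeomorph.symm (γ t, v) := by
      refine (Z.localTriv i).toOpenPartialHomeomorph.continuousOn_symm.comp_continuous
        (by fun_prop) fun t => ?_
      rw [(Z.localTriv i).target_eq]
      exact ⟨hγ t, trivial⟩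
    have hval : ∀ t, (Z.localTriv i).toOpenPartialHomeomorph.symm (γ t, v) =
      ⟨γ t, (s (idx (γ t)) (γ t))⁻¹ * s i (γ t) * v⟩ := fun t => rfl
    have hp : (pt p g).1 = (Z.localTriv i).toOpenPartialHomeomorph.symm (γ 0, v) := by
      rw [hval]
      exact total_ext _ _ γ.source.symm (by rw [γ.source]; simp [v])
    have hq : (pt q (s i q * (s i p)⁻¹ * g)).1 =
        (Z.localTriv i).toOpenPartialHomeomorph.symm (γ 1, v) := by
      rw [hval]
      exact total_ext _ _ γ.target.symm (by rw [γ.target]; simp [v, mul_assoc])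
    -- The lift of `γ` has constant coordinate `v` in chart `i`.
    let Γ : Path (pt p g).1 (pt q (s i q * (s i p)⁻¹ * g)).1 := ⟨⟨_, hcont⟩, hp.symm, hq.symm⟩
    have := cov.monodromy_eq_of_map_eq (γ := Path.Homotopic.Quotient.mk γ)
      (Path.Homotopic.Quotient.mk Γ) ?_
    · change co q (cov.monodromy _ (pt p g)) = _
      rw [this, copt]
    · rfl

end Transport

end

-- The telescoping identity by which connecting paths `δ`, `δ₁` cut a long loop into short ones.
open CategoryTheory in
theorem CategoryTheory.Groupoid.comp_inv_comp_comp {C : Type*} [Groupoid C] {w x y z : C}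
    (α : x ⟶ y) (δ : w ⟶ y) (τ : y ⟶ z) (δ₁ δ₂ : w ⟶ z) :
    ((α ≫ Groupoid.inv δ) ≫ ((δ ≫ τ) ≫ Groupoid.inv δ₁)) ≫ (δ₁ ≫ Groupoid.inv δ₂) =
      (α ≫ τ) ≫ Groupoid.inv δ₂ := by
  simp

section Generation

variable {X : Type*} [TopologicalSpace X]

theorem Path.forall_trans_mem {x y z : X} {γ : Path x y} {δ : Path y z} {U : Set X}
    (hγ : ∀ t, γ t ∈ U) (hδ : ∀ t, δ t ∈ U) (t : unitInterval) : γ.trans δ t ∈ U := by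
  have : γ.trans δ t ∈ Set.range γ ∪ Set.range δ := by
    rw [← Path.trans_range]; exact ⟨t, rfl⟩
  rcases this with ⟨s, hs⟩ | ⟨s, hs⟩
  · rw [← hs]; exact hγ s
  · rw [← hs]; exact hδ s

theorem Path.subpath_mem_of_forall {p q : X} {γ : Path p q}
    {s s' : unitInterval} (hs : s ≤ s') {U : Set X} (h : ∀ v ∈ Set.Icc s s', γ v ∈ U) (u : unitInterval) :
    γ.subpath s s' u ∈ U := by
  have : γ.subpath s s' u ∈ Set.range (γ.subpath s s') := ⟨u, rfl⟩
  rw [Path.range_subpath_of_le _ _ _ hs] at this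
  obtain ⟨v, hv, hv'⟩ := this
  exact hv' ▸ h v hv

theorem Path.mk_trans_symm_cast {x y : X} (hy : y = x) (β : Path x y) :
    Path.Homotopic.Quotient.mk (β.trans ((Path.refl x).cast rfl hy).symm) =
      Path.Homotopic.Quotient.mk (β.cast rfl hy.symm) := by
  subst hy
  simp

/-- The fundamental group is generated by the loops inside the members of an open cover with path
connected intersections. -/
theorem FundamentalGroup.eq_top_of_open_cover {ι : Type*} {U : ι → Set X} (hU : ∀ i, IsOpen (U i))
    (hcov : ∀ p, ∃ i, p ∈ U i) {x : X} (hx : ∀ i, x ∈ U i)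
    (hconn : ∀ i j, ∀ p ∈ U i ∩ U j, JoinedIn (U i ∩ U j) x p)
    (K : Subgroup (FundamentalGroup X x))
    (hK : ∀ i (γ : Path x x), (∀ t, γ t ∈ U i) →
      FundamentalGroup.fromPath (Path.Homotopic.Quotient.mk γ) ∈ K) : K = ⊤ := by
  rw [eq_top_iff]
  rintro g -
  induction g using Quotient.ind with | _ γ
  obtain ⟨t, ht₀, hmono, ⟨N, hN⟩, ht⟩ := exists_monotone_Icc_subset_open_cover_unitInterval
    (c := fun i => γ ⁻¹' U i) (fun i => (hU i).preimage γ.continuous)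
    (fun s _ => by obtain ⟨i, hi⟩ := hcov (γ s); exact Set.mem_iUnion.2 ⟨i, hi⟩)
  let α : ∀ s, Path x (γ s) := fun s => (γ.subpath 0 s).cast γ.source.symm rfl
  -- The return path is arbitrary inside any one member of the cover, so the induction can switch
  -- members at each subdivision point.
  have main : ∀ n i (δ : Path x (γ (t n))), (∀ u, δ u ∈ U i) →
      FundamentalGroup.fromPath (Path.Homotopic.Quotient.mk ((α (t n)).trans δ.symm)) ∈ K := by
    intro n
    induction n with
    | zero =>
      intro i δ hδ
      refine hK i _ (Path.forall_trans_mem (fun u => ?_) fun u => hδ _)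
      have : α (t 0) u = x := by
        change γ (Set.Icc.convexComb 0 (t 0) u) = x
        simp [ht₀]
      rw [this]
      exact hx i
    | succ n ih =>
      intro j δ₂ hδ₂
      obtain ⟨i, hi⟩ := ht n
      have hle := hmono n.le_succ
      have hs : γ (t n) ∈ U i := hi ⟨le_rfl, hle⟩
      have hs' : γ (t (n + 1)) ∈ U i := hi ⟨hle, le_rfl⟩
      obtain ⟨δ, hδ⟩ := hconn i i _ ⟨hs, hs⟩
      obtain ⟨δ₁, hδ₁⟩ := hconn i j _ ⟨hs', by simpa using hδ₂ 1⟩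
      let τ := γ.subpath (t n) (t (n + 1))
      have hτ : ∀ u, τ u ∈ U i := Path.subpath_mem_of_forall hle fun v hv => hi hv
      -- The loop out along `γ` and back along `δ₂` is the product of the earlier loop closed by
      -- `δ`, a loop in `U i`, and a loop in `U j`; `δ₁` lies in both members.
      have h₁ := ih i δ fun u => (hδ u).1
      have h₂ := hK i ((δ.trans τ).trans δ₁.symm) (Path.forall_trans_mem
        (Path.forall_trans_mem (fun u => (hδ u).1) hτ) fun u => (hδ₁ _).1)
      have h₃ := hK j (δ₁.trans δ₂.symm) (Path.forall_trans_mem (fun u => (hδ₁ u).2)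
        fun u => hδ₂ _)
      have h₄ : Path.Homotopic.Quotient.mk ((α (t n)).trans τ) =
          Path.Homotopic.Quotient.mk (α (t (n + 1))) :=
        Path.Homotopic.Quotient.eq.2 (Path.Homotopic.pathCast
          ⟨Path.Homotopy.subpathTransSubpath γ 0 (t n) (t (n + 1))⟩ γ.source.symm rfl)
      have h₅ := CategoryTheory.Groupoid.comp_inv_comp_comp (C := FundamentalGroupoid X)
        (w := ⟨x⟩) (x := ⟨x⟩) (y := ⟨γ (t n)⟩) (z := ⟨γ (t (n + 1))⟩)
        (Path.Homotopic.Quotient.mk (α (t n))) (Path.Homotopic.Quotient.mk δ)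
        (Path.Homotopic.Quotient.mk τ) (Path.Homotopic.Quotient.mk δ₁)
        (Path.Homotopic.Quotient.mk δ₂)
      have h₆ : FundamentalGroup.fromPath
          (Path.Homotopic.Quotient.mk ((α (t (n + 1))).trans δ₂.symm)) =
          (Path.Homotopic.Quotient.mk ((α (t n)).trans τ)).trans
            (Path.Homotopic.Quotient.mk δ₂).symm := by
        rw [h₄]; rfl
      rw [h₆]
      have h₇ := K.mul_mem h₃ (K.mul_mem h₂ h₁)
      exact (congrArg (· ∈ K) h₅).mp h₇
  have fin : ∀ i (δ : Path x (γ 1)), (∀ u, δ u ∈ U i) →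
      FundamentalGroup.fromPath (Path.Homotopic.Quotient.mk ((α 1).trans δ.symm)) ∈ K := by
    rw [← hN N le_rfl]
    exact main N
  obtain ⟨i, -⟩ := hcov x
  have := fin i ((Path.refl x).cast rfl γ.target) (fun u => hx i)
  rw [Path.mk_trans_symm_cast] at this
  have hγ : (α 1).cast rfl γ.target.symm = γ := by
    ext u
    simp [α]
  rw [hγ] at this
  exact this

end Generation

section

open Topology unitInterval

/-! ### Coordinates on the one-holed torus -/

namespace HoledTorus

/-- A coordinate that keeps the point outside of the hole, whatever the other coordinate is. -/
def Good (r : ℝ) (z : UnitAddCircle) : Prop := z ≠ 0 ∧ r ≤ ‖z‖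

variable {r : ℝ}

/-- For the sup norm, lying outside the hole means that one coordinate alone keeps the point
outside. Homotopies can thus be checked one coordinate at a time, for the puncture and the boundary
alike. -/
theorem mem_iff (p : UnitAddCircle × UnitAddCircle) :
    (p ≠ 0 ∧ r ≤ ‖p‖) ↔ Good r p.1 ∨ Good r p.2 := by
  obtain ⟨x, y⟩ := p
  simp only [Good, Prod.norm_def, ne_eq, Prod.mk_eq_zero, not_and_or, le_sup_iff]
  constructor
  · rintro ⟨h, h'⟩
    by_cases hx : x = 0
    · have hy : y ≠ 0 := by tauto
      refine Or.inr ⟨hy, ?_⟩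
      rcases h' with h' | h'
      · subst hx
        rw [norm_zero] at h'
        exact h'.trans (norm_nonneg y)
      · exact h'
    · by_cases hy : y = 0
      · refine Or.inl ⟨hx, ?_⟩
        rcases h' with h' | h'
        · exact h'
        · subst hy
          rw [norm_zero] at h'
          exact h'.trans (norm_nonneg x)
      · tauto
  · tauto

theorem norm_coe_of_mem {x : ℝ} (h₀ : 0 ≤ x) (h₁ : x ≤ 1) :
    ‖(x : UnitAddCircle)‖ = min x (1 - x) := by
  rcases le_total x (1 / 2) with h | h
  · rw [(AddCircle.norm_coe_eq_abs_iff 1 one_ne_zero).2 (by rw [abs_of_nonneg h₀]; simpa using h),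
      abs_of_nonneg h₀, min_eq_left (by linarith)]
  · have e : (x : UnitAddCircle) = ((x - 1 : ℝ) : UnitAddCircle) := by
      rw [AddCircle.coe_sub, AddCircle.coe_period, sub_zero]
    rw [e, (AddCircle.norm_coe_eq_abs_iff 1 one_ne_zero).2, abs_of_nonpos (by linarith),
      min_eq_right (by linarith)]
    · ring
    · rw [abs_of_nonpos (by linarith), abs_one]
      linarith

theorem coe_ne_zero_of_mem {x : ℝ} (h₀ : 0 < x) (h₁ : x < 1) : (x : UnitAddCircle) ≠ 0 := by
  intro h
  obtain ⟨n, hn⟩ := AddCircle.coe_eq_zero_iff (p := (1 : ℝ)).1 h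
  rw [zsmul_one] at hn
  rw [← hn] at h₀ h₁
  norm_cast at h₀ h₁
  omega

theorem good_coe_iff {x : ℝ} (h₀ : 0 < x) (h₁ : x < 1) :
    Good r (x : UnitAddCircle) ↔ r ≤ x ∧ x ≤ 1 - r := by
  rw [Good, norm_coe_of_mem h₀.le h₁.le, le_min_iff]
  constructor
  · rintro ⟨-, h, h'⟩
    exact ⟨h, by linarith⟩
  · rintro ⟨h, h'⟩
    exact ⟨coe_ne_zero_of_mem h₀ h₁, h, by linarith⟩

theorem coe_add_one (x : ℝ) : ((x + 1 : ℝ) : UnitAddCircle) = x := AddCircle.coe_add_period 1 x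

theorem coe_add_intCast (x : ℝ) (n : ℤ) : ((x + n : ℝ) : UnitAddCircle) = x := by
  have h : ((n : ℝ) : UnitAddCircle) = 0 := AddCircle.coe_eq_zero_iff (p := (1 : ℝ)).2 ⟨n, by simp⟩
  rw [AddCircle.coe_add, h, add_zero]

theorem good_half (hr : r < 1 / 2) : Good r ((1 / 2 : ℝ) : UnitAddCircle) :=
  (good_coe_iff (by norm_num) (by norm_num)).2 ⟨hr.le, by linarith⟩

/-- The representative of an element of the circle in `[0, 1)`. -/
noncomputable def rep (z : UnitAddCircle) : ℝ := AddCircle.equivIco 1 0 z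

theorem coe_rep (z : UnitAddCircle) : (rep z : UnitAddCircle) = z := AddCircle.coe_equivIco

theorem rep_nonneg (z : UnitAddCircle) : 0 ≤ rep z := (AddCircle.equivIco 1 0 z).2.1

theorem rep_lt_one (z : UnitAddCircle) : rep z < 1 := by
  have h : rep z < 0 + 1 := (AddCircle.equivIco 1 0 z).2.2
  rwa [zero_add] at h

theorem rep_pos {z : UnitAddCircle} (hz : z ≠ 0) : 0 < rep z := by
  refine (rep_nonneg z).lt_of_ne fun h => hz ?_
  rw [← coe_rep z, ← h, AddCircle.coe_zero]

theorem rep_coe {x : ℝ} (h₀ : 0 ≤ x) (h₁ : x < 1) : rep x = x :=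
  AddCircle.equivIco_coe_of_mem ⟨h₀, by rwa [zero_add]⟩

theorem continuousAt_rep {z : UnitAddCircle} (hz : z ≠ 0) : ContinuousAt rep z :=
  continuous_subtype_val.continuousAt.comp
    (AddCircle.continuousAt_equivIco 1 0 (by simpa using hz))

/-- The point with given coordinates. -/
def point (x y : ℝ) (h : Good r (x : UnitAddCircle) ∨ Good r (y : UnitAddCircle)) :
    HoledTorus r :=
  ⟨(x, y), (mem_iff _).2 h⟩

theorem continuous_point {Y : Type*} [TopologicalSpace Y] {x y : Y → ℝ}
    (h : ∀ t, Good r (x t : UnitAddCircle) ∨ Good r (y t : UnitAddCircle)) (hx : Continuous x)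
    (hy : Continuous y) : Continuous fun t => point (x t) (y t) (h t) :=
  Continuous.subtype_mk (((AddCircle.continuous_mk' 1).comp hx).prodMk
    ((AddCircle.continuous_mk' 1).comp hy)) _

/-- The homeomorphism of the one-holed torus given by a homeomorphism of the torus. -/
def homeo (e : UnitAddCircle × UnitAddCircle ≃ₜ UnitAddCircle × UnitAddCircle)
    (he : ∀ p, (p ≠ 0 ∧ r ≤ ‖p‖) ↔ (e p ≠ 0 ∧ r ≤ ‖e p‖)) : HoledTorus r ≃ₜ HoledTorus r :=
  e.subtype he

/-- The exchange of the coordinates. -/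
def swap : HoledTorus r ≃ₜ HoledTorus r :=
  homeo (Homeomorph.prodComm _ _) fun p => by
    rw [mem_iff, mem_iff]
    exact or_comm

/-- The reflection of the first coordinate. -/
def flip : HoledTorus r ≃ₜ HoledTorus r :=
  homeo ((Homeomorph.neg _).prodCongr (Homeomorph.refl _)) fun p => by
    rw [mem_iff, mem_iff]
    simp [Good]

/-- Two paths with lifts to the plane between which the straight line homotopy avoids the hole. -/
theorem homotopic_of_lift {p q : HoledTorus r} {γ δ : Path p q} {x y x' y' : I → ℝ}
    (hx : Continuous x) (hy : Continuous y) (hx' : Continuous x') (hy' : Continuous y')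
    (hγ : ∀ t, (γ t).1 = (↑(x t), ↑(y t))) (hδ : ∀ t, (δ t).1 = (↑(x' t), ↑(y' t)))
    (x₀ : x 0 = x' 0) (x₁ : x 1 = x' 1) (y₀ : y 0 = y' 0) (y₁ : y 1 = y' 1)
    (h : ∀ s t : I, Good r (((1 - s) * x t + s * x' t : ℝ) : UnitAddCircle) ∨
      Good r (((1 - s) * y t + s * y' t : ℝ) : UnitAddCircle)) : γ.Homotopic δ := by
  refine ⟨⟨⟨⟨fun z => point _ _ (h z.1 z.2), ?_⟩, ?_, ?_⟩, ?_⟩⟩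
  · exact continuous_point (fun z : I × I => h z.1 z.2) (by fun_prop) (by fun_prop)
  · intro t
    apply Subtype.ext
    simp [point, hγ]
  · intro t
    apply Subtype.ext
    simp [point, hδ]
  · rintro s t (rfl | rfl)
    · apply Subtype.ext
      change ((_ : UnitAddCircle), (_ : UnitAddCircle)) = (γ 0).1
      rw [hγ, ← x₀, ← y₀, ← add_mul, ← add_mul]
      simp
    · apply Subtype.ext
      change ((_ : UnitAddCircle), (_ : UnitAddCircle)) = (γ 1).1
      rw [hγ, ← x₁, ← y₁, ← add_mul, ← add_mul]
      simp

end HoledTorus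

end

/-! ### Standard loops and generators of the fundamental group -/

section

open Topology unitInterval

namespace HoledTorus

variable {r : ℝ}

/-- The base point. -/
noncomputable def base (hr : r < 1 / 2) : HoledTorus r := point (1 / 2) (1 / 2) (Or.inl (good_half hr))

/-- The loop that runs `n` times around the torus vertically. -/
noncomputable def vloop (hr : r < 1 / 2) (n : ℤ) : Path (base hr) (base hr) where
  toFun t := point (1 / 2) (1 / 2 + n * t) (Or.inl (good_half hr))
  continuous_toFun := continuous_point _ (by fun_prop) (by fun_prop)
  source' := by apply Subtype.ext; simp [point, base]
  target' := by
    apply Subtype.ext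
    change ((_ : UnitAddCircle), (_ : UnitAddCircle)) = (_, _)
    rw [Set.Icc.coe_one, mul_one, coe_add_intCast]

/-- The loop that runs `n` times around the torus horizontally. -/
noncomputable def hloop (hr : r < 1 / 2) (n : ℤ) : Path (base hr) (base hr) where
  toFun t := point (1 / 2 + n * t) (1 / 2) (Or.inr (good_half hr))
  continuous_toFun := continuous_point _ (by fun_prop) (by fun_prop)
  source' := by apply Subtype.ext; simp [point, base]
  target' := by
    apply Subtype.ext
    change ((_ : UnitAddCircle), (_ : UnitAddCircle)) = (_, _)
    rw [Set.Icc.coe_one, mul_one, coe_add_intCast]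

theorem vloop_apply (hr : r < 1 / 2) (n : ℤ) (t : I) :
    (vloop hr n t).1 = (((1 / 2 : ℝ) : UnitAddCircle), ((1 / 2 + n * t : ℝ) : UnitAddCircle)) := rfl

theorem hloop_apply (hr : r < 1 / 2) (n : ℤ) (t : I) :
    (hloop hr n t).1 = (((1 / 2 + n * t : ℝ) : UnitAddCircle), ((1 / 2 : ℝ) : UnitAddCircle)) := rfl

/-- Good values in `(0, 1)` form an interval that contains `1 / 2`. -/
theorem good_segment {x u : ℝ} (h₀ : 0 < x) (h₁ : x < 1) (hu₀ : 0 ≤ u)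
    (hu₁ : u ≤ 1) (h : Good r (x : UnitAddCircle)) :
    Good r (((1 - u) * x + u * (1 / 2) : ℝ) : UnitAddCircle) := by
  rw [good_coe_iff h₀ h₁] at h
  rw [good_coe_iff (by nlinarith) (by nlinarith)]
  constructor <;> nlinarith

/-- The points off the first coordinate axis are connected to the base point. -/
theorem exists_path_of_fst_ne_zero (hr : r < 1 / 2) (p : HoledTorus r) (hp : p.1.1 ≠ 0) :
    ∃ γ : Path (base hr) p, ∀ t, (γ t).1.1 ≠ 0 ∧ (p.1.2 ≠ 0 → (γ t).1.2 ≠ 0) := by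
  -- While the first coordinate moves to `1 / 2`, either it is good and stays so, or the unmoved
  -- second coordinate is good.
  have hg : ∀ u : I, Good r (((1 - u) * rep p.1.1 + u * (1 / 2) : ℝ) : UnitAddCircle) ∨
      Good r (rep p.1.2 : UnitAddCircle) := by
    intro u
    rcases (mem_iff p.1).1 p.2 with h | h
    · left
      refine good_segment (rep_pos hp) (rep_lt_one _) u.2.1 u.2.2 ?_
      rwa [coe_rep]
    · right
      rwa [coe_rep]
  let q : HoledTorus r := point (1 / 2) (rep p.1.2) (Or.inl (good_half hr))
  let γ₁ : Path q (base hr) :=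
    { toFun := fun t => point (1 / 2) ((1 - t) * rep p.1.2 + t * (1 / 2)) (Or.inl (good_half hr))
      continuous_toFun := continuous_point _ (by fun_prop) (by fun_prop)
      source' := by apply Subtype.ext; simp [point, q]
      target' := by apply Subtype.ext; simp [point, base] }
  let γ₂ : Path p q :=
    { toFun := fun t => point _ _ (hg t)
      continuous_toFun := continuous_point _ (by fun_prop) (by fun_prop)
      source' := by apply Subtype.ext; simp [point, coe_rep]
      target' := by apply Subtype.ext; simp [point, q] }
  refine ⟨(γ₂.trans γ₁).symm, fun t => Path.forall_trans_mem
    (U := {z : HoledTorus r | z.1.1 ≠ 0 ∧ (p.1.2 ≠ 0 → z.1.2 ≠ 0)}) (fun t => ⟨?_, ?_⟩)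
    (fun t => ⟨?_, ?_⟩) _⟩
  · have := rep_pos hp
    have := rep_lt_one p.1.1
    have := t.2.1
    have := t.2.2
    exact coe_ne_zero_of_mem (by nlinarith) (by nlinarith)
  · intro h
    change (rep p.1.2 : UnitAddCircle) ≠ 0
    rwa [coe_rep]
  · exact coe_ne_zero_of_mem (by norm_num) (by norm_num)
  · intro h
    have := rep_pos h
    have := rep_lt_one p.1.2
    have := t.2.1
    have := t.2.2
    exact coe_ne_zero_of_mem (by nlinarith) (by nlinarith)

theorem exists_path_of_snd_ne_zero (hr : r < 1 / 2) (p : HoledTorus r) (hp : p.1.2 ≠ 0) :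
    ∃ γ : Path (base hr) p, ∀ t, (γ t).1.2 ≠ 0 ∧ (p.1.1 ≠ 0 → (γ t).1.1 ≠ 0) := by
  obtain ⟨γ, hγ⟩ := exists_path_of_fst_ne_zero hr (swap p) hp
  exact ⟨γ.map swap.continuous, hγ⟩

theorem fst_ne_zero_or_snd_ne_zero (p : HoledTorus r) : p.1.1 ≠ 0 ∨ p.1.2 ≠ 0 := by
  rcases (mem_iff p.1).1 p.2 with h | h
  · exact Or.inl h.1
  · exact Or.inr h.1

theorem pathConnectedSpace (hr : r < 1 / 2) : PathConnectedSpace (HoledTorus r) := by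
  have h : ∀ p : HoledTorus r, Joined (base hr) p := by
    intro p
    rcases fst_ne_zero_or_snd_ne_zero p with hp | hp
    · obtain ⟨γ, -⟩ := exists_path_of_fst_ne_zero hr p hp
      exact ⟨γ⟩
    · obtain ⟨γ, -⟩ := exists_path_of_snd_ne_zero hr p hp
      exact ⟨γ⟩
  exact ⟨⟨base hr⟩, fun p q => (h p).symm.trans (h q)⟩

/-- Off the value `0` the first coordinate lifts to `(0, 1)` and is pushed straight to `1 / 2`. The
second coordinate, lifted to the line, is then straightened freely. -/
theorem exists_homotopic_vloop (hr : r < 1 / 2) (γ : Path (base hr) (base hr))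
    (hγ : ∀ t, (γ t).1.1 ≠ 0) : ∃ n, γ.Homotopic (vloop hr n) := by
  have hc : Continuous fun t => (γ t).1 := continuous_subtype_val.comp γ.continuous
  have hx : Continuous fun t => rep (γ t).1.1 := continuous_iff_continuousAt.2 fun t =>
    (continuousAt_rep (hγ t)).comp (f := fun t => (γ t).1.1) (continuous_fst.comp hc).continuousAt
  have hx₀ : rep (γ 0).1.1 = 1 / 2 := by
    rw [γ.source]; exact rep_coe (by norm_num) (by norm_num)
  have hx₁ : rep (γ 1).1.1 = 1 / 2 := by
    rw [γ.target]; exact rep_coe (by norm_num) (by norm_num)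
  let c : C(I, UnitAddCircle) := ⟨fun t => (γ t).1.2, continuous_snd.comp hc⟩
  have hc₀ : c 0 = ((1 / 2 : ℝ) : UnitAddCircle) := by
    change (γ 0).1.2 = _
    rw [γ.source]
    rfl
  have cov := AddCircle.isCoveringMap_coe (1 : ℝ)
  let y := cov.liftPath c (1 / 2) hc₀
  have hy : ∀ t, (y t : UnitAddCircle) = (γ t).1.2 := fun t =>
    congrFun (cov.liftPath_lifts c (1 / 2) hc₀) t
  have hy₀ : y 0 = 1 / 2 := cov.liftPath_zero c (1 / 2) hc₀
  obtain ⟨n, hn⟩ : ∃ n : ℤ, y 1 = 1 / 2 + n := by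
    have h : ((y 1 - 1 / 2 : ℝ) : UnitAddCircle) = 0 := by
      rw [AddCircle.coe_sub, hy, γ.target]
      exact sub_self _
    obtain ⟨n, hn⟩ := AddCircle.coe_eq_zero_iff (p := (1 : ℝ)).1 h
    rw [zsmul_one] at hn
    exact ⟨n, by linarith⟩
  let δ : Path (base hr) (base hr) :=
    { toFun := fun t => point (1 / 2) (y t) (Or.inl (good_half hr))
      continuous_toFun := continuous_point _ (by fun_prop) (by fun_prop)
      source' := by apply Subtype.ext; simp [point, base, hy₀]
      target' := by
        apply Subtype.ext
        change ((_ : UnitAddCircle), (_ : UnitAddCircle)) = (_, _)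
        rw [hn, coe_add_intCast] }
  refine ⟨n, Path.Homotopic.trans (p₁ := δ) ?_ ?_⟩
  · refine homotopic_of_lift hx y.continuous continuous_const y.continuous (fun t => ?_)
      (fun t => rfl) hx₀ hx₁ rfl rfl fun s t => ?_
    · rw [coe_rep, hy]
    · rcases (mem_iff (γ t).1).1 (γ t).2 with h | h
      · left
        refine good_segment (rep_pos (hγ t)) (rep_lt_one _) s.2.1 s.2.2 ?_
        rwa [coe_rep]
      · right
        rw [← add_mul, sub_add_cancel, one_mul, hy]
        exact h
  · refine homotopic_of_lift continuous_const y.continuous continuous_const (by fun_prop)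
      (fun t => rfl) (vloop_apply hr n) rfl rfl (by simp [hy₀]) (by simp [hn]) fun s t => ?_
    left
    rw [← add_mul, sub_add_cancel, one_mul]
    exact good_half hr

theorem exists_homotopic_hloop (hr : r < 1 / 2) (γ : Path (base hr) (base hr))
    (hγ : ∀ t, (γ t).1.2 ≠ 0) : ∃ n, γ.Homotopic (hloop hr n) := by
  obtain ⟨n, hn⟩ := exists_homotopic_vloop hr (γ.map swap.continuous) hγ
  exact ⟨n, hn.map ⟨swap, swap.continuous⟩⟩

theorem vloop_trans_vloop (hr : r < 1 / 2) (m n : ℤ) :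
    ((vloop hr m).trans (vloop hr n)).Homotopic (vloop hr (m + n)) := by
  refine homotopic_of_lift (x := fun _ => 1 / 2) (x' := fun _ => 1 / 2)
    -- A lift of the concatenation in one formula; `min` and `max` switch halves at `t = 1 / 2`.
    (y := fun t => 1 / 2 + m * min (2 * (t : ℝ)) 1 + n * max (2 * (t : ℝ) - 1) 0)
    (y' := fun t => 1 / 2 + (m + n : ℤ) * (t : ℝ))
    (by fun_prop) (by fun_prop) (by fun_prop) (by fun_prop) (fun t => ?_) (vloop_apply hr _)
    rfl rfl ?_ ?_ fun s t => ?_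
  · rw [Path.trans_apply]
    split_ifs with h
    · rw [vloop_apply, min_eq_left (by linarith), max_eq_right (by linarith)]
      simp
    · rw [vloop_apply, min_eq_right (by linarith), max_eq_left (by linarith), mul_one,
        add_right_comm, coe_add_intCast]
  · norm_num
  · norm_num
    ring
  · left
    rw [← add_mul, sub_add_cancel, one_mul]
    exact good_half hr

open FundamentalGroup in
/-- The class of the vertical loop. -/
noncomputable def vclass (hr : r < 1 / 2) : FundamentalGroup (HoledTorus r) (base hr) :=
  fromPath (Path.Homotopic.Quotient.mk (vloop hr 1))

open FundamentalGroup in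
/-- The class of the horizontal loop. -/
noncomputable def hclass (hr : r < 1 / 2) : FundamentalGroup (HoledTorus r) (base hr) :=
  fromPath (Path.Homotopic.Quotient.mk (hloop hr 1))

open FundamentalGroup in
theorem fromPath_vloop (hr : r < 1 / 2) (n : ℤ) :
    fromPath (Path.Homotopic.Quotient.mk (vloop hr n)) =
      vclass hr ^ n := by
  let φ : Multiplicative ℤ →* FundamentalGroup (HoledTorus r) (base hr) :=
    MonoidHom.mk' (fun n => fromPath (Path.Homotopic.Quotient.mk (vloop hr n.toAdd))) fun m n => by
      rw [toAdd_mul, add_comm]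
      exact (Path.Homotopic.Quotient.eq.2 (vloop_trans_vloop hr n.toAdd m.toAdd)).symm
  have := map_zpow φ (Multiplicative.ofAdd 1) n
  rw [← ofAdd_zsmul, zsmul_one] at this
  exact this

open FundamentalGroup in
theorem fromPath_hloop (hr : r < 1 / 2) (n : ℤ) :
    fromPath (Path.Homotopic.Quotient.mk (hloop hr n)) =
      hclass hr ^ n := by
  have := congrArg (FundamentalGroup.map ⟨swap, swap.continuous⟩ (base hr)) (fromPath_vloop hr n)
  rw [map_zpow] at this
  exact this

/-- The two loops generate the fundamental group. -/
theorem closure_loops (hr : r < 1 / 2) :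
    Subgroup.closure {hclass hr, vclass hr} = ⊤ := by
  have hc₁ : Continuous fun p : HoledTorus r => p.1.1 := continuous_fst.comp continuous_subtype_val
  have hc₂ : Continuous fun p : HoledTorus r => p.1.2 := continuous_snd.comp continuous_subtype_val
  have hb : (base hr).1.1 ≠ 0 := (good_half hr).1
  -- The cover consists of the sets where one given coordinate is nonzero; loops inside each are
  -- homotopic to multiples of a single standard loop.
  refine FundamentalGroup.eq_top_of_open_cover
    (U := fun i : Bool => if i then {p : HoledTorus r | p.1.1 ≠ 0} else {p | p.1.2 ≠ 0})
    ?_ ?_ ?_ ?_ _ ?_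
  · rintro (_ | _)
    · exact isOpen_compl_singleton.preimage hc₂
    · exact isOpen_compl_singleton.preimage hc₁
  · intro p
    rcases fst_ne_zero_or_snd_ne_zero p with h | h
    · exact ⟨true, h⟩
    · exact ⟨false, h⟩
  · rintro (_ | _)
    · exact hb
    · exact hb
  · rintro (_ | _) (_ | _) p ⟨h, h'⟩
    · obtain ⟨γ, hγ⟩ := exists_path_of_snd_ne_zero hr p h
      exact ⟨γ, fun t => ⟨(hγ t).1, (hγ t).1⟩⟩
    · obtain ⟨γ, hγ⟩ := exists_path_of_snd_ne_zero hr p h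
      exact ⟨γ, fun t => ⟨(hγ t).1, (hγ t).2 h'⟩⟩
    · obtain ⟨γ, hγ⟩ := exists_path_of_fst_ne_zero hr p h
      exact ⟨γ, fun t => ⟨(hγ t).1, (hγ t).2 h'⟩⟩
    · obtain ⟨γ, hγ⟩ := exists_path_of_fst_ne_zero hr p h
      exact ⟨γ, fun t => ⟨(hγ t).1, (hγ t).1⟩⟩
  · rintro (_ | _) γ hγ
    · obtain ⟨n, hn⟩ := exists_homotopic_hloop hr γ hγ
      rw [Path.Homotopic.Quotient.eq.2 hn, fromPath_hloop]
      exact Subgroup.zpow_mem _ (Subgroup.subset_closure (Set.mem_insert _ _)) n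
    · obtain ⟨n, hn⟩ := exists_homotopic_vloop hr γ hγ
      rw [Path.Homotopic.Quotient.eq.2 hn, fromPath_vloop]
      exact Subgroup.zpow_mem _ (Subgroup.subset_closure (Set.mem_insert_of_mem _ (Set.mem_singleton _))) n

end HoledTorus

end

/-! ### A covering with fibre the free group, and freeness of the fundamental group -/

section

open Topology unitInterval FreeGroup

theorem Path.Homotopic.Quotient.mk_eq_trans_trans_subpath {X : Type*} [TopologicalSpace X] {p q : X}
    (γ : Path p q) (s s' : I) :
    Path.Homotopic.Quotient.mk (γ.cast γ.source γ.target) =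
      ((Path.Homotopic.Quotient.mk (γ.subpath 0 s)).trans
        (Path.Homotopic.Quotient.mk (γ.subpath s s'))).trans
        (Path.Homotopic.Quotient.mk (γ.subpath s' 1)) := by
  rw [← Path.subpath_zero_one]
  refine (Path.Homotopic.Quotient.eq.2 ?_).symm
  exact (Path.Homotopic.hcomp ⟨Path.Homotopy.subpathTransSubpath γ 0 s s'⟩ (.refl _)).trans
    ⟨Path.Homotopy.subpathTransSubpath γ 0 s' 1⟩

namespace HoledTorus

variable {r : ℝ}

/-- The coordinate of a given kind. -/
def coord (c : Bool) (p : HoledTorus r) : UnitAddCircle := if c then p.1.1 else p.1.2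

theorem continuous_coord (c : Bool) : Continuous (coord c : HoledTorus r → UnitAddCircle) := by
  cases c
  · exact continuous_snd.comp continuous_subtype_val
  · exact continuous_fst.comp continuous_subtype_val

theorem coord_ne_zero_or (c : Bool) (p : HoledTorus r) : coord c p ≠ 0 ∨ coord (!c) p ≠ 0 := by
  cases c
  · exact (fst_ne_zero_or_snd_ne_zero p).symm
  · exact fst_ne_zero_or_snd_ne_zero p

/-- Three charts that trivialize the covering with free fundamental group quotient. -/
def chart : Option Bool → Set (HoledTorus r)
  | none => {p | coord true p ≠ 0 ∧ coord false p ≠ 0}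
  | some c => {p | coord c p ≠ ((1 / 2 : ℝ) : UnitAddCircle) ∧ coord (!c) p ≠ 0}

/-- The frames over the charts. -/
noncomputable def frame : Option Bool → HoledTorus r → FreeGroup Bool
  | none, _ => 1
  | some c, p => if 1 / 2 < rep (coord c p) then of c else 1

theorem isOpen_chart (i : Option Bool) : IsOpen (chart i : Set (HoledTorus r)) := by
  rcases i with _ | c
  · exact (isOpen_compl_singleton.preimage (continuous_coord _)).inter
      (isOpen_compl_singleton.preimage (continuous_coord _))
  · exact (isOpen_compl_singleton.preimage (continuous_coord _)).inter
      (isOpen_compl_singleton.preimage (continuous_coord _))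

theorem exists_mem_chart (p : HoledTorus r) : ∃ i, p ∈ chart i := by
  have h₀ : ((1 / 2 : ℝ) : UnitAddCircle) ≠ 0 := coe_ne_zero_of_mem (by norm_num) (by norm_num)
  by_cases h : ∃ c, coord c p = 0
  · obtain ⟨c, hc⟩ := h
    exact ⟨some c, by rw [hc]; exact h₀.symm, (coord_ne_zero_or c p).resolve_left (· hc)⟩
  · push Not at h
    exact ⟨none, h _, h _⟩

theorem frame_eventually_eq {c : Bool} {p : HoledTorus r} (h₀ : coord c p ≠ 0)
    (h : coord c p ≠ ((1 / 2 : ℝ) : UnitAddCircle)) :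
    ∀ᶠ q in 𝓝 p, frame (some c) q = frame (some c) p := by
  have hc : ContinuousAt (fun q : HoledTorus r => rep (coord c q)) p :=
    (continuousAt_rep h₀).comp (continuous_coord c).continuousAt
  have hne : rep (coord c p) ≠ 1 / 2 := by
    intro e
    rw [← e, coe_rep] at h
    exact h rfl
  rcases hne.lt_or_gt with hlt | hlt
  · filter_upwards [hc.eventually_lt_const hlt] with q hq
    simp only [frame]
    rw [if_neg hq.not_gt, if_neg hlt.not_gt]
  · filter_upwards [hc.eventually_const_lt hlt] with q hq
    simp only [frame]
    rw [if_pos hq, if_pos hlt]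

/-- The frame of `some c` can jump only where coordinate `c` is `1 / 2` or `0`. The first value is
excluded by its own chart, the second by every other chart. -/
theorem frame_eventually_eq_of_mem {i j : Option Bool} (hij : i ≠ j) {p : HoledTorus r}
    (hi : p ∈ chart i) (hj : p ∈ chart j) : ∀ᶠ q in 𝓝 p, frame i q = frame i p := by
  rcases i with _ | c
  · exact Filter.Eventually.of_forall fun _ => rfl
  · refine frame_eventually_eq ?_ hi.1
    rcases j with _ | d
    · cases c
      exacts [hj.2, hj.1]
    · have : c = !d := by cases c <;> cases d <;> simp_all
      rw [this]
      exact hj.2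

/-- Transport in a covering of the one-holed torus with fibre the free group. -/
theorem exists_loop_action (hr : r < 1 / 2) :
    ∃ M : FundamentalGroup (HoledTorus r) (base hr) → FreeGroup Bool → FreeGroup Bool,
      (∀ g, M 1 g = g) ∧ (∀ α β g, M (α * β) g = M α (M β g)) ∧
      (∀ g, M (hclass hr) g = (of true)⁻¹ * g) ∧ ∀ g, M (vclass hr) g = (of false)⁻¹ * g := by
  obtain ⟨M, hM₁, hM₂, hM₃⟩ := exists_transport (chart : Option Bool → Set (HoledTorus r))
    isOpen_chart exists_mem_chart frame (by
      rintro i j p ⟨hi, hj⟩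
      by_cases hij : i = j
      · subst hij
        simp
      · filter_upwards [frame_eventually_eq_of_mem hij hi hj,
          frame_eventually_eq_of_mem (Ne.symm hij) hj hi] with q h₁ h₂
        rw [h₁, h₂])
  have key : ∀ (c : Bool) (γ : Path (base hr) (base hr)),
      (∀ t, coord c (γ t) = ((1 / 2 + t : ℝ) : UnitAddCircle)) →
      (∀ t, coord (!c) (γ t) = ((1 / 2 : ℝ) : UnitAddCircle)) →
      ∀ g, M (Path.Homotopic.Quotient.mk γ) g = (of c)⁻¹ * g := by
    intro c γ h₁ h₂ g
    have cast_eq : ∀ {p q p' q' : HoledTorus r} (γ : Path p q) (h : p' = p) (h' : q' = q) g,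
        M (Path.Homotopic.Quotient.mk (γ.cast h h')) g = M (Path.Homotopic.Quotient.mk γ) g := by
      rintro p q p' q' γ rfl rfl g
      rfl
    have hhalf : ((1 / 2 : ℝ) : UnitAddCircle) ≠ 0 := (good_half hr).1
    -- The moving coordinate starts at `1 / 2` and passes `0` at time `1 / 2`. Only the middle
    -- piece, between times `1 / 4` and `3 / 4`, needs the chart `some c`; there the frame changes
    -- from `of c` to `1`, and the outer pieces act trivially.
    let s : I := ⟨1 / 4, by norm_num, by norm_num⟩
    let s' : I := ⟨3 / 4, by norm_num, by norm_num⟩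
    have none_mem : ∀ t, coord c (γ t) ≠ 0 → γ t ∈ chart none := by
      intro t h
      have h' : coord (!c) (γ t) ≠ 0 := by rw [h₂]; exact hhalf
      cases c
      exacts [⟨h', h⟩, ⟨h, h'⟩]
    have hs : ∀ t : I, (t : ℝ) < 1 / 2 → coord c (γ t) ≠ 0 := by
      intro t ht
      rw [h₁]
      have := t.2.1
      exact coe_ne_zero_of_mem (by linarith) (by linarith)
    have hs' : ∀ t : I, 1 / 2 < (t : ℝ) →
        coord c (γ t) = ((t - 1 / 2 : ℝ) : UnitAddCircle) := by
      intro t ht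
      rw [h₁, ← coe_add_one (t - 1 / 2)]
      congr 1
      ring
    have f₁ : frame (some c) (γ s) = of c := by
      simp only [frame]
      rw [h₁, rep_coe (by norm_num [s]) (by norm_num [s]), if_pos (by norm_num [s])]
    have f₂ : frame (some c) (γ s') = 1 := by
      simp only [frame]
      rw [hs' s' (by norm_num [s']), rep_coe (by norm_num [s']) (by norm_num [s']),
        if_neg (by norm_num [s'])]
    rw [← cast_eq γ γ.source γ.target, Path.Homotopic.Quotient.mk_eq_trans_trans_subpath γ s s',
      hM₂, hM₂, hM₃ none, hM₃ (some c), hM₃ none, f₁, f₂]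
    · simp [frame]
    · refine Path.subpath_mem_of_forall (Subtype.coe_le_coe.1 (by norm_num [s])) fun t ht =>
        none_mem t (hs t ?_)
      have : (t : ℝ) ≤ 1 / 4 := ht.2
      linarith
    · refine Path.subpath_mem_of_forall (Subtype.coe_le_coe.1 (by norm_num [s, s']))
        fun t ht => ⟨?_, by rw [h₂]; exact hhalf⟩
      have ht₁ : 1 / 4 ≤ (t : ℝ) := ht.1
      have ht₂ : (t : ℝ) ≤ 3 / 4 := ht.2
      rw [h₁, AddCircle.coe_add]
      intro h
      exact coe_ne_zero_of_mem (by linarith) (by linarith) (add_eq_left.1 h)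
    · refine Path.subpath_mem_of_forall (Subtype.coe_le_coe.1 (by norm_num [s'])) fun t ht =>
        none_mem t ?_
      have ht₁ : 3 / 4 ≤ (t : ℝ) := ht.1
      have ht₂ : (t : ℝ) ≤ 1 := ht.2
      rw [hs' t (by linarith)]
      exact coe_ne_zero_of_mem (by linarith) (by linarith)
  -- A product of loop classes runs its right factor first, so transport becomes a left action.
  refine ⟨fun α g => M α g, hM₁ _, fun α β g => hM₂ β α g, ?_, ?_⟩
  · refine key true _ (fun t => ?_) fun t => rfl
    change ((1 / 2 + (1 : ℤ) * t : ℝ) : UnitAddCircle) = _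
    rw [Int.cast_one, one_mul]
  · refine key false _ (fun t => ?_) fun t => rfl
    change ((1 / 2 + (1 : ℤ) * t : ℝ) : UnitAddCircle) = _
    rw [Int.cast_one, one_mul]

/-- The fundamental group is free on the two loops. -/
theorem exists_marking (hr : r < 1 / 2) :
    ∃ e : FreeGroup Bool ≃* (FundamentalGroup (HoledTorus r) (base hr))ᵐᵒᵖ,
      (e (of true)).unop = hclass hr ∧ (e (of false)).unop = vclass hr := by
  let ρ : FreeGroup Bool →* (FundamentalGroup (HoledTorus r) (base hr))ᵐᵒᵖ :=
    FreeGroup.lift fun c => MulOpposite.op (if c then hclass hr else vclass hr)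
  have h₁ : (ρ (of true)).unop = hclass hr := by simp [ρ]
  have h₂ : (ρ (of false)).unop = vclass hr := by simp [ρ]
  obtain ⟨M, hM₁, hM₂, ha, hb⟩ := exists_loop_action hr
  -- Transport along `ρ w` determines `w`, which gives injectivity.
  have hM : ∀ w g, M (ρ w).unop g = w⁻¹ * g := by
    intro w
    induction w using FreeGroup.induction_on with
    | C1 =>
      intro g
      rw [_root_.map_one, MulOpposite.unop_one, hM₁, inv_one, one_mul]
    | of c =>
      cases c
      · rw [h₂]; exact hb
      · rw [h₁]; exact ha
    | inv_of c ih =>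
      intro g
      have h := ih ((of c) * g)
      rw [inv_mul_cancel_left] at h
      rw [← h, ← hM₂, _root_.map_inv, MulOpposite.unop_inv, inv_mul_cancel, hM₁, inv_inv, h]
    | mul u v hu hv =>
      intro g
      rw [_root_.map_mul, MulOpposite.unop_mul, hM₂, hu, hv, mul_inv_rev, mul_assoc]
  have hinj : Function.Injective ρ := by
    rw [injective_iff_map_eq_one]
    intro w hw
    have := hM w 1
    rw [hw, MulOpposite.unop_one, hM₁, mul_one] at this
    exact inv_eq_one.1 this.symm
  have hsurj : Function.Surjective ρ := by
    intro α
    have hmem : ∀ β ∈ Subgroup.closure {hclass hr, vclass hr}, ∃ w, (ρ w).unop = β := by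
      intro β hβ
      induction hβ using Subgroup.closure_induction with
      | mem β hβ =>
        rcases hβ with rfl | hβ
        · exact ⟨_, h₁⟩
        · exact ⟨_, h₂.trans (Set.mem_singleton_iff.1 hβ).symm⟩
      | one => exact ⟨1, by simp⟩
      | mul β γ _ _ hβ hγ =>
        obtain ⟨u, rfl⟩ := hβ
        obtain ⟨v, rfl⟩ := hγ
        exact ⟨v * u, by simp⟩
      | inv β _ hβ =>
        obtain ⟨u, rfl⟩ := hβ
        exact ⟨u⁻¹, by simp⟩
    obtain ⟨w, hw⟩ := hmem α.unop (by rw [closure_loops]; exact Subgroup.mem_top _)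
    exact ⟨w, MulOpposite.unop_injective hw⟩
  exact ⟨MulEquiv.ofBijective ρ ⟨hinj, hsurj⟩, h₁, h₂⟩

end HoledTorus

end

/-! ### Homeomorphisms that realize the elementary automorphisms -/

section

open Topology unitInterval FreeGroup CurveClass FundamentalGroup

theorem CurveClass.ofLoop_mapOfEq {S : Type*} [TopologicalSpace S] {x : S} (h : S ≃ₜ S)
    (hx : h x = x) (α : FundamentalGroup S x) :
    ofLoop (mapOfEq (h : C(S, S)) hx α) = (ofLoop α).map h := by
  have cast_eq : ∀ {y z : S} (q : Path.Homotopic.Quotient y y) (hz : z = y),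
      ofLoop (fromPath (q.cast hz hz)) = ofLoop (fromPath q) := by
    rintro y z q rfl
    rw [Path.Homotopic.Quotient.cast_rfl_rfl]
  rw [← push_self, push_ofLoop, mapOfEq_apply]
  exact cast_eq _ hx.symm

/-- An automorphism is realized by a homeomorphism that fixes the base point and acts on the
generators in the same way. -/
theorem realized_of_mapOfEq {S : Type*} [TopologicalSpace S] {x : S}
    {e : FreeGroup Bool ≃* (FundamentalGroup S x)ᵐᵒᵖ} {φ : MulAut (FreeGroup Bool)} (h : S ≃ₜ S)
    (hx : h x = x) (ha : mapOfEq (h : C(S, S)) hx (e (of true)).unop = (e (φ (of true))).unop)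
    (hb : mapOfEq (h : C(S, S)) hx (e (of false)).unop = (e (φ (of false))).unop) :
    Realized e φ := by
  refine ⟨h, fun g => ?_⟩
  rw [markedClass, ← ofLoop_mapOfEq h hx, markedClass]
  congr 1
  induction g using FreeGroup.induction_on with
  | C1 => rw [_root_.map_one, _root_.map_one, _root_.map_one, MulOpposite.unop_one, _root_.map_one]
  | of c =>
    cases c
    exacts [hb, ha]
  | inv_of c ih =>
    rw [_root_.map_inv, _root_.map_inv, _root_.map_inv, MulOpposite.unop_inv, MulOpposite.unop_inv,
      _root_.map_inv, ih]
  | mul u v hu hv =>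
    rw [_root_.map_mul, _root_.map_mul, _root_.map_mul, MulOpposite.unop_mul, MulOpposite.unop_mul,
      _root_.map_mul, hu, hv]

namespace HoledTorus

variable {r : ℝ}

theorem swap_base (hr : r < 1 / 2) : swap (base hr) = base hr := rfl

theorem realized_swapAut (hr : r < 1 / 2)
    {e : FreeGroup Bool ≃* (FundamentalGroup (HoledTorus r) (base hr))ᵐᵒᵖ}
    (ha : (e (of true)).unop = hclass hr) (hb : (e (of false)).unop = vclass hr) :
    Realized e swapAut := by
  refine realized_of_mapOfEq swap (swap_base hr) ?_ ?_
  · rw [ha, swapAut_true, hb, mapOfEq_apply]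
    rfl
  · rw [hb, swapAut_false, ha, mapOfEq_apply]
    rfl

theorem flip_base (hr : r < 1 / 2) : flip (base hr) = base hr := by
  apply Subtype.ext
  change (-((1 / 2 : ℝ) : UnitAddCircle), _) = (((1 / 2 : ℝ) : UnitAddCircle), _)
  congr 1
  rw [← AddCircle.coe_neg, ← coe_add_one]
  norm_num

theorem realized_invAut (hr : r < 1 / 2)
    {e : FreeGroup Bool ≃* (FundamentalGroup (HoledTorus r) (base hr))ᵐᵒᵖ}
    (ha : (e (of true)).unop = hclass hr) (hb : (e (of false)).unop = vclass hr) :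
    Realized e invAut := by
  refine realized_of_mapOfEq flip (flip_base hr) ?_ ?_
  · rw [ha, invAut_true, _root_.map_inv, MulOpposite.unop_inv, ha, mapOfEq_apply]
    refine congrArg Path.Homotopic.Quotient.mk (a₁ := ((hloop hr 1).map flip.continuous).cast
      (flip_base hr).symm (flip_base hr).symm) (a₂ := (hloop hr 1).symm) ?_
    ext t
    apply Subtype.ext
    change (-((1 / 2 + (1 : ℤ) * t : ℝ) : UnitAddCircle), _) =
      (((1 / 2 + (1 : ℤ) * (1 - t) : ℝ) : UnitAddCircle), _)
    congr 1
    -- The lifts `-(1/2 + t)` and `1/2 + (1 - t)` differ by `2`.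
    rw [← AddCircle.coe_neg, ← coe_add_intCast _ 2]
    congr 1
    push_cast
    ring
  · rw [hb, invAut_false, hb, mapOfEq_apply]
    refine congrArg Path.Homotopic.Quotient.mk (a₁ := ((vloop hr 1).map flip.continuous).cast
      (flip_base hr).symm (flip_base hr).symm) (a₂ := vloop hr 1) ?_
    ext t
    apply Subtype.ext
    change (-((1 / 2 : ℝ) : UnitAddCircle), _) = (((1 / 2 : ℝ) : UnitAddCircle), _)
    congr 1
    exact congrArg (fun p : HoledTorus r => p.1.1) (flip_base hr)

/-- The height of the twist over the interval `[1 / 2, 3 / 2]`. -/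
noncomputable def ramp (r x : ℝ) : ℝ := max 0 ((x - 1 - r) / (1 / 2 - r))

/-- The height of the twist. -/
noncomputable def shear (r : ℝ) : UnitAddCircle → UnitAddCircle :=
  AddCircle.liftIco 1 (1 / 2) fun x => (ramp r x : UnitAddCircle)

theorem ramp_of_le {x : ℝ} (hr : r < 1 / 2) (hx : x ≤ 1 + r) : ramp r x = 0 :=
  max_eq_left (div_nonpos_of_nonpos_of_nonneg (by linarith) (by linarith))

theorem ramp_three_half (hr : r < 1 / 2) : ramp r (3 / 2) = 1 := by
  have : (3 / 2 - 1 - r) / (1 / 2 - r) = 1 := by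
    rw [div_eq_one_iff_eq (by linarith)]
    ring
  rw [ramp, this, max_eq_right zero_le_one]

theorem continuous_ramp : Continuous (ramp r) := by
  unfold ramp
  fun_prop

theorem continuous_shear (hr₀ : 0 ≤ r) (hr : r < 1 / 2) : Continuous (shear r) := by
  refine AddCircle.liftIco_continuous ?_
    ((AddCircle.continuous_mk' 1).comp continuous_ramp).continuousOn
  rw [ramp_of_le hr (by linarith), show (1 / 2 + 1 : ℝ) = 3 / 2 by norm_num, ramp_three_half hr,
    AddCircle.coe_period, AddCircle.coe_zero]

theorem shear_coe (hr₀ : 0 ≤ r) (hr : r < 1 / 2) {x : ℝ} (h₀ : 1 / 2 ≤ x) (h₁ : x ≤ 3 / 2) :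
    shear r x = (ramp r x : UnitAddCircle) := by
  rcases h₁.lt_or_eq with h₁ | rfl
  · exact AddCircle.liftIco_coe_apply ⟨h₀, by linarith⟩
  · have h : ((3 / 2 : ℝ) : UnitAddCircle) = ((1 / 2 : ℝ) : UnitAddCircle) := by
      rw [← coe_add_one (1 / 2)]
      norm_num
    rw [ramp_three_half hr, AddCircle.coe_period, h]
    refine (AddCircle.liftIco_coe_apply ⟨le_rfl, by linarith⟩).trans ?_
    rw [ramp_of_le hr (by linarith), AddCircle.coe_zero]

/-- The ramp rises only for `1 + r < x`, that is where the first coordinate is good. Hence the twist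
leaves the second coordinate alone wherever it decides about the hole. -/
theorem shear_of_not_good (hr₀ : 0 ≤ r) (hr : r < 1 / 2) {z : UnitAddCircle}
    (hz : ¬ Good r z) : shear r z = 0 := by
  obtain ⟨x, ⟨h₀, h₁⟩, rfl⟩ : ∃ x ∈ Set.Ico (1 / 2 : ℝ) (1 / 2 + 1), (x : UnitAddCircle) = z :=
    ⟨_, (AddCircle.equivIco 1 (1 / 2) z).2, AddCircle.coe_equivIco⟩
  refine (AddCircle.liftIco_coe_apply ⟨h₀, h₁⟩).trans ?_
  rw [ramp_of_le hr, AddCircle.coe_zero]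
  by_contra! h
  refine hz ?_
  rw [← sub_add_cancel x 1, coe_add_one]
  exact (good_coe_iff (by linarith) (by linarith)).2 ⟨by linarith, by linarith⟩

theorem good_or_good_add_shear_iff (hr₀ : 0 ≤ r) (hr : r < 1 / 2) (x y : UnitAddCircle) :
    Good r x ∨ Good r (y + shear r x) ↔ Good r x ∨ Good r y := by
  by_cases h : Good r x
  · simp [h]
  · rw [shear_of_not_good hr₀ hr h, add_zero]

/-- The Dehn twist. -/
noncomputable def twist (hr₀ : 0 ≤ r) (hr : r < 1 / 2) : HoledTorus r ≃ₜ HoledTorus r :=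
  homeo
    { toFun := fun p => (p.1, p.2 + shear r p.1)
      invFun := fun p => (p.1, p.2 - shear r p.1)
      left_inv := fun p => by simp
      right_inv := fun p => by simp
      continuous_toFun := by
        have := continuous_shear hr₀ hr
        fun_prop
      continuous_invFun := by
        have := continuous_shear hr₀ hr
        fun_prop }
    fun p => by
      rw [mem_iff, mem_iff]
      exact (good_or_good_add_shear_iff hr₀ hr p.1 p.2).symm

theorem twist_apply (hr₀ : 0 ≤ r) (hr : r < 1 / 2) (p : HoledTorus r) :
    (twist hr₀ hr p).1 = (p.1.1, p.1.2 + shear r p.1.1) := rfl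

theorem shear_half (hr₀ : 0 ≤ r) (hr : r < 1 / 2) : shear r ((1 / 2 : ℝ) : UnitAddCircle) = 0 := by
  rw [shear_coe hr₀ hr le_rfl (by norm_num), ramp_of_le hr (by linarith), AddCircle.coe_zero]

theorem twist_base (hr₀ : 0 ≤ r) (hr : r < 1 / 2) : twist hr₀ hr (base hr) = base hr := by
  apply Subtype.ext
  change (((1 / 2 : ℝ) : UnitAddCircle), _ + shear r ((1 / 2 : ℝ) : UnitAddCircle)) = _
  rw [shear_half hr₀ hr, add_zero]
  rfl

/-- The twist maps the horizontal loop to the product of the two loops. -/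
theorem twist_hloop (hr₀ : 0 ≤ r) (hr : r < 1 / 2) :
    (((hloop hr 1).map (twist hr₀ hr).continuous).cast (twist_base hr₀ hr).symm
      (twist_base hr₀ hr).symm).Homotopic ((hloop hr 1).trans (vloop hr 1)) := by
  have hramp := continuous_ramp (r := r)
  have hg : ∀ t : I, Good r ((1 / 2 + min (2 * (t : ℝ)) 1 : ℝ) : UnitAddCircle) ∨
      Good r ((1 / 2 + ramp r (1 / 2 + t) : ℝ) : UnitAddCircle) := by
    intro t
    by_cases h : (t : ℝ) ≤ 1 / 2
    · right
      rw [ramp_of_le hr (by linarith), add_zero]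
      exact good_half hr
    · left
      rw [min_eq_right (by linarith), coe_add_one]
      exact good_half hr
  -- An intermediate path: horizontal motion as in the concatenation, vertical motion as in the
  -- twisted loop. Each of the two straight line homotopies then moves one coordinate only.
  let δ : Path (base hr) (base hr) :=
    { toFun := fun t => point _ _ (hg t)
      continuous_toFun := continuous_point hg (by fun_prop) (by fun_prop)
      source' := by
        apply Subtype.ext
        change ((_ : UnitAddCircle), (_ : UnitAddCircle)) = (_, _)
        rw [Set.Icc.coe_zero, ramp_of_le hr (by linarith)]
        simp
      target' := by
        apply Subtype.ext
        change ((_ : UnitAddCircle), (_ : UnitAddCircle)) = (_, _)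
        rw [Set.Icc.coe_one, show (1 / 2 + 1 : ℝ) = 3 / 2 by norm_num, ramp_three_half hr,
          min_eq_right (by norm_num), coe_add_one] }
  refine Path.Homotopic.trans (p₁ := δ) ?_ ?_
  · refine homotopic_of_lift (x := fun t => 1 / 2 + t) (y := fun t => 1 / 2 + ramp r (1 / 2 + t))
      (x' := fun t => 1 / 2 + min (2 * (t : ℝ)) 1) (y' := fun t => 1 / 2 + ramp r (1 / 2 + t))
      (by fun_prop) (by fun_prop) (by fun_prop) (by fun_prop) (fun t => ?_) (fun t => rfl)
      ?_ ?_ rfl rfl fun s t => ?_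
    · have := t.2.1
      have := t.2.2
      change (twist hr₀ hr (hloop hr 1 t)).1 = _
      rw [twist_apply, hloop_apply, Int.cast_one, one_mul,
        shear_coe hr₀ hr (by linarith) (by linarith), AddCircle.coe_add _ (1 / 2) (ramp r _)]
    · simp
    · norm_num
    · have ht₀ := t.2.1
      have ht₁ := t.2.2
      have hs₀ := s.2.1
      have hs₁ := s.2.2
      -- Up to this time the ramp vanishes and the second coordinate is `1 / 2`; afterwards the
      -- first coordinate stays in `[1 + r, 3 / 2]`.
      by_cases h : (t : ℝ) ≤ 1 / 2 + r
      · right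
        rw [ramp_of_le hr (by linarith), add_zero, ← add_mul, sub_add_cancel, one_mul]
        exact good_half hr
      · left
        rw [min_eq_right (by linarith), ← sub_add_cancel (_ + _) (1 : ℝ), coe_add_one]
        have h₁ : t ≤ (1 - s) * t + (s : ℝ) := by nlinarith
        have h₂ : (1 - s) * t + (s : ℝ) ≤ 1 := by nlinarith
        exact (good_coe_iff (by linarith) (by linarith)).2 ⟨by linarith, by linarith⟩
  · refine homotopic_of_lift (x := fun t => 1 / 2 + min (2 * (t : ℝ)) 1)
      (y := fun t => 1 / 2 + ramp r (1 / 2 + t))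
      (x' := fun t => 1 / 2 + min (2 * (t : ℝ)) 1) (y' := fun t => 1 / 2 + max (2 * (t : ℝ) - 1) 0)
      (by fun_prop) (by fun_prop) (by fun_prop) (by fun_prop) (fun t => rfl) (fun t => ?_)
      rfl rfl ?_ ?_ fun s t => ?_
    · rw [Path.trans_apply]
      split_ifs with h
      · rw [hloop_apply, min_eq_left (by linarith), max_eq_right (by linarith)]
        simp
      · rw [vloop_apply, min_eq_right (by linarith), max_eq_left (by linarith), coe_add_one]
        simp
    · rw [Set.Icc.coe_zero, ramp_of_le hr (by linarith)]
      norm_num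
    · rw [Set.Icc.coe_one, show (1 / 2 + 1 : ℝ) = 3 / 2 by norm_num, ramp_three_half hr]
      norm_num
    · by_cases h : (t : ℝ) ≤ 1 / 2
      · right
        rw [ramp_of_le hr (by linarith), max_eq_right (by linarith), add_zero, ← add_mul,
          sub_add_cancel, one_mul]
        exact good_half hr
      · left
        rw [min_eq_right (by linarith), ← add_mul, sub_add_cancel, one_mul, coe_add_one]
        exact good_half hr

theorem realized_mulAut₁ (hr₀ : 0 ≤ r) (hr : r < 1 / 2)
    {e : FreeGroup Bool ≃* (FundamentalGroup (HoledTorus r) (base hr))ᵐᵒᵖ}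
    (ha : (e (of true)).unop = hclass hr) (hb : (e (of false)).unop = vclass hr) :
    Realized e mulAut₁ := by
  refine realized_of_mapOfEq (twist hr₀ hr) (twist_base hr₀ hr) ?_ ?_
  · rw [mulAut₁_true, _root_.map_mul, MulOpposite.unop_mul, ha, hb, mapOfEq_apply]
    exact Path.Homotopic.Quotient.eq.2 (twist_hloop hr₀ hr)
  · rw [mulAut₁_false, hb, mapOfEq_apply]
    refine congrArg Path.Homotopic.Quotient.mk (a₁ := ((vloop hr 1).map
      (twist hr₀ hr).continuous).cast (twist_base hr₀ hr).symm (twist_base hr₀ hr).symm)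
      (a₂ := vloop hr 1) ?_
    ext t
    apply Subtype.ext
    change (twist hr₀ hr (vloop hr 1 t)).1 = _
    rw [twist_apply, vloop_apply, shear_half hr₀ hr, add_zero]

/-- The fundamental group of the one-holed torus is free of rank two, and all automorphisms are
realized by homeomorphisms. -/
theorem exists_marking_realized (hr₀ : 0 ≤ r) (hr : r < 1 / 2) :
    ∃ e : FreeGroup Bool ≃* (FundamentalGroup (HoledTorus r) (base hr))ᵐᵒᵖ, ∀ φ, Realized e φ := by
  obtain ⟨e, ha, hb⟩ := exists_marking hr
  exact ⟨e, realized_of_elementary (realized_swapAut hr ha hb) (realized_invAut hr ha hb)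
    (realized_mulAut₁ hr₀ hr ha hb)⟩

end HoledTorus

/-- A marking of the fundamental group of a one-holed torus with a prescribed generating pair. -/
theorem IsOneHoledTorus.exists_marking {S : Type*} [TopologicalSpace S] (hS : IsOneHoledTorus S)
    {x : S} {a b : FundamentalGroup S x} (hab : Subgroup.closure {a, b} = ⊤) :
    PathConnectedSpace S ∧ ∃ e : FreeGroup Bool ≃* (FundamentalGroup S x)ᵐᵒᵖ,
      (∀ φ, Realized e φ) ∧ (e (of true)).unop = a ∧ (e (of false)).unop = b := by
  obtain ⟨r, hr₀, hr, ⟨θ⟩⟩ := hS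
  have := HoledTorus.pathConnectedSpace hr
  obtain ⟨e, he⟩ := HoledTorus.exists_marking_realized hr₀ hr
  obtain ⟨e', he'⟩ := exists_marking_of_homeomorph θ x e he
  exact ⟨θ.symm.surjective.pathConnectedSpace θ.symm.continuous,
    exists_marking_of_closure_eq_top e' he' hab⟩

end

theorem proposition3p2 {S : Type*} [TopologicalSpace S] (hS : IsOneHoledTorus S) (x : S)
    (a b : FundamentalGroup S x)
    (hab : Subgroup.closure ({a, b} : Set (FundamentalGroup S x)) = ⊤) (ℓ : ℕ) :
    ((5 ≤ ℓ → (orbOfLength a b (wordClass a b [.a, .a, .b, .A, .B]) ℓ).encard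
        = ((4 * Nat.totient (ℓ - 4) : ℕ) : ℕ∞)) ∧
      (ℓ < 5 → (orbOfLength a b (wordClass a b [.a, .a, .b, .A, .B]) ℓ).encard = 0)) ∧
    ((Even ℓ → 6 ≤ ℓ → (orbOfLength a b (wordClass a b [.a, .b, .a, .B]) ℓ).encard
        = ((2 * Nat.totient (ℓ / 2) : ℕ) : ℕ∞)) ∧
      (ℓ = 4 → (orbOfLength a b (wordClass a b [.a, .b, .a, .B]) ℓ).encard = 4) ∧
      (Odd ℓ ∨ ℓ < 4 → (orbOfLength a b (wordClass a b [.a, .b, .a, .B]) ℓ).encard = 0)) := by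
  obtain ⟨hpc, e, he, ha, hb⟩ := hS.exists_marking hab
  have h₁ : wordClass a b [.a, .a, .b, .A, .B] = markedClass e FreeGroup.wordOne := by
    rw [wordClass_eq ha hb]
    rfl
  have h₂ : wordClass a b [.a, .b, .a, .B] = markedClass e FreeGroup.wordTwo := by
    rw [wordClass_eq ha hb]
    rfl
  rw [h₁, h₂, orbOfLength_markedClass he ha hb, orbOfLength_markedClass he ha hb]
  exact ⟨FreeGroup.encard_orbit_wordOne_eq _ (markedClass_eq_iff e) ℓ,
    FreeGroup.encard_orbit_wordTwo_eq _ (markedClass_eq_iff e) ℓ⟩
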